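/- **Setting.** *Arities* are the finite sequences $(\alpha_1,\dots,\alpha_n)$ of arities; $()$ has order $0$, and $(\alpha_1,\dots,\alpha_n)$ with $n\ge 1$ has order one more than the largest order of an $\alpha_i$. Everything is taken up to renaming of bound variables. *The framework TF.* Variables and constants carry arities. Objects are the expressions $z[F_1,\dots,F_n]$, where $z$ is an $(\alpha_1,\dots,\alpha_n)$-ary variable or constant and $F_i$ is an $\alpha_i$-ary abstraction; an $(\alpha_1,\dots,\alpha_n)$-ary abstraction is an expression $[x_1,\dots,x_n]M$ with $x_i$ an $\alpha_i$-ary variable and $M$ an object. Base kinds are $\mathbf{Type}$ and $El(M)$; an $(\alpha_1,\dots,\alpha_n)$-ary kind is $(x_1:K_1,\dots,x_n:K_n)T$ with $x_i$ and $K_i$ of arity $\alpha_i$ and $T$ a base kind. The $\eta$-long form of an $(\alpha_1,\dots,\alpha_n)$-ary symbol $z$ is $z^\eta=[x_1,\dots,x_n]z[x_1^\eta,\dots,x_n^\eta]$. The instantiation $\{F/x\}N$ of $F$ for $x$ of the same arity is hereditary substitution: $\{F/x\}z[\vec G]=z[\{F/x\}\vec G]$ for $z\neq x$, and $\{[t_1,\dots,t_n]P/x\}\,x[\vec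 G]=\{\{F/x\}G_1/t_1\}\cdots\{\{F/x\}G_n/t_n\}P$ where $F=[t_1,\dots,t_n]P$; and $([x]F)\bullet G=\{G/x\}F$. The primitive judgements are $\Gamma\ \mathrm{valid}$, $\Gamma\vdash M:T$ and $\Gamma\vdash M=N:T$ for base kinds $T$. The judgements $\Gamma\Vdash K\ \mathrm{kind}$, $\Gamma\Vdash K=K'$, $\Gamma\Vdash F:K$, $\Gamma\Vdash F=G:K$, $\Gamma\Vdash\vec F::\Delta$ and $\Gamma\Vdash\vec F=\vec G::\Delta$ at higher arities are the usual sets of primitive ones, for instance $(\Gamma\Vdash[\vec x]M:(\Delta)T)=\{\Gamma,\Delta\vdash M:T\}$ with $\vec x$ the variables of $\Delta$; $\mathbf{Type}=El(M)$ is undefined. The rules are: context formation; reflexivity, symmetry, transitivity; conversion along $A=B:\mathbf{Type}$; for $z:(\Delta)T$ in the context or the specification, $\Gamma\vdash z\vec F:\{\vec F/\Delta\}T$ from $\Gamma\Vdash\vec F::\Delta$, and $\Gamma\vdash z\vec F=z\vec G:\{\vec F/\Delta\}T$ from $\Gamma\Vdash\vec F=\vec G::\Delta$; for an equation declaration $(\Delta)(M=N:T)$,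 $\Gamma\vdash\{\vec F/\Delta\}M=\{\vec F/\Delta\}N:\{\vec F/\Delta\}T$ from $\Gamma\Vdash\vec F::\Delta$. A context $x_1:K_1,\dots,x_n:K_n$ has the order of the arity formed by the arities of its variables. A TF specification is *$n$-good* if, whenever $\Gamma$ has order $\le n$ and $\Gamma\vdash M=N:T$ is derivable, so are $\Gamma\vdash M:T$ and $\Gamma\vdash N:T$. *The framework LF* is the Church-typed version of Martin-Löf's logical framework, with kinds $\mathbf{Type}\mid El(k)\mid(x:K)K'$, objects $x\mid c\mid[x:K]k\mid kk'$, the judgements $\Gamma\ \mathrm{valid}$, $\Gamma\vdash K\ \mathrm{kind}$, $\Gamma\vdash k:K$, $\Gamma\vdash k=k':K$, $\Gamma\vdash K=K'$, and its usual rules (including the substitution, $\beta$ and $\eta$ rules). A specification $T$ is a set of declarations $c:K$, one for each constant, and of computation rules $(\Delta)(k=k':K)$. A declaration $c:K$ gives $\Gamma\vdash c:K$ whenever $\Gamma$ is valid and $K$ is a kind in the empty context; a computation rule gives $\Gamma\vdash[\vec k/\Delta]k=[\vec k/\Delta]k':[\vec k/\Delta]K$ whenever $\Gamma\Vdash\vec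 k::\Delta$ and both sides have kind $[\vec k/\Delta]K$ under $\Gamma$. *The translation.* $\mathrm{Ar}(\mathbf{Type})=\mathrm{Ar}(El(k))=()$ and $\mathrm{Ar}((x:K)K')$ is $\mathrm{Ar}(K)$ prepended to $\mathrm{Ar}(K')$. $\mathrm{Ar}_\Gamma(k)$ is the partial function giving variables and constants the arity of their declared kind, with $\mathrm{Ar}_\Gamma([x:K]k)$ equal to $\mathrm{Ar}(K)$ prepended to $\mathrm{Ar}_{\Gamma,x:K}(k)$, and $\mathrm{Ar}_\Gamma(kk')=\beta$ if $\mathrm{Ar}_\Gamma(k)$ is $\mathrm{Ar}_\Gamma(k')$ prepended to $\beta$. $\mathrm{NF}_\Gamma$ is the partial translation of LF into TF with $\mathrm{NF}_\Gamma(x)=x^\eta$, $\mathrm{NF}_\Gamma(c)=c^\eta$, $\mathrm{NF}_\Gamma([x:K]k)=[x]\mathrm{NF}_{\Gamma,x:K}(k)$, $\mathrm{NF}_\Gamma(kk')=\mathrm{NF}_\Gamma(k)\bullet\mathrm{NF}_\Gamma(k')$, extended componentwise to kinds, contexts, specifications and judgements (the latter becoming sets of TF judgements), and defined when all components are defined and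 of matching arities. **Theorem.** Let $T$ be a type theory specification in LF. 1. If $\mathrm{NF}_\Gamma(K)$ is defined, for a kind $K$, then it is an $\mathrm{Ar}(K)$-ary kind. For an object $k$, $\mathrm{NF}_\Gamma(k)$ is defined as an $\alpha$-ary abstraction if and only if $\mathrm{Ar}_\Gamma(k)=\alpha$. 2. Let $\Gamma\subseteq\Delta$ and let $X$ be an LF-object, kind or context. If $\mathrm{NF}_\Gamma(X)$ is defined, then $\mathrm{NF}_\Delta(X)$ is defined and $\mathrm{NF}_\Delta(X)\equiv\mathrm{NF}_\Gamma(X)$. More generally, the corresponding statement holds for every renaming of the variables of $\Gamma$ to variables of $\Delta$ that respects the declared kinds. 3. Suppose $\mathrm{Ar}_\Gamma(k)=\mathrm{Ar}(K)$, and let $X$ be an LF-object, kind or context. If $\mathrm{NF}_\Gamma(k)$ and $\mathrm{NF}_{\Gamma,x:K,\Delta}(X)$ are defined, then $\mathrm{NF}_{\Gamma,[k/x]\Delta}([k/x]X)$ is defined and $$\mathrm{NF}_{\Gamma,[k/x]\Delta}([k/x]X)\equiv\{\mathrm{NF}_\Gamma(k)/x\}\,\mathrm{NF}_{\Gamma,x:K,\Delta}(X).$$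 4. Suppose $\mathrm{NF}(T)$ is defined and is an $n$-good specification in TF. If a judgement $\mathcal J$ is derivable in LF under $T$ and its context has order $\le n$, then $\mathrm{NF}(\mathcal J)$ is defined and every TF judgement in $\mathrm{NF}(\mathcal J)$ is derivable in TF under $\mathrm{NF}(T)$. -/

import Mathlib

universe u

/-! ## Arities -/

/-- Arities are the finite sequences of arities: `zero` is the empty sequence `()`, and
`cons α (α₁, …, αₙ)` is `(α, α₁, …, αₙ)`, i.e. the concatenation `(α) ^ (α₁, …, αₙ)`. -/
inductive Arity where
  | zero : Arity
  | cons (head tail : Arity) : Arity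
  deriving DecidableEq

/-- The order of an arity: `()` has order `0`, and `(α₁, …, αₙ)` with `n > 0` has order
`1 + max (order αᵢ)`. -/
def Arity.order : Arity → ℕ
  | .zero => 0
  | .cons α β => max (α.order + 1) β.order

/-- The order of a context whose variables have the arities listed in `A`, i.e. the order of the
arity formed by the sequence `A` (`0` for the empty context, otherwise one more than the
largest order of an entry). -/
def ctxOrder (A : List Arity) : ℕ := A.foldr (fun α m => max (α.order + 1) m) 0

/-- `Var A α`: the variables of arity `α` in scope `A` (de Bruijn; the head of `A` is the most
recently introduced variable). -/
inductive Var : List Arity → Arity → Type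
  | zero {A : List Arity} {α : Arity} : Var (α :: A) α
  | succ {A : List Arity} {α β : Arity} (x : Var A α) : Var (β :: A) α

/-- The de Bruijn index of a variable. -/
def Var.toNat : {A : List Arity} → {α : Arity} → Var A α → ℕ
  | _, _, .zero => 0
  | _, _, .succ x => x.toNat + 1

/-- The variable with a given de Bruijn index, together with its arity. -/
def Var.find : (A : List Arity) → ℕ → Option (Σ α, Var A α)
  | [], _ => none
  | α :: _, 0 => some ⟨α, .zero⟩
  | _ :: A, i + 1 => (Var.find A i).map fun p => ⟨p.1, p.2.succ⟩

/-- Arity-preserving renamings. -/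
abbrev Ren (A B : List Arity) : Type := ∀ α : Arity, Var A α → Var B α

/-- Extension of a renaming under one binder. -/
def Ren.lift {A B : List Arity} {γ : Arity} (ρ : Ren A B) : Ren (γ :: A) (γ :: B)
  | _, .zero => .zero
  | _, .succ x => .succ (ρ _ x)

/-- Extension of a renaming under the binders `D`. -/
def Ren.liftN {A B : List Arity} (ρ : Ren A B) : (D : List Arity) → Ren (D ++ A) (D ++ B)
  | [] => ρ
  | _ :: D => (Ren.liftN ρ D).lift

/-- Weakening by one variable. -/
def Ren.wk {A : List Arity} {γ : Arity} : Ren A (γ :: A) := fun _ x => x.succ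

/-! ## The lambda-free framework TF: syntax -/

namespace TF

/-- Syntactic categories: `α`-ary abstractions and `α`-ary abstraction sequences. -/
inductive Cat where
  | abs (α : Arity) : Cat
  | seq (α : Arity) : Cat

/-- `Head ar A α`: the `α`-ary variables (from the scope `A`) and the `α`-ary constants, where
`ar` assigns an arity to each constant. -/
inductive Head {C : Type u} (ar : C → Arity) (A : List Arity) : Arity → Type u
  | var {α : Arity} (x : Var A α) : Head ar A α
  | con (c : C) : Head ar A (ar c)

/-- Abstractions and abstraction sequences in scope `A`, up to renaming of bound variables.
Objects are the `0`-ary abstractions; they have the form `z[F₁, …, Fₙ]` with `z` an `α`-ary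
variable or constant and `F` an `α`-ary abstraction sequence.  `lam F` is `[x]F`. -/
inductive Expr {C : Type u} (ar : C → Arity) : List Arity → Cat → Type u
  | app {A : List Arity} {α : Arity} (z : Head ar A α) (S : Expr ar A (.seq α)) :
      Expr ar A (.abs .zero)
  | lam {A : List Arity} {α β : Arity} (F : Expr ar (α :: A) (.abs β)) :
      Expr ar A (.abs (.cons α β))
  | nil {A : List Arity} : Expr ar A (.seq .zero)
  | cons {A : List Arity} {α β : Arity} (F : Expr ar A (.abs α)) (S : Expr ar A (.seq β)) :
      Expr ar A (.seq (.cons α β))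

/-- `α`-ary abstractions. -/
abbrev Abs {C : Type u} (ar : C → Arity) (A : List Arity) (α : Arity) : Type u :=
  Expr ar A (.abs α)

/-- `α`-ary abstraction sequences. -/
abbrev Seq {C : Type u} (ar : C → Arity) (A : List Arity) (α : Arity) : Type u :=
  Expr ar A (.seq α)

/-- Objects. -/
abbrev Obj {C : Type u} (ar : C → Arity) (A : List Arity) : Type u := Abs ar A .zero

variable {C : Type u} {ar : C → Arity}

/-- Renaming of a variable or constant. -/
def Head.rename {A B : List Arity} {α : Arity} (ρ : Ren A B) : Head ar A α → Head ar B α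
  | .var x => .var (ρ _ x)
  | .con c => .con c

/-- Renaming of abstractions and sequences. -/
def Expr.rename {A B : List Arity} {s : Cat} (ρ : Ren A B) : Expr ar A s → Expr ar B s
  | .app z S => .app (z.rename ρ) (S.rename ρ)
  | .lam F => .lam (F.rename ρ.lift)
  | .nil => .nil
  | .cons F S => .cons (F.rename ρ) (S.rename ρ)

/-- The `F` of `[x]F`. -/
def Expr.body {A : List Arity} {α β : Arity} : Abs ar A (.cons α β) → Abs ar (α :: A) β
  | .lam F => F

/-- The first member of a sequence. -/
def Expr.head {A : List Arity} {α β : Arity} : Seq ar A (.cons α β) → Abs ar A α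
  | .cons F _ => F

/-- All members of a sequence but the first. -/
def Expr.tail {A : List Arity} {α β : Arity} : Seq ar A (.cons α β) → Seq ar A β
  | .cons _ S => S

/-! ### Eta-long forms -/

/-- The scope `A` extended by variables of the arities `α₁, …, αₙ`, where `(α₁, …, αₙ)` is the
given arity. -/
def ext : Arity → List Arity → List Arity
  | .zero, A => A
  | .cons α β, A => ext β (α :: A)

/-- The inclusion of `A` into `ext α A`. -/
def wkExt : (α : Arity) → (A : List Arity) → Ren A (ext α A)
  | .zero, _ => fun _ x => x
  | .cons α β, A => fun _ x => wkExt β (α :: A) _ x.succ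

/-- `[x₁, …, xₙ]M`. -/
def lamAll : (α : Arity) → {A : List Arity} → Obj ar (ext α A) → Abs ar A α
  | .zero, _, M => M
  | .cons _ β, _, M => .lam (lamAll β M)

/-- The sequence `x₁^η, …, xₙ^η` of the eta-long forms of the variables added by `ext α A`. -/
def etaSeq : (α : Arity) → (A : List Arity) → Seq ar (ext α A) α
  | .zero, _ => .nil
  | .cons α β, A =>
      .cons
        (Expr.rename (wkExt β (α :: A))
          (lamAll α (.app (.var (wkExt α (α :: A) α .zero)) (etaSeq α (α :: A)))))
        (etaSeq β (α :: A))

/-- The eta-long form `z^η = [x₁, …, xₙ] z[x₁^η, …, xₙ^η]` of an `α`-ary variable or constant,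
`α = (α₁, …, αₙ)`. -/
def eta {A : List Arity} {α : Arity} (z : Head ar A α) : Abs ar A α :=
  lamAll α (.app (z.rename (wkExt α A)) (etaSeq α A))

/-! ### Instantiation and employment -/

/-- What is put for a variable when an `α`-ary abstraction is instantiated for one `α`-ary
variable: another variable, or the abstraction. -/
inductive Img {C : Type u} (ar : C → Arity) (α : Arity) (B : List Arity) : Arity → Type u
  | var {β : Arity} (x : Var B β) : Img ar α B β
  | abs (F : Abs ar B α) : Img ar α B α

/-- Weakening by one variable. -/
def Img.weaken {α β γ : Arity} {B : List Arity} : Img ar α B β → Img ar α (γ :: B) β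
  | .var x => .var x.succ
  | .abs F => .abs (F.rename Ren.wk)

/-- An assignment of images to all variables of a scope. -/
abbrev Env {C : Type u} (ar : C → Arity) (α : Arity) (A B : List Arity) : Type u :=
  ∀ β : Arity, Var A β → Img ar α B β

/-- The assignment that sends the last variable to `F` and fixes all others. -/
def Env.single {α : Arity} {A : List Arity} (F : Abs ar A α) : Env ar α (α :: A) A
  | _, .zero => .abs F
  | _, .succ x => .var x

/-- Extension under one binder. -/
def Env.lift {α γ : Arity} {A B : List Arity} (σ : Env ar α A B) : Env ar α (γ :: A) (γ :: B)
  | _, .zero => .var .zero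
  | _, .succ x => (σ _ x).weaken

/-- Extension under the binders `D`. -/
def Env.liftN {α : Arity} {A B : List Arity} (σ : Env ar α A B) :
    (D : List Arity) → Env ar α (D ++ A) (D ++ B)
  | [] => σ
  | _ :: D => (Env.liftN σ D).lift

/-- `z[S]` when the image of `z` is a variable; `ap F S` when it is the abstraction `F`. -/
def Img.plug {α β : Arity} {B : List Arity} (ap : Abs ar B α → Seq ar B α → Obj ar B) :
    Img ar α B β → Seq ar B β → Obj ar B
  | .var x, S => .app (.var x) S
  | .abs F, S => ap F S

/-- The object that results from `z[…]`, given the new arguments `S`. -/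
def Head.plug {α β : Arity} {A B : List Arity} (ap : Abs ar B α → Seq ar B α → Obj ar B)
    (σ : Env ar α A B) : Head ar A β → Seq ar B β → Obj ar B
  | .var x, S => (σ _ x).plug ap S
  | .con c, S => .app (.con c) S

/-- The recursion on the expression in the definition of instantiation; `ap` says how an `α`-ary
abstraction is employed on an `α`-ary sequence. -/
def Expr.substWith {α : Arity} (ap : ∀ B : List Arity, Abs ar B α → Seq ar B α → Obj ar B)
    {A B : List Arity} {s : Cat} (σ : Env ar α A B) : Expr ar A s → Expr ar B s
  | .app z S => z.plug (ap B) σ (S.substWith ap σ)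
  | .lam F => .lam (F.substWith ap σ.lift)
  | .nil => .nil
  | .cons F S => .cons (F.substWith ap σ) (S.substWith ap σ)

/-- The recursion on the arity in the definition of instantiation: for `F = [t₁, …, tₙ]P`,
`employSeq α A F (G₁, …, Gₙ)` instantiates `G₁, …, Gₙ` for `t₁, …, tₙ` in `P`; in other words it
is `F • G₁ • ⋯ • Gₙ`. -/
def employSeq : (α : Arity) → (A : List Arity) → Abs ar A α → Seq ar A α → Obj ar A
  | .zero, _, F, _ => F
  | .cons α β, A, F, S =>
      employSeq β A (Expr.substWith (employSeq α) (Env.single S.head) F.body) S.tail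

/-- Hereditary substitution of abstractions for variables along `σ`. -/
def Expr.subst {α : Arity} {A B : List Arity} {s : Cat} (σ : Env ar α A B) (N : Expr ar A s) :
    Expr ar B s :=
  N.substWith (employSeq α) σ

/-- Instantiation `{F/x}N`, where `x` is an `α`-ary variable, `N` is in scope `A, x, D` and
`F` is in scope `A`. -/
def Expr.inst {α : Arity} {A : List Arity} {s : Cat} (D : List Arity) (F : Abs ar A α)
    (N : Expr ar (D ++ α :: A) s) : Expr ar (D ++ A) s :=
  N.subst ((Env.single F).liftN D)

/-- Employment `([x]F) • G = {G/x}F`. -/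
def Expr.employ {A : List Arity} {α β : Arity} (F : Abs ar A (.cons α β)) (G : Abs ar A α) :
    Abs ar A β :=
  Expr.inst [] G F.body

/-! ### Kinds and contexts -/

/-- `α`-ary kinds.  The base kinds are the `0`-ary ones, `Type` and `El(M)`; `pi K K'` is
`(x : K)K'`, so that an `(α₁, …, αₙ)`-ary kind is `(x₁ : K₁, …, xₙ : Kₙ)T` with `xᵢ` and `Kᵢ` of
arity `αᵢ` and `T` a base kind. -/
inductive Kind {C : Type u} (ar : C → Arity) : List Arity → Arity → Type u
  | type {A : List Arity} : Kind ar A .zero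
  | el {A : List Arity} (M : Obj ar A) : Kind ar A .zero
  | pi {A : List Arity} {α β : Arity} (K : Kind ar A α) (K' : Kind ar (α :: A) β) :
      Kind ar A (.cons α β)

/-- Base kinds. -/
abbrev Base {C : Type u} (ar : C → Arity) (A : List Arity) : Type u := Kind ar A .zero

/-- Renaming of kinds. -/
def Kind.rename {A B : List Arity} {α : Arity} (ρ : Ren A B) : Kind ar A α → Kind ar B α
  | .type => .type
  | .el M => .el (M.rename ρ)
  | .pi K K' => .pi (K.rename ρ) (K'.rename ρ.lift)

/-- Hereditary substitution in kinds. -/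
def Kind.subst {α β : Arity} {A B : List Arity} (σ : Env ar α A B) : Kind ar A β → Kind ar B β
  | .type => .type
  | .el M => .el (M.subst σ)
  | .pi K K' => .pi (K.subst σ) (K'.subst σ.lift)

/-- Instantiation `{F/x}K` in kinds; `K` is in scope `A, x, D` and `F` in scope `A`. -/
def Kind.inst {α β : Arity} {A : List Arity} (D : List Arity) (F : Abs ar A α)
    (K : Kind ar (D ++ α :: A) β) : Kind ar (D ++ A) β :=
  K.subst ((Env.single F).liftN D)

/-- The `K'` of `(x : K)K'`. -/
def Kind.cod {A : List Arity} {α β : Arity} : Kind ar A (.cons α β) → Kind ar (α :: A) β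
  | .pi _ K' => K'

/-- The base kind `{S/Δ}T`, for the kind `(Δ)T` and a sequence `S` of the same arity. -/
def Kind.instSeq : (α : Arity) → {A : List Arity} → Kind ar A α → Seq ar A α → Base ar A
  | .zero, _, K, _ => K
  | .cons _ β, _, K, S => Kind.instSeq β (Kind.inst [] S.head K.cod) S.tail

/-- Contexts; `Ctx ar A` consists of the contexts `x₁ : K₁, …, xₙ : Kₙ` whose variables have the
arities listed in `A` (in reverse order). -/
inductive Ctx {C : Type u} (ar : C → Arity) : List Arity → Type u
  | nil : Ctx ar []
  | snoc {A : List Arity} {α : Arity} (Γ : Ctx ar A) (K : Kind ar A α) : Ctx ar (α :: A)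

/-- The kind of a variable in a context. -/
def Ctx.lookup : {A : List Arity} → {α : Arity} → Ctx ar A → Var A α → Kind ar A α
  | _, _, .snoc _ K, .zero => K.rename Ren.wk
  | _, _, .snoc Γ _, .succ x => (Γ.lookup x).rename Ren.wk

/-- Context extensions: `Tele ar A D` consists of the sequences of declarations that may follow a
context with the arities `A`, and that declare variables of the arities `D`. -/
inductive Tele {C : Type u} (ar : C → Arity) (A : List Arity) : List Arity → Type u
  | nil : Tele ar A []
  | snoc {D : List Arity} {α : Arity} (Θ : Tele ar A D) (K : Kind ar (D ++ A) α) :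
      Tele ar A (α :: D)

/-- Renaming of context extensions. -/
def Tele.rename {A B : List Arity} (ρ : Ren A B) : {D : List Arity} → Tele ar A D → Tele ar B D
  | _, .nil => .nil
  | _, .snoc (D := D) Θ K => .snoc (Θ.rename ρ) (K.rename (ρ.liftN D))

/-- Hereditary substitution in context extensions. -/
def Tele.subst {α : Arity} {A B : List Arity} (σ : Env ar α A B) :
    {D : List Arity} → Tele ar A D → Tele ar B D
  | _, .nil => .nil
  | _, .snoc (D := D) Θ K => .snoc (Θ.subst σ) (K.subst (σ.liftN D))

/-- Instantiation `{F/x}Θ` in context extensions; `Θ` extends a context in scope `A, x, D`. -/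
def Tele.inst {α : Arity} {A E : List Arity} (D : List Arity) (F : Abs ar A α)
    (Θ : Tele ar (D ++ α :: A) E) : Tele ar (D ++ A) E :=
  Θ.subst ((Env.single F).liftN D)

/-! ## TF: judgements and derivability -/

/-- The primitive judgement forms `Γ valid`, `Γ ⊢ M : T` and `Γ ⊢ M = N : T`. -/
inductive Judg {C : Type u} (ar : C → Arity) : Type u
  | valid {A : List Arity} (Γ : Ctx ar A) : Judg ar
  | typ {A : List Arity} (Γ : Ctx ar A) (M : Obj ar A) (T : Base ar A) : Judg ar
  | eq {A : List Arity} (Γ : Ctx ar A) (M N : Obj ar A) (T : Base ar A) : Judg ar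

/-- The defined judgement `Γ ⊩ K kind`. -/
def kindJ : {A : List Arity} → {α : Arity} → Ctx ar A → Kind ar A α → Set (Judg ar)
  | _, _, Γ, .type => {.valid Γ}
  | _, _, Γ, .el M => {.typ Γ M .type}
  | _, _, Γ, .pi K K' => kindJ (Γ.snoc K) K'

/-- The defined judgement `Γ ⊩ K = K'`, for kinds of the same arity; it is undefined (`none`) when
somewhere `Type` would have to be compared with some `El(M)`. -/
def kindEqJ : {A : List Arity} → {α : Arity} → Ctx ar A → Kind ar A α → Kind ar A α →
    Option (Set (Judg ar))
  | _, _, Γ, .type, .type => some {.valid Γ}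
  | _, _, Γ, .el M, .el N => some {.eq Γ M N .type}
  | _, _, _, .type, .el _ => none
  | _, _, _, .el _, .type => none
  | _, _, Γ, .pi K L, .pi K' L' =>
      (kindEqJ Γ K K').bind fun s => (kindEqJ (Γ.snoc K) L L').map fun t => {.valid Γ} ∪ s ∪ t

/-- The defined judgement `Γ ⊩ F : K`, i.e. `Γ, Δ ⊢ M : T` for `F = [x₁, …, xₙ]M` and
`K = (Δ)T`. -/
def absJ : {A : List Arity} → {α : Arity} → Ctx ar A → Abs ar A α → Kind ar A α → Set (Judg ar)
  | _, _, Γ, M, .type => {.typ Γ M .type}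
  | _, _, Γ, M, .el N => {.typ Γ M (.el N)}
  | _, _, Γ, F, .pi K K' => absJ (Γ.snoc K) F.body K'

/-- The defined judgement `Γ ⊩ F = G : K`, i.e. `Γ, Δ ⊢ M = N : T` for `F = [x₁, …, xₙ]M`,
`G = [x₁, …, xₙ]N` and `K = (Δ)T`. -/
def absEqJ : {A : List Arity} → {α : Arity} → Ctx ar A → Abs ar A α → Abs ar A α → Kind ar A α →
    Set (Judg ar)
  | _, _, Γ, M, N, .type => {.eq Γ M N .type}
  | _, _, Γ, M, N, .el P => {.eq Γ M N (.el P)}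
  | _, _, Γ, F, G, .pi K K' => absEqJ (Γ.snoc K) F.body G.body K'

/-- The `K` of `(x : K)K'`. -/
def Kind.dom {A : List Arity} {α β : Arity} : Kind ar A (.cons α β) → Kind ar A α
  | .pi K _ => K

/-- The defined judgement `Γ ⊩ S :: Δ`, where `Δ` is given through a kind `(Δ)T`: the members
`F₁, F₂, …` of `S` have the kinds `K₁`, `{F₁/x₁}K₂`, …, and `Γ` is valid. -/
def seqJ : (α : Arity) → {A : List Arity} → Ctx ar A → Seq ar A α → Kind ar A α → Set (Judg ar)
  | .zero, _, Γ, _, _ => {.valid Γ}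
  | .cons _ β, _, Γ, S, K =>
      absJ Γ S.head K.dom ∪ seqJ β Γ S.tail (Kind.inst [] S.head K.cod)

/-- The defined judgement `Γ ⊩ S = S' :: Δ`, where `Δ` is given through a kind `(Δ)T`. -/
def seqEqJ : (α : Arity) → {A : List Arity} → Ctx ar A → Seq ar A α → Seq ar A α → Kind ar A α →
    Set (Judg ar)
  | .zero, _, Γ, _, _, _ => {.valid Γ}
  | .cons _ β, _, Γ, S, S', K =>
      absEqJ Γ S.head S'.head K.dom ∪ seqEqJ β Γ S.tail S'.tail (Kind.inst [] S.head K.cod)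

/-- An equation declaration `(Δ)(M = N : T)`: `arity` is the arity of `Δ`, `kind` is `(Δ)T`,
`lhs` is `[x₁, …, xₙ]M` and `rhs` is `[x₁, …, xₙ]N`, where `x₁, …, xₙ` are the variables
of `Δ`. -/
structure EqDecl {C : Type u} (ar : C → Arity) : Type u where
  arity : Arity
  kind : Kind ar [] arity
  lhs : Abs ar [] arity
  rhs : Abs ar [] arity

/-- A type theory specification: a declaration `c : K` for each constant `c`, with `K` of the
arity of `c`, and a set of equation declarations. -/
structure Spec {C : Type u} (ar : C → Arity) : Type u where
  kind : ∀ c : C, Kind ar [] (ar c)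
  eqns : Set (EqDecl ar)

/-- The renaming from the empty scope. -/
def Ren.empty (A : List Arity) : Ren [] A := fun _ x => nomatch x

/-- Derivability in TF under the specification `S`. -/
inductive Derivable (S : Spec ar) : Judg ar → Prop
  | emp_ctxt : Derivable S (.valid .nil)
  | ctxt {A : List Arity} {α : Arity} {Γ : Ctx ar A} {K : Kind ar A α} :
      (∀ J ∈ kindJ Γ K, Derivable S J) → Derivable S (.valid (Γ.snoc K))
  | var {A : List Arity} {α : Arity} {Γ : Ctx ar A} (x : Var A α) {F : Seq ar A α} :
      (∀ J ∈ seqJ α Γ F (Γ.lookup x), Derivable S J) →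
      Derivable S (.typ Γ (.app (.var x) F) (Kind.instSeq α (Γ.lookup x) F))
  | var_eq {A : List Arity} {α : Arity} {Γ : Ctx ar A} (x : Var A α) {F G : Seq ar A α} :
      (∀ J ∈ seqEqJ α Γ F G (Γ.lookup x), Derivable S J) →
      Derivable S (.eq Γ (.app (.var x) F) (.app (.var x) G) (Kind.instSeq α (Γ.lookup x) F))
  | const {A : List Arity} {Γ : Ctx ar A} (c : C) {F : Seq ar A (ar c)} :
      (∀ J ∈ seqJ (ar c) Γ F ((S.kind c).rename (Ren.empty A)), Derivable S J) →
      Derivable S (.typ Γ (.app (.con c) F)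
        (Kind.instSeq (ar c) ((S.kind c).rename (Ren.empty A)) F))
  | const_eq {A : List Arity} {Γ : Ctx ar A} (c : C) {F G : Seq ar A (ar c)} :
      (∀ J ∈ seqEqJ (ar c) Γ F G ((S.kind c).rename (Ren.empty A)), Derivable S J) →
      Derivable S (.eq Γ (.app (.con c) F) (.app (.con c) G)
        (Kind.instSeq (ar c) ((S.kind c).rename (Ren.empty A)) F))
  | eq {A : List Arity} {Γ : Ctx ar A} (d : EqDecl ar) (hd : d ∈ S.eqns)
      {F : Seq ar A d.arity} :
      (∀ J ∈ seqJ d.arity Γ F (d.kind.rename (Ren.empty A)), Derivable S J) →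
      Derivable S (.eq Γ (employSeq d.arity A (d.lhs.rename (Ren.empty A)) F)
        (employSeq d.arity A (d.rhs.rename (Ren.empty A)) F)
        (Kind.instSeq d.arity (d.kind.rename (Ren.empty A)) F))
  | ref {A : List Arity} {Γ : Ctx ar A} {M : Obj ar A} {T : Base ar A} :
      Derivable S (.typ Γ M T) → Derivable S (.eq Γ M M T)
  | sym {A : List Arity} {Γ : Ctx ar A} {M N : Obj ar A} {T : Base ar A} :
      Derivable S (.eq Γ M N T) → Derivable S (.eq Γ N M T)
  | trans {A : List Arity} {Γ : Ctx ar A} {M N P : Obj ar A} {T : Base ar A} :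
      Derivable S (.eq Γ M N T) → Derivable S (.eq Γ N P T) → Derivable S (.eq Γ M P T)
  | conv {A : List Arity} {Γ : Ctx ar A} {M P Q : Obj ar A} :
      Derivable S (.typ Γ M (.el P)) → Derivable S (.eq Γ P Q .type) →
      Derivable S (.typ Γ M (.el Q))
  | conv_eq {A : List Arity} {Γ : Ctx ar A} {M N P Q : Obj ar A} :
      Derivable S (.eq Γ M N (.el P)) → Derivable S (.eq Γ P Q .type) →
      Derivable S (.eq Γ M N (.el Q))

/-- `S` is `n`-good: in contexts of order at most `n`, both sides of a derivable equation have
the kind at which they are equal. -/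
def Spec.Good (S : Spec ar) (n : ℕ) : Prop :=
  ∀ (A : List Arity) (Γ : Ctx ar A) (M N : Obj ar A) (T : Base ar A), ctxOrder A ≤ n →
    Derivable S (.eq Γ M N T) → Derivable S (.typ Γ M T) ∧ Derivable S (.typ Γ N T)

end TF

/-! ## The framework LF -/

namespace LF

/-- Syntactic categories of LF. -/
inductive Cat where
  | kind : Cat
  | obj : Cat

/-- Kinds and objects of LF over a set `C` of constants, up to renaming of bound variables
(de Bruijn): `pi K K'` is `(x : K)K'` and `lam K k` is `[x : K]k`. -/
inductive Expr (C : Type u) : Cat → Type u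
  | type : Expr C .kind
  | el (k : Expr C .obj) : Expr C .kind
  | pi (K K' : Expr C .kind) : Expr C .kind
  | var (i : ℕ) : Expr C .obj
  | con (c : C) : Expr C .obj
  | lam (K : Expr C .kind) (k : Expr C .obj) : Expr C .obj
  | app (k k' : Expr C .obj) : Expr C .obj

/-- Kinds. -/
abbrev Kind (C : Type u) : Type u := Expr C .kind

/-- Objects. -/
abbrev Obj (C : Type u) : Type u := Expr C .obj

/-- Contexts, and context extensions; the head of the list is the kind of the most recently
declared variable. -/
abbrev Ctx (C : Type u) : Type u := List (Kind C)

variable {C : Type u}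

/-- Extension of a renaming of indices under one binder. -/
def liftRen (ρ : ℕ → ℕ) : ℕ → ℕ
  | 0 => 0
  | i + 1 => ρ i + 1

/-- Extension of a renaming of indices under `n` binders. -/
def liftRenN (ρ : ℕ → ℕ) : ℕ → ℕ → ℕ
  | 0 => ρ
  | n + 1 => liftRen (liftRenN ρ n)

/-- Renaming of free variables. -/
def Expr.rename {s : Cat} (ρ : ℕ → ℕ) : Expr C s → Expr C s
  | .type => .type
  | .el k => .el (k.rename ρ)
  | .pi K K' => .pi (K.rename ρ) (K'.rename (liftRen ρ))
  | .var i => .var (ρ i)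
  | .con c => .con c
  | .lam K k => .lam (K.rename ρ) (k.rename (liftRen ρ))
  | .app k k' => .app (k.rename ρ) (k'.rename ρ)

/-- Weakening by one variable. -/
def Expr.weaken {s : Cat} (e : Expr C s) : Expr C s := e.rename Nat.succ

/-- Extension of a substitution under one binder. -/
def liftSub (σ : ℕ → Obj C) : ℕ → Obj C
  | 0 => .var 0
  | i + 1 => (σ i).weaken

/-- Extension of a substitution under `n` binders. -/
def liftSubN (σ : ℕ → Obj C) : ℕ → ℕ → Obj C
  | 0 => σ
  | n + 1 => liftSub (liftSubN σ n)

/-- Simultaneous capture-avoiding substitution. -/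
def Expr.subst {s : Cat} (σ : ℕ → Obj C) : Expr C s → Expr C s
  | .type => .type
  | .el k => .el (k.subst σ)
  | .pi K K' => .pi (K.subst σ) (K'.subst (liftSub σ))
  | .var i => σ i
  | .con c => .con c
  | .lam K k => .lam (K.subst σ) (k.subst (liftSub σ))
  | .app k k' => .app (k.subst σ) (k'.subst σ)

/-- The substitution of the members of a list for the last variables (the head of the list for
the most recent one). -/
def listSub (ks : List (Obj C)) (i : ℕ) : Obj C := (ks[i]?).getD (.var (i - ks.length))

/-- `[k/x]e`, where `d` variables have been declared after `x`. -/
def Expr.inst {s : Cat} (d : ℕ) (k : Obj C) (e : Expr C s) : Expr C s :=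
  e.subst (liftSubN (listSub [k]) d)

/-- `[k/x]Θ`, for a context extension `Θ`, where `d` variables have been declared between `x`
and `Θ`. -/
def Ctx.inst (d : ℕ) (k : Obj C) : Ctx C → Ctx C
  | [] => []
  | K :: Θ => Expr.inst (Θ.length + d) k K :: Ctx.inst d k Θ

/-- Renaming of a context extension. -/
def Ctx.rename (ρ : ℕ → ℕ) : Ctx C → Ctx C
  | [] => []
  | K :: Θ => K.rename (liftRenN ρ Θ.length) :: Ctx.rename ρ Θ

/-- The kind of a variable in a context. -/
def Ctx.lookup : Ctx C → ℕ → Option (Kind C)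
  | [], _ => none
  | K :: _, 0 => some K.weaken
  | _ :: Γ, i + 1 => (Ctx.lookup Γ i).map Expr.weaken

/-- `(Δ)K`. -/
def piAll : Ctx C → Kind C → Kind C
  | [], K => K
  | L :: Δ, K => piAll Δ (.pi L K)

/-- `[Δ]k`. -/
def lamAll : Ctx C → Obj C → Obj C
  | [], k => k
  | L :: Δ, k => lamAll Δ (.lam L k)

/-- A computation rule `(Δ)(k = k' : K)`. -/
structure EqDecl (C : Type u) : Type u where
  ctx : Ctx C
  lhs : Obj C
  rhs : Obj C
  kind : Kind C

/-- A type theory specification: a declaration `c : K` for each constant `c`, and a set of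
computation rules. -/
structure Spec (C : Type u) : Type u where
  kind : C → Kind C
  eqns : Set (EqDecl C)

/-- The judgement forms `Γ valid`, `Γ ⊢ K kind`, `Γ ⊢ k : K`, `Γ ⊢ k = k' : K` and
`Γ ⊢ K = K'`. -/
inductive Judg (C : Type u) : Type u
  | valid (Γ : Ctx C) : Judg C
  | kind (Γ : Ctx C) (K : Kind C) : Judg C
  | typ (Γ : Ctx C) (k : Obj C) (K : Kind C) : Judg C
  | eq (Γ : Ctx C) (k k' : Obj C) (K : Kind C) : Judg C
  | keq (Γ : Ctx C) (K K' : Kind C) : Judg C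

/-- The context of a judgement. -/
def Judg.ctx : Judg C → Ctx C
  | .valid Γ => Γ
  | .kind Γ _ => Γ
  | .typ Γ _ _ => Γ
  | .eq Γ _ _ _ => Γ
  | .keq Γ _ _ => Γ

/-- The judgements `Γ ⊢ k₁ : K₁`, `Γ ⊢ k₂ : [k₁/x₁]K₂`, … that make up
`Γ ⊩ (k₁, …, kₙ) :: Δ`. -/
def seqJ (Γ : Ctx C) : List (Obj C) → Ctx C → Set (Judg C)
  | k :: ks, K :: Δ => {.typ Γ k (K.subst (listSub ks))} ∪ seqJ Γ ks Δ
  | _, _ => ∅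

/-- Derivability in LF (the Church-typed version of Martin-Löf's logical framework) under the
specification `T`.  A declaration `c : K` takes effect where `K` is a kind in the empty context,
and a computation rule takes effect where both sides of the instance have its kind. -/
inductive Derivable (T : Spec C) : Judg C → Prop
  -- contexts and assumptions
  | emp : Derivable T (.valid [])
  | ctxt {Γ : Ctx C} {K : Kind C} : Derivable T (.kind Γ K) → Derivable T (.valid (K :: Γ))
  | var {Γ : Ctx C} {i : ℕ} {K : Kind C} :
      Derivable T (.valid Γ) → Ctx.lookup Γ i = some K → Derivable T (.typ Γ (.var i) K)
  -- general equality rules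
  | kref {Γ : Ctx C} {K : Kind C} : Derivable T (.kind Γ K) → Derivable T (.keq Γ K K)
  | ksym {Γ : Ctx C} {K K' : Kind C} : Derivable T (.keq Γ K K') → Derivable T (.keq Γ K' K)
  | ktrans {Γ : Ctx C} {K K' K'' : Kind C} :
      Derivable T (.keq Γ K K') → Derivable T (.keq Γ K' K'') → Derivable T (.keq Γ K K'')
  | ref {Γ : Ctx C} {k : Obj C} {K : Kind C} :
      Derivable T (.typ Γ k K) → Derivable T (.eq Γ k k K)
  | sym {Γ : Ctx C} {k k' : Obj C} {K : Kind C} :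
      Derivable T (.eq Γ k k' K) → Derivable T (.eq Γ k' k K)
  | trans {Γ : Ctx C} {k k' k'' : Obj C} {K : Kind C} :
      Derivable T (.eq Γ k k' K) → Derivable T (.eq Γ k' k'' K) → Derivable T (.eq Γ k k'' K)
  -- equality typing rules
  | conv {Γ : Ctx C} {k : Obj C} {K K' : Kind C} :
      Derivable T (.typ Γ k K) → Derivable T (.keq Γ K K') → Derivable T (.typ Γ k K')
  | conv_eq {Γ : Ctx C} {k k' : Obj C} {K K' : Kind C} :
      Derivable T (.eq Γ k k' K) → Derivable T (.keq Γ K K') → Derivable T (.eq Γ k k' K')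
  -- substitution rules
  | subst_valid {Γ Δ : Ctx C} {K : Kind C} {k : Obj C} :
      Derivable T (.valid (Δ ++ K :: Γ)) → Derivable T (.typ Γ k K) →
      Derivable T (.valid (Ctx.inst 0 k Δ ++ Γ))
  | subst_kind {Γ Δ : Ctx C} {K K' : Kind C} {k : Obj C} :
      Derivable T (.kind (Δ ++ K :: Γ) K') → Derivable T (.typ Γ k K) →
      Derivable T (.kind (Ctx.inst 0 k Δ ++ Γ) (Expr.inst Δ.length k K'))
  | subst_kind_eq {Γ Δ : Ctx C} {K K' : Kind C} {k k' : Obj C} :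
      Derivable T (.kind (Δ ++ K :: Γ) K') → Derivable T (.eq Γ k k' K) →
      Derivable T (.keq (Ctx.inst 0 k Δ ++ Γ) (Expr.inst Δ.length k K') (Expr.inst Δ.length k' K'))
  | subst_typ {Γ Δ : Ctx C} {K K' : Kind C} {k l : Obj C} :
      Derivable T (.typ (Δ ++ K :: Γ) l K') → Derivable T (.typ Γ k K) →
      Derivable T (.typ (Ctx.inst 0 k Δ ++ Γ) (Expr.inst Δ.length k l) (Expr.inst Δ.length k K'))
  | subst_typ_eq {Γ Δ : Ctx C} {K K' : Kind C} {k k' l : Obj C} :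
      Derivable T (.typ (Δ ++ K :: Γ) l K') → Derivable T (.eq Γ k k' K) →
      Derivable T (.eq (Ctx.inst 0 k Δ ++ Γ) (Expr.inst Δ.length k l) (Expr.inst Δ.length k' l)
        (Expr.inst Δ.length k K'))
  | subst_keq {Γ Δ : Ctx C} {K K' K'' : Kind C} {k : Obj C} :
      Derivable T (.keq (Δ ++ K :: Γ) K' K'') → Derivable T (.typ Γ k K) →
      Derivable T (.keq (Ctx.inst 0 k Δ ++ Γ) (Expr.inst Δ.length k K') (Expr.inst Δ.length k K''))
  | subst_eq {Γ Δ : Ctx C} {K K' : Kind C} {k l l' : Obj C} :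
      Derivable T (.eq (Δ ++ K :: Γ) l l' K') → Derivable T (.typ Γ k K) →
      Derivable T (.eq (Ctx.inst 0 k Δ ++ Γ) (Expr.inst Δ.length k l) (Expr.inst Δ.length k l')
        (Expr.inst Δ.length k K'))
  -- the kind Type
  | type {Γ : Ctx C} : Derivable T (.valid Γ) → Derivable T (.kind Γ .type)
  | el {Γ : Ctx C} {k : Obj C} : Derivable T (.typ Γ k .type) → Derivable T (.kind Γ (.el k))
  | el_eq {Γ : Ctx C} {k k' : Obj C} :
      Derivable T (.eq Γ k k' .type) → Derivable T (.keq Γ (.el k) (.el k'))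
  -- dependent product kinds
  | pi {Γ : Ctx C} {K K' : Kind C} :
      Derivable T (.kind Γ K) → Derivable T (.kind (K :: Γ) K') → Derivable T (.kind Γ (.pi K K'))
  | pi_eq {Γ : Ctx C} {K₁ K₂ K₁' K₂' : Kind C} :
      Derivable T (.keq Γ K₁ K₂) → Derivable T (.keq (K₁ :: Γ) K₁' K₂') →
      Derivable T (.keq Γ (.pi K₁ K₁') (.pi K₂ K₂'))
  | lam {Γ : Ctx C} {K K' : Kind C} {k : Obj C} :
      Derivable T (.typ (K :: Γ) k K') → Derivable T (.typ Γ (.lam K k) (.pi K K'))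
  | lam_eq {Γ : Ctx C} {K₁ K₂ K' : Kind C} {k₁ k₂ : Obj C} :
      Derivable T (.keq Γ K₁ K₂) → Derivable T (.eq (K₁ :: Γ) k₁ k₂ K') →
      Derivable T (.eq Γ (.lam K₁ k₁) (.lam K₂ k₂) (.pi K₁ K'))
  | app {Γ : Ctx C} {K K' : Kind C} {f k : Obj C} :
      Derivable T (.typ Γ f (.pi K K')) → Derivable T (.typ Γ k K) →
      Derivable T (.typ Γ (.app f k) (Expr.inst 0 k K'))
  | app_eq {Γ : Ctx C} {K K' : Kind C} {f f' k k' : Obj C} :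
      Derivable T (.eq Γ f f' (.pi K K')) → Derivable T (.eq Γ k k' K) →
      Derivable T (.eq Γ (.app f k) (.app f' k') (Expr.inst 0 k K'))
  | beta {Γ : Ctx C} {K K' : Kind C} {k k' : Obj C} :
      Derivable T (.typ (K :: Γ) k' K') → Derivable T (.typ Γ k K) →
      Derivable T (.eq Γ (.app (.lam K k') k) (Expr.inst 0 k k') (Expr.inst 0 k K'))
  | eta {Γ : Ctx C} {K K' : Kind C} {f : Obj C} :
      Derivable T (.typ Γ f (.pi K K')) →
      Derivable T (.eq Γ (.lam K (.app f.weaken (.var 0))) f (.pi K K'))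
  -- the declarations of the specification
  | const {Γ : Ctx C} (c : C) :
      Derivable T (.kind [] (T.kind c)) → Derivable T (.valid Γ) →
      Derivable T (.typ Γ (.con c) (T.kind c))
  | comp {Γ : Ctx C} (d : EqDecl C) (hd : d ∈ T.eqns) (ks : List (Obj C)) :
      ks.length = d.ctx.length →
      (∀ J ∈ seqJ Γ ks d.ctx, Derivable T J) →
      Derivable T (.typ Γ (d.lhs.subst (listSub ks)) (d.kind.subst (listSub ks))) →
      Derivable T (.typ Γ (d.rhs.subst (listSub ks)) (d.kind.subst (listSub ks))) →
      Derivable T (.eq Γ (d.lhs.subst (listSub ks)) (d.rhs.subst (listSub ks))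
        (d.kind.subst (listSub ks)))

/-! ## Arities of LF entities and the translation NF -/

/-- `Ar(K)`, for a kind `K`.  (Objects get the dummy value `zero`; it is never used.) -/
def Expr.kindArity {s : Cat} : Expr C s → Arity
  | .type => .zero
  | .el _ => .zero
  | .pi K K' => .cons K.kindArity K'.kindArity
  | .var _ => .zero
  | .con _ => .zero
  | .lam _ _ => .zero
  | .app _ _ => .zero

/-- The arities of the entries of a context. -/
def Ctx.arities (Γ : Ctx C) : List Arity := Γ.map Expr.kindArity

/-- The arities that `T` gives to the constants. -/
def Spec.ar (T : Spec C) (c : C) : Arity := (T.kind c).kindArity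

/-- The (partial) arity of an object, relative to the arities `A` of the entries of a context.
(It is undefined on kinds.) -/
def objArity (ar : C → Arity) {s : Cat} : List Arity → Expr C s → Option Arity
  | A, .var i => A[i]?
  | _, .con c => some (ar c)
  | A, .lam K k => (objArity ar (K.kindArity :: A) k).map (Arity.cons K.kindArity)
  | A, .app k k' =>
      match objArity ar A k, objArity ar A k' with
      | some (.cons α β), some α' => if α' = α then some β else none
      | _, _ => none
  | _, .type => none
  | _, .el _ => none
  | _, .pi _ _ => none

/-- `Ar_Γ(k)`. -/
def Spec.Ar (T : Spec C) (Γ : Ctx C) (k : Obj C) : Option Arity := objArity T.ar Γ.arities k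

/-- The (partial) normal form of an object, with its arity, relative to the arities `A` of the
entries of a context.  (It is undefined on kinds.) -/
def nfObj (ar : C → Arity) {s : Cat} :
    (A : List Arity) → Expr C s → Option (Σ α, TF.Abs ar A α)
  | A, .var i => (Var.find A i).map fun p => ⟨p.1, TF.eta (.var p.2)⟩
  | _, .con c => some ⟨ar c, TF.eta (.con c)⟩
  | A, .lam K k =>
      (nfObj ar (K.kindArity :: A) k).map fun p => ⟨.cons K.kindArity p.1, .lam p.2⟩
  | A, .app k k' =>
      match nfObj ar A k, nfObj ar A k' with
      | some ⟨.cons α β, F⟩, some ⟨α', G⟩ =>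
          if h : α' = α then some ⟨β, F.employ (h ▸ G)⟩ else none
      | _, _ => none
  | _, .type => none
  | _, .el _ => none
  | _, .pi _ _ => none

/-- The (partial) normal form of a kind, relative to the arities `A` of the entries of a
context.  (It is undefined on objects.) -/
def nfKind (ar : C → Arity) {s : Cat} : (A : List Arity) → (K : Expr C s) →
    Option (TF.Kind ar A K.kindArity)
  | _, .type => some .type
  | A, .el k =>
      match nfObj ar A k with
      | some ⟨.zero, M⟩ => some (.el M)
      | _ => none
  | A, .pi K K' =>
      (nfKind ar A K).bind fun L => (nfKind ar (K.kindArity :: A) K').map fun L' => .pi L L'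
  | _, .var _ => none
  | _, .con _ => none
  | _, .lam _ _ => none
  | _, .app _ _ => none

/-- The (partial) normal form of a context extension, relative to the arities `A` of the entries
of a context. -/
def nfTele (ar : C → Arity) (A : List Arity) : (Θ : Ctx C) → Option (TF.Tele ar A Θ.arities)
  | [] => some .nil
  | K :: Θ =>
      (nfTele ar A Θ).bind fun t => (nfKind ar (Ctx.arities Θ ++ A) K).map fun L => .snoc t L

/-- The (partial) normal form of a context. -/
def nfCtx (ar : C → Arity) : (Γ : Ctx C) → Option (TF.Ctx ar Γ.arities)
  | [] => some .nil
  | K :: Γ => (nfCtx ar Γ).bind fun t => (nfKind ar (Ctx.arities Γ) K).map fun L => .snoc t L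

/-- `NF_Γ(k)` is defined and equal to `F`. -/
def Spec.NFObj (T : Spec C) (Γ : Ctx C) (k : Obj C) {A : List Arity} {α : Arity}
    (F : TF.Abs T.ar A α) : Prop :=
  A = Γ.arities ∧ nfObj T.ar A k = some ⟨α, F⟩

/-- `NF_Γ(K)` is defined and equal to `L`. -/
def Spec.NFKind (T : Spec C) (Γ : Ctx C) (K : Kind C) {A : List Arity} {α : Arity}
    (L : TF.Kind T.ar A α) : Prop :=
  A = Γ.arities ∧
    (nfKind T.ar A K).map (fun L₀ => (⟨_, L₀⟩ : Σ β, TF.Kind T.ar A β)) = some ⟨α, L⟩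

/-- `NF_Γ(Θ)` is defined and equal to `t`, for a context extension `Θ` over `Γ`. -/
def Spec.NFTele (T : Spec C) (Γ Θ : Ctx C) {A D : List Arity} (t : TF.Tele T.ar A D) : Prop :=
  A = Γ.arities ∧
    (nfTele T.ar A Θ).map (fun t₀ => (⟨_, t₀⟩ : Σ E, TF.Tele T.ar A E)) = some ⟨D, t⟩

/-- `NF(Γ)`, relative to the empty context, is defined and equal to `Γ'`. -/
def Spec.NFCtx (T : Spec C) (Γ : Ctx C) (Γ' : TF.Ctx T.ar Γ.arities) : Prop :=
  nfCtx T.ar Γ = some Γ'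

/-- `NF(d)` is defined and equal to `e`, for a computation rule `d`. -/
def Spec.NFEqDecl (T : Spec C) (d : EqDecl C) (e : TF.EqDecl T.ar) : Prop :=
  T.NFKind [] (piAll d.ctx d.kind) e.kind ∧
    T.NFObj [] (lamAll d.ctx d.lhs) e.lhs ∧ T.NFObj [] (lamAll d.ctx d.rhs) e.rhs

/-- `NF(T)` is defined and equal to `S`. -/
def Spec.NFSpec (T : Spec C) (S : TF.Spec T.ar) : Prop :=
  (∀ c : C, T.NFKind [] (T.kind c) (S.kind c)) ∧
    (∀ d ∈ T.eqns, ∃ e, T.NFEqDecl d e) ∧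
    S.eqns = {e | ∃ d ∈ T.eqns, T.NFEqDecl d e}

/-- `NF(J)` is defined and equal to the given set of primitive judgements of TF. -/
inductive Spec.NFJudg (T : Spec C) : Judg C → Set (TF.Judg T.ar) → Prop
  | valid {Γ : Ctx C} {Γ' : TF.Ctx T.ar Γ.arities} :
      T.NFCtx Γ Γ' → T.NFJudg (.valid Γ) {.valid Γ'}
  | kind {Γ : Ctx C} {K : Kind C} {Γ' : TF.Ctx T.ar Γ.arities} {α : Arity}
      {L : TF.Kind T.ar Γ.arities α} :
      T.NFCtx Γ Γ' → T.NFKind Γ K L → T.NFJudg (.kind Γ K) (TF.kindJ Γ' L)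
  | keq {Γ : Ctx C} {K K' : Kind C} {Γ' : TF.Ctx T.ar Γ.arities} {α : Arity}
      {L L' : TF.Kind T.ar Γ.arities α} {s : Set (TF.Judg T.ar)} :
      T.NFCtx Γ Γ' → T.NFKind Γ K L → T.NFKind Γ K' L' → TF.kindEqJ Γ' L L' = some s →
      T.NFJudg (.keq Γ K K') s
  | typ {Γ : Ctx C} {k : Obj C} {K : Kind C} {Γ' : TF.Ctx T.ar Γ.arities} {α : Arity}
      {F : TF.Abs T.ar Γ.arities α} {L : TF.Kind T.ar Γ.arities α} :
      T.NFCtx Γ Γ' → T.NFObj Γ k F → T.NFKind Γ K L → T.NFJudg (.typ Γ k K) (TF.absJ Γ' F L)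
  | eq {Γ : Ctx C} {k k' : Obj C} {K : Kind C} {Γ' : TF.Ctx T.ar Γ.arities} {α : Arity}
      {F F' : TF.Abs T.ar Γ.arities α} {L : TF.Kind T.ar Γ.arities α} :
      T.NFCtx Γ Γ' → T.NFObj Γ k F → T.NFObj Γ k' F' → T.NFKind Γ K L →
      T.NFJudg (.eq Γ k k' K) (TF.absEqJ Γ' F F' L)

end LF

/-!
The first three parts come from one observation: `NF` is evaluation.  For a partial assignment `σ`
of TF abstractions to the LF variables, `LF.eval σ k` looks variables up in `σ`, sends constants to
their eta-long forms and turns application into employment; `NF` is the evaluation under the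
assignment of all eta-long forms (`nfObj_eq_eval`, `nfKind_eq_evalKind`).  Evaluation turns LF
renaming and substitution into precomposition (`eval_rename`, `eval_subst`), and it commutes with TF
renaming and hereditary substitution (`eval_map_rename`, `eval_map_subst`).  The latter rests on two
facts on hereditary substitution: it commutes with itself and with employment
(`Expr.subst_comm_of`, `employCommute`, by induction on the sum of the two arities), and
eta-long forms are neutral for it (`eta_subst_abs`, `employSeq_eta`, `Expr.subst_single_eta`).

For soundness, LF is interpreted in a Kripke model over derivability in TF.  By recursion on the
arity, `TF.Mem` says when two abstractions are equal elements of a kind: at base kinds they are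
derivably of that kind and derivably equal, at higher arities they send equal arguments to equal
results in all renamings.  `TF.KEq` is the corresponding equality of kinds.  Both are partial
equivalence relations, and equal kinds have the same elements (`TF.isPer`).  By induction on the
arity, what holds in the model is derivable, and the eta-long forms of variables and constants are
elements of their kinds (`TF.reifies`, `Reifies.mem_eta`); the only property of derivations that
this needs is closure under renaming (`Derivable.renDerivable`).

An LF judgement is true in the model if it holds under equal evaluations of its variables, and every
rule of LF preserves truth (`LF.Derivable.valid`): the substitution rules since substitution is
evaluation in another assignment, `β` and `η` since both sides have the same value.  For a
computation rule, the equation declaration of TF gives the equation for all arguments, and the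
premises of the LF rule say that both sides are elements of the kind (`InstEq.mem`).  Under the
assignment of eta-long forms, truth of a judgement is derivability of its normal form
(`Valid.exists_nfJudg`).
-/

namespace TF

variable {C : Type u} {ar : C → Arity}

/-! ### Renaming in TF -/

/-- Composition of renamings, `ρ` first. -/
def Ren.comp {A B D : List Arity} (ρ : Ren A B) (ρ' : Ren B D) : Ren A D :=
  fun _ x => ρ' _ (ρ _ x)

/-- The identity renaming. -/
def Ren.id (A : List Arity) : Ren A A := fun _ x => x

theorem Ren.lift_comp {A B D : List Arity} {γ : Arity} (ρ : Ren A B) (ρ' : Ren B D) :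
    (Ren.comp ρ ρ').lift (γ := γ) = Ren.comp ρ.lift ρ'.lift := by
  funext α x; cases x <;> rfl

theorem Ren.lift_id {A : List Arity} {γ : Arity} : (Ren.id A).lift = Ren.id (γ :: A) := by
  funext α x; cases x <;> rfl

theorem Ren.wk_lift {A B : List Arity} {γ : Arity} (ρ : Ren A B) :
    Ren.comp (Ren.wk (γ := γ)) ρ.lift = Ren.comp ρ Ren.wk := rfl

theorem Expr.rename_rename {A B D : List Arity} {s : Cat} (e : Expr ar A s) (ρ : Ren A B)
    (ρ' : Ren B D) : (e.rename ρ).rename ρ' = e.rename (Ren.comp ρ ρ') := by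
  induction e generalizing B D with
  | app z S ih => cases z <;> simp [Expr.rename, Head.rename, ih, Ren.comp]
  | lam F ih => simp [Expr.rename, ih, Ren.lift_comp]
  | nil => rfl
  | cons F S ihF ihS => simp [Expr.rename, ihF, ihS]

theorem Expr.rename_id {A : List Arity} {s : Cat} (e : Expr ar A s) :
    e.rename (Ren.id A) = e := by
  induction e with
  | app z S ih => cases z <;> simp [Expr.rename, Head.rename, ih, Ren.id]
  | lam F ih => simp [Expr.rename, ih, Ren.lift_id]
  | nil => rfl
  | cons F S ihF ihS => simp [Expr.rename, ihF, ihS]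

theorem Expr.body_rename {A B : List Arity} {α β : Arity} (F : Abs ar A (.cons α β))
    (ρ : Ren A B) : Expr.body (F.rename ρ) = F.body.rename ρ.lift := by
  cases F; rfl

theorem Expr.head_rename {A B : List Arity} {α β : Arity} (S : Seq ar A (.cons α β))
    (ρ : Ren A B) : Expr.head (S.rename ρ) = S.head.rename ρ := by
  cases S; rfl

theorem Expr.tail_rename {A B : List Arity} {α β : Arity} (S : Seq ar A (.cons α β))
    (ρ : Ren A B) : Expr.tail (S.rename ρ) = S.tail.rename ρ := by
  cases S; rfl

theorem Expr.lam_body {A : List Arity} {α β : Arity} (F : Abs ar A (.cons α β)) :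
    Expr.lam F.body = F := by
  cases F; rfl

/-! ### Hereditary substitution and renaming -/

/-- Renaming of an image. -/
def Img.rename {α β : Arity} {B D : List Arity} (ρ : Ren B D) : Img ar α B β → Img ar α D β
  | .var x => .var (ρ _ x)
  | .abs F => .abs (F.rename ρ)

/-- The assignment `σ` followed by the renaming `ρ`. -/
def Env.rename {α : Arity} {A B D : List Arity} (σ : Env ar α A B) (ρ : Ren B D) :
    Env ar α A D :=
  fun _ x => (σ _ x).rename ρ

/-- The renaming `ρ` followed by the assignment `σ`. -/
def Env.pre {α : Arity} {A B D : List Arity} (ρ : Ren A B) (σ : Env ar α B D) : Env ar α A D :=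
  fun _ x => σ _ (ρ _ x)

theorem Env.lift_pre {α γ : Arity} {A B D : List Arity} (ρ : Ren A B) (σ : Env ar α B D) :
    (Env.pre ρ σ).lift (γ := γ) = Env.pre ρ.lift σ.lift := by
  funext β x; cases x <;> rfl

theorem Env.lift_rename {α γ : Arity} {A B D : List Arity} (σ : Env ar α A B) (ρ : Ren B D) :
    (σ.rename ρ).lift (γ := γ) = σ.lift.rename ρ.lift := by
  funext β x
  cases x with
  | zero => rfl
  | succ x =>
    simp only [Env.lift, Env.rename]
    cases σ _ x <;> simp [Img.rename, Img.weaken, Expr.rename_rename, Ren.wk_lift]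
    rfl

theorem Expr.substWith_rename {α : Arity}
    (ap : ∀ B : List Arity, Abs ar B α → Seq ar B α → Obj ar B)
    {A B D : List Arity} {s : Cat} (e : Expr ar A s) (ρ : Ren A B) (σ : Env ar α B D) :
    (e.rename ρ).substWith ap σ = e.substWith ap (Env.pre ρ σ) := by
  induction e generalizing B D with
  | app z S ih => cases z <;> simp [Expr.rename, Expr.substWith, Head.rename, Head.plug, ih, Env.pre]
  | lam F ih => simp [Expr.rename, Expr.substWith, ih, Env.lift_pre]
  | nil => rfl
  | cons F S ihF ihS => simp [Expr.rename, Expr.substWith, ihF, ihS]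

theorem Expr.rename_substWith {α : Arity}
    (ap : ∀ B : List Arity, Abs ar B α → Seq ar B α → Obj ar B)
    (hap : ∀ (B D : List Arity) (ρ : Ren B D) (F : Abs ar B α) (S : Seq ar B α),
      (ap B F S).rename ρ = ap D (F.rename ρ) (S.rename ρ))
    {A B D : List Arity} {s : Cat} (e : Expr ar A s) (σ : Env ar α A B) (ρ : Ren B D) :
    (e.substWith ap σ).rename ρ = e.substWith ap (σ.rename ρ) := by
  induction e generalizing B D with
  | app z S ih =>
    cases z with
    | con c => simp [Expr.rename, Expr.substWith, Head.rename, Head.plug, ih]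
    | var x =>
      simp only [Expr.substWith, Head.plug, Env.rename]
      cases σ _ x <;> simp [Img.rename, Img.plug, Expr.rename, Head.rename, hap, ih]
  | lam F ih => simp [Expr.rename, Expr.substWith, ih, Env.lift_rename]
  | nil => rfl
  | cons F S ihF ihS => simp [Expr.rename, Expr.substWith, ihF, ihS]

theorem Env.single_rename {α : Arity} {A B : List Arity} (F : Abs ar A α) (ρ : Ren A B) :
    (Env.single F).rename ρ = Env.pre ρ.lift (Env.single (F.rename ρ)) := by
  funext β x; cases x <;> rfl

theorem employSeq_rename (α : Arity) {A B : List Arity} (F : Abs ar A α) (S : Seq ar A α)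
    (ρ : Ren A B) :
    (employSeq α A F S).rename ρ = employSeq α B (F.rename ρ) (S.rename ρ) := by
  induction α generalizing A B with
  | zero => rfl
  | cons α β ihα ihβ =>
    simp only [employSeq]
    rw [ihβ, Expr.rename_substWith _ (fun _ _ ρ F S => ihα F S ρ), Env.single_rename,
      Expr.body_rename, Expr.head_rename, Expr.tail_rename, Expr.substWith_rename]

theorem Expr.subst_rename {α : Arity} {A B D : List Arity} {s : Cat} (e : Expr ar A s)
    (ρ : Ren A B) (σ : Env ar α B D) : (e.rename ρ).subst σ = e.subst (Env.pre ρ σ) :=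
  Expr.substWith_rename _ e ρ σ

theorem Expr.rename_subst {α : Arity} {A B D : List Arity} {s : Cat} (e : Expr ar A s)
    (σ : Env ar α A B) (ρ : Ren B D) : (e.subst σ).rename ρ = e.subst (σ.rename ρ) :=
  Expr.rename_substWith _ (fun _ _ ρ F S => employSeq_rename α F S ρ) e σ ρ

theorem Env.pre_wk_lift {α γ : Arity} {A B : List Arity} (σ : Env ar α A B) :
    Env.pre (Ren.wk (γ := γ)) σ.lift = σ.rename Ren.wk := by
  funext β x
  simp only [Env.pre, Env.rename, Ren.wk, Env.lift]
  cases σ _ x <;> rfl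

theorem Expr.subst_wk {α γ : Arity} {A B : List Arity} {s : Cat} (e : Expr ar A s)
    (σ : Env ar α A B) :
    (e.rename (Ren.wk (γ := γ))).subst σ.lift = (e.subst σ).rename Ren.wk := by
  rw [Expr.subst_rename, Expr.rename_subst, Env.pre_wk_lift]

theorem Expr.employ_eq {A : List Arity} {α β : Arity} (F : Abs ar A (.cons α β))
    (G : Abs ar A α) : F.employ G = F.body.subst (Env.single G) := rfl

theorem Expr.employ_rename {A B : List Arity} {α β : Arity} (F : Abs ar A (.cons α β))
    (G : Abs ar A α) (ρ : Ren A B) :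
    (F.employ G).rename ρ = (Expr.rename ρ F).employ (G.rename ρ) := by
  simp only [Expr.employ_eq]
  rw [Expr.rename_subst, Env.single_rename, Expr.body_rename, Expr.subst_rename]

theorem employSeq_cons {A : List Arity} {α β : Arity} (F : Abs ar A (.cons α β))
    (S : Seq ar A (.cons α β)) :
    employSeq (.cons α β) A F S = employSeq β A (F.employ S.head) S.tail := rfl

/-- An assignment that sends every variable to its image under `ρ`, and none to an abstraction,
acts as `ρ`. -/
theorem Expr.subst_var {α : Arity} {A B : List Arity} {s : Cat} (e : Expr ar A s)
    (σ : Env ar α A B) (ρ : Ren A B) (h : ∀ β (x : Var A β), σ _ x = .var (ρ _ x)) :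
    e.subst σ = e.rename ρ := by
  induction e generalizing B with
  | app z S ih =>
    cases z with
    | con c =>
      simp only [Expr.subst, Expr.substWith, Head.plug, Expr.rename, Head.rename] at ih ⊢
      rw [ih σ ρ h]
    | var x =>
      simp only [Expr.subst, Expr.substWith, Head.plug, Expr.rename, Head.rename, h,
        Img.plug] at ih ⊢
      rw [ih σ ρ h]
  | lam F ih =>
    simp only [Expr.subst, Expr.substWith, Expr.rename] at ih ⊢
    rw [ih]
    intro β x
    cases x with
    | zero => rfl
    | succ x => simp [Env.lift, h, Img.weaken, Ren.lift]
  | nil => rfl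
  | cons F S ihF ihS =>
    simp only [Expr.subst, Expr.substWith, Expr.rename] at ihF ihS ⊢
    rw [ihF σ ρ h, ihS σ ρ h]

theorem Expr.subst_single_wk {α : Arity} {A : List Arity} {s : Cat} (e : Expr ar A s)
    (F : Abs ar A α) : (e.rename Ren.wk).subst (Env.single F) = e := by
  have h : e.subst (Env.pre Ren.wk (Env.single F)) = e.rename (Ren.id A) :=
    Expr.subst_var _ _ _ (fun _ _ => rfl)
  rw [Expr.subst_rename, h, Expr.rename_id]

/-! ### Commutation of hereditary substitutions -/

/-- The number of pairs of parentheses in an arity. -/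
def size : Arity → ℕ
  | .zero => 1
  | .cons α β => size α + size β

theorem size_pos (α : Arity) : 0 < size α := by
  induction α with
  | zero => simp [size]
  | cons α β => simp [size]; omega

/-- `CommuteAt τ τ' i j`: the image `i` followed by `τ` and the image `j` followed by `τ'` are
the same.  Here `i` and `j` are the images of one variable under two assignments, of which the
first and `τ'` instantiate `α`-ary variables, and the second and `τ` instantiate `β`-ary ones, so
that each variable meets at most one of its two instantiations on either path. -/
inductive CommuteAt {α β : Arity} {B B' D : List Arity} (τ : Env ar β B D) (τ' : Env ar α B' D) :
    {γ : Arity} → Img ar α B γ → Img ar β B' γ → Prop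
  | var {γ : Arity} {y : Var B γ} {y' : Var B' γ} {z : Var D γ} :
      τ _ y = .var z → τ' _ y' = .var z → CommuteAt τ τ' (.var y) (.var y')
  | left {F : Abs ar B α} {y' : Var B' α} :
      τ' _ y' = .abs (F.subst τ) → CommuteAt τ τ' (.abs F) (.var y')
  | right {G : Abs ar B' β} {y : Var B β} :
      τ _ y = .abs (G.subst τ') → CommuteAt τ τ' (.var y) (.abs G)

theorem CommuteAt.weaken {α β γ δ : Arity} {B B' D : List Arity} {τ : Env ar β B D}
    {τ' : Env ar α B' D} {i : Img ar α B γ} {j : Img ar β B' γ} (h : CommuteAt τ τ' i j) :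
    CommuteAt (τ.lift (γ := δ)) (τ'.lift (γ := δ)) i.weaken j.weaken := by
  cases h with
  | var h h' =>
    exact .var (z := Var.succ _) (by simp only [Env.lift, h]; rfl) (by simp only [Env.lift, h']; rfl)
  | left h =>
    refine .left ?_
    simp only [Env.lift, h, Expr.subst_wk]; rfl
  | right h =>
    refine .right ?_
    simp only [Env.lift, h, Expr.subst_wk]; rfl

/-- `α`-ary employment commutes with instantiation of `β`-ary variables. -/
def EmployCommute (ar : C → Arity) (α β : Arity) : Prop :=
  ∀ (A B : List Arity) (F : Abs ar A α) (S : Seq ar A α) (τ : Env ar β A B),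
    (employSeq α A F S).subst τ = employSeq α B (F.subst τ) (S.subst τ)

/-- Hereditary substitutions commute if they do so on variables and employment at both arities
commutes with instantiation at the other. -/
theorem Expr.subst_comm_of {α β : Arity} (h : EmployCommute ar α β) (h' : EmployCommute ar β α)
    {A B B' D : List Arity} {s : Cat} (e : Expr ar A s) (σ : Env ar α A B) (τ : Env ar β B D)
    (σ' : Env ar β A B') (τ' : Env ar α B' D)
    (hc : ∀ γ (x : Var A γ), CommuteAt τ τ' (σ _ x) (σ' _ x)) :
    (e.subst σ).subst τ = (e.subst σ').subst τ' := by
  induction e generalizing B B' D with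
  | app z S ih =>
    have ih := ih σ τ σ' τ' hc
    cases z with
    | con c =>
      simp only [Expr.subst, Expr.substWith, Head.plug] at ih ⊢
      rw [ih]
    | var x =>
      have hx := hc _ x
      have e1 : (Expr.app (.var x) S).subst σ = (σ _ x).plug (employSeq α B) (S.subst σ) := rfl
      have e2 : (Expr.app (.var x) S).subst σ' = (σ' _ x).plug (employSeq β B') (S.subst σ') := rfl
      rw [e1, e2]
      generalize σ _ x = i at hx
      generalize σ' _ x = j at hx
      cases hx with
      | var h1 h2 =>
        simp only [Img.plug, Expr.subst, Expr.substWith, Head.plug, h1, h2] at ih ⊢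
        rw [ih]
      | left h2 =>
        simp only [Img.plug]
        rw [h, ih]
        conv_rhs => simp only [Expr.subst, Expr.substWith, Head.plug, h2, Img.plug]
        rfl
      | right h1 =>
        simp only [Img.plug]
        rw [h', ← ih]
        conv_lhs => simp only [Expr.subst, Expr.substWith, Head.plug, h1, Img.plug]
        rfl
  | lam F ih =>
    have := ih σ.lift τ.lift σ'.lift τ'.lift (by
      intro γ x
      cases x with
      | zero => exact .var (z := .zero) rfl rfl
      | succ x => exact (hc _ x).weaken)
    simp only [Expr.subst, Expr.substWith] at this ⊢
    rw [this]
  | nil => rfl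
  | cons F S ihF ihS =>
    have h1 := ihF σ τ σ' τ' hc
    have h2 := ihS σ τ σ' τ' hc
    simp only [Expr.subst, Expr.substWith] at h1 h2 ⊢
    rw [h1, h2]

theorem Expr.head_subst {A B : List Arity} {α β γ : Arity} (S : Seq ar A (.cons α β))
    (τ : Env ar γ A B) : Expr.head (S.subst τ) = S.head.subst τ := by
  cases S; rfl

theorem Expr.tail_subst {A B : List Arity} {α β γ : Arity} (S : Seq ar A (.cons α β))
    (τ : Env ar γ A B) : Expr.tail (S.subst τ) = S.tail.subst τ := by
  cases S; rfl

theorem Expr.body_subst {A B : List Arity} {α β γ : Arity} (F : Abs ar A (.cons α β))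
    (τ : Env ar γ A B) : Expr.body (F.subst τ) = F.body.subst τ.lift := by
  cases F; rfl

theorem commuteAt_single {α β γ : Arity} {A B : List Arity} (G : Abs ar A α) (τ : Env ar β A B)
    (x : Var (α :: A) γ) :
    CommuteAt τ (Env.single (G.subst τ)) (Env.single G _ x) (τ.lift _ x) := by
  cases x with
  | zero => exact .left rfl
  | succ x =>
    simp only [Env.single, Env.lift]
    cases h : τ _ x with
    | var y => exact .var h rfl
    | abs F => exact .right (by rw [h, Expr.subst_single_wk])

/-- Commutation at `α, β` reduces to commutation at pairs of smaller total size: the recursion of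
`employSeq` on `α = (α₁) ^ α₂` leads to `α₂, β` and, through `Expr.subst_comm_of`, to `α₁, β` and
`β, α₁`. -/
theorem employCommute_aux (n : ℕ) : ∀ α β : Arity, size α + size β ≤ n →
    EmployCommute ar α β := by
  induction n with
  | zero =>
    intro α β h
    have := size_pos α
    omega
  | succ n ih =>
    intro α β h A B F S τ
    cases α with
    | zero => rfl
    | cons α₁ α₂ =>
      have := size_pos α₁
      have := size_pos α₂
      simp only [size] at h
      rw [employSeq_cons, employSeq_cons, ih α₂ β (by omega), Expr.head_subst, Expr.tail_subst,
        Expr.employ_eq, Expr.employ_eq, Expr.body_subst,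
        Expr.subst_comm_of (ih α₁ β (by omega)) (ih β α₁ (by omega)) _ _ _ _ _
          (fun _ x => commuteAt_single S.head τ x)]

theorem employCommute (α β : Arity) : EmployCommute ar α β :=
  employCommute_aux _ α β le_rfl

theorem Expr.subst_single_comm {α β : Arity} {A B : List Arity} {s : Cat}
    (e : Expr ar (α :: A) s) (G : Abs ar A α) (τ : Env ar β A B) :
    (e.subst (Env.single G)).subst τ = (e.subst τ.lift).subst (Env.single (G.subst τ)) :=
  Expr.subst_comm_of (employCommute α β) (employCommute β α) _ _ _ _ _
    (fun _ x => commuteAt_single G τ x)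

theorem Expr.employ_subst {A B : List Arity} {α β γ : Arity} (F : Abs ar A (.cons α β))
    (G : Abs ar A α) (τ : Env ar γ A B) :
    (F.employ G).subst τ = (Expr.subst τ F).employ (G.subst τ) := by
  rw [Expr.employ_eq, Expr.employ_eq, Expr.subst_single_comm, Expr.body_subst]

/-! ### Eta-long forms -/

/-- Extension of a renaming under the binders of an arity. -/
def Ren.liftExt : (α : Arity) → {A B : List Arity} → Ren A B → Ren (ext α A) (ext α B)
  | .zero, _, _, ρ => ρ
  | .cons _ β, _, _, ρ => Ren.liftExt β ρ.lift

/-- Extension of an assignment under the binders of an arity. -/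
def Env.liftExt {γ : Arity} : (α : Arity) → {A B : List Arity} → Env ar γ A B →
    Env ar γ (ext α A) (ext α B)
  | .zero, _, _, σ => σ
  | .cons _ β, _, _, σ => Env.liftExt β σ.lift

theorem wkExt_liftExt (α : Arity) {A B : List Arity} (ρ : Ren A B) :
    Ren.comp (wkExt α A) (Ren.liftExt α ρ) = Ren.comp ρ (wkExt α B) := by
  induction α generalizing A B with
  | zero => rfl
  | cons α β _ ih =>
    funext γ x
    exact congrFun (congrFun (ih ρ.lift) γ) x.succ

theorem Env.pre_wkExt_liftExt {γ : Arity} (α : Arity) {A B : List Arity} (σ : Env ar γ A B) :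
    Env.pre (wkExt α A) (Env.liftExt α σ) = σ.rename (wkExt α B) := by
  induction α generalizing A B with
  | zero =>
    funext δ x
    simp only [Env.pre, Env.rename, wkExt, Env.liftExt]
    cases σ _ x with
    | var y => rfl
    | abs F => exact congrArg Img.abs (Expr.rename_id F).symm
  | cons α β _ ih =>
    funext δ x
    have := congrFun (congrFun (ih (σ.lift (γ := α))) δ) x.succ
    simp only [Env.pre, Env.rename, wkExt, Env.liftExt] at this ⊢
    rw [this]
    simp only [Env.lift]
    cases σ _ x with
    | var y => rfl
    | abs F => exact congrArg Img.abs (Expr.rename_rename F _ _)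

theorem lamAll_rename (α : Arity) {A B : List Arity} (M : Obj ar (ext α A)) (ρ : Ren A B) :
    (lamAll α M).rename ρ = lamAll α (Expr.rename (Ren.liftExt α ρ) M) := by
  induction α generalizing A B with
  | zero => rfl
  | cons α β _ ih => exact congrArg Expr.lam (ih (A := α :: A) M ρ.lift)

theorem lamAll_subst {γ : Arity} (α : Arity) {A B : List Arity} (M : Obj ar (ext α A))
    (σ : Env ar γ A B) :
    (lamAll α M).subst σ = lamAll α (Expr.subst (Env.liftExt α σ) M) := by
  induction α generalizing A B with
  | zero => rfl
  | cons α β _ ih =>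
    have := ih M σ.lift
    simp only [lamAll, Expr.subst, Expr.substWith] at this ⊢
    rw [this]; rfl

theorem Head.rename_rename {A B D : List Arity} {α : Arity} (z : Head ar A α) (ρ : Ren A B)
    (ρ' : Ren B D) : (z.rename ρ).rename ρ' = z.rename (Ren.comp ρ ρ') := by
  cases z <;> rfl

theorem etaSeq_rename (α : Arity) {A B : List Arity} (ρ : Ren A B) :
    (etaSeq (ar := ar) α A).rename (Ren.liftExt α ρ) = etaSeq α B := by
  induction α generalizing A B with
  | zero => rfl
  | cons α β ihα ihβ =>
    have h : ((eta (ar := ar) (.var .zero)).rename (wkExt β (α :: A))).rename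
        (Ren.liftExt β (ρ.lift (γ := α))) = (eta (.var .zero)).rename (wkExt β (α :: B)) := by
      have hz := congrFun (congrFun (wkExt_liftExt α (ρ.lift (γ := α))) α) .zero
      simp only [Ren.comp] at hz
      rw [Expr.rename_rename, wkExt_liftExt, ← Expr.rename_rename, eta, lamAll_rename]
      simp only [Expr.rename, Head.rename]
      rw [ihα, hz]; rfl
    exact congrArg₂ (Expr.cons (ar := ar) (A := ext β (α :: B))) h (ihβ ρ.lift)

theorem eta_rename {α : Arity} {A B : List Arity} (z : Head ar A α) (ρ : Ren A B) :
    (eta z).rename ρ = eta (z.rename ρ) := by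
  simp only [eta, lamAll_rename, Expr.rename, etaSeq_rename, Head.rename_rename, wkExt_liftExt]

theorem etaSeq_subst {γ : Arity} (α : Arity) {A B : List Arity} (σ : Env ar γ A B) :
    (etaSeq α A).subst (Env.liftExt α σ) = etaSeq α B := by
  induction α generalizing A B with
  | zero => rfl
  | cons α β ihα ihβ =>
    have h := ihβ (σ.lift (γ := α))
    have h' := ihα (σ.lift (γ := α))
    have key : (eta (ar := ar) (.var (.zero (A := A) (α := α)))).subst σ.lift
        = eta (.var .zero) := by
      have := congrFun (congrFun (Env.pre_wkExt_liftExt α (σ.lift (γ := α))) α) .zero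
      simp only [Env.pre, Env.rename] at this
      simp only [eta, lamAll_subst, Head.rename]
      simp only [Expr.subst, Expr.substWith, Head.plug, this] at h' ⊢
      rw [h']
      rfl
    have key2 : (Expr.rename (wkExt β (α :: A)) (eta (ar := ar) (.var (.zero)))).subst
        (Env.liftExt β σ.lift) = (eta (.var .zero)).rename (wkExt β (α :: B)) := by
      rw [Expr.subst_rename, Env.pre_wkExt_liftExt, ← Expr.rename_subst, key]
    exact congrArg₂ (Expr.cons (ar := ar) (A := ext β (α :: B))) key2 h

theorem eta_subst_con {γ : Arity} {A B : List Arity} (c : C) (σ : Env ar γ A B) :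
    (eta (.con c)).subst σ = eta (.con c) := by
  have h := etaSeq_subst (ar c) σ
  simp only [eta, lamAll_subst, Head.rename]
  simp only [Expr.subst, Expr.substWith, Head.plug] at h ⊢
  rw [h]

theorem eta_subst_var {γ α : Arity} {A B : List Arity} (x : Var A α) (y : Var B α)
    (σ : Env ar γ A B) (hx : σ _ x = .var y) :
    (eta (.var x)).subst σ = eta (.var y) := by
  have h := etaSeq_subst α σ
  have := congrFun (congrFun (Env.pre_wkExt_liftExt α σ) α) x
  simp only [Env.pre, Env.rename, hx] at this
  simp only [eta, lamAll_subst, Head.rename]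
  simp only [Expr.subst, Expr.substWith, Head.plug, this] at h ⊢
  rw [h]
  rfl

/-- `{F/x}x^η` in terms of the employment of `F` on fresh variables. -/
theorem eta_subst_abs_aux {α : Arity} {A B : List Arity} (x : Var A α) (F : Abs ar B α)
    (σ : Env ar α A B) (hx : σ _ x = .abs F) :
    (eta (.var x)).subst σ =
      lamAll α (employSeq α _ (F.rename (wkExt α B)) (etaSeq α B)) := by
  have h := etaSeq_subst α σ
  have := congrFun (congrFun (Env.pre_wkExt_liftExt α σ) α) x
  simp only [Env.pre, Env.rename, hx] at this
  simp only [eta, lamAll_subst, Head.rename]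
  simp only [Expr.subst, Expr.substWith, Head.plug, this] at h ⊢
  rw [h]
  rfl

/-- Simultaneous instantiation of the members of a sequence for the variables added by
`ext α A`. -/
def instAll : (α : Arity) → {A : List Arity} → {s : Cat} → Seq ar A α →
    Expr ar (ext α A) s → Expr ar A s
  | .zero, _, _, _, e => e
  | .cons _ β, _, _, S, e => instAll β S.tail (e.subst ((Env.single S.head).liftExt β))

theorem employSeq_lamAll (α : Arity) {A : List Arity} (M : Obj ar (ext α A)) (S : Seq ar A α) :
    employSeq α A (lamAll α M) S = instAll α S M := by
  induction α generalizing A with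
  | zero => rfl
  | cons α β _ ih =>
    exact (congrArg (fun F => employSeq β A F S.tail)
      (lamAll_subst β (A := α :: A) M (Env.single S.head))).trans (ih _ _)

theorem instAll_app (α : Arity) {A : List Arity} {γ : Arity} (z : Head ar A γ)
    (S : Seq ar A α) (R : Seq ar (ext α A) γ) :
    instAll α S (.app (z.rename (wkExt α A)) R) = .app z (instAll α S R) := by
  induction α generalizing A with
  | zero => cases z <;> rfl
  | cons α β _ ih =>
    simp only [instAll]
    have h := ih z S.tail (R.subst ((Env.single S.head).liftExt β))
    rw [← h]
    congr 1
    cases z with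
    | con c => rfl
    | var x =>
      have := congrFun (congrFun (Env.pre_wkExt_liftExt β (Env.single S.head)) γ) x.succ
      simp only [Env.pre, Env.rename] at this
      simp only [Head.rename, wkExt]
      simp only [Expr.subst, Expr.substWith, Head.plug, this]
      rfl

theorem instAll_cons (α : Arity) {A : List Arity} {γ δ : Arity} (S : Seq ar A α)
    (F : Abs ar (ext α A) γ) (R : Seq ar (ext α A) δ) :
    instAll α S (.cons F R) = .cons (instAll α S F) (instAll α S R) := by
  induction α generalizing A with
  | zero => rfl
  | cons α β _ ih => simp only [instAll, ← ih]; rfl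

theorem instAll_wk (α : Arity) {A : List Arity} {s : Cat} (S : Seq ar A α) (e : Expr ar A s) :
    instAll α S (e.rename (wkExt α A)) = e := by
  induction α generalizing A with
  | zero => exact Expr.rename_id e
  | cons α β _ ih =>
    have h : ((e.rename Ren.wk).rename (wkExt β (α :: A))).subst
        ((Env.single S.head).liftExt β) = e.rename (wkExt β A) := by
      rw [Expr.subst_rename, Env.pre_wkExt_liftExt, ← Expr.rename_subst, Expr.subst_single_wk]
    rw [Expr.rename_rename] at h
    exact (congrArg (instAll β S.tail) h).trans (ih _ _)

/-- The image is the given variable or its eta-long form. -/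
inductive IsVarOrEta {α : Arity} {B : List Arity} : {β : Arity} → Img ar α B β → Var B β → Prop
  | var {β : Arity} (y : Var B β) : IsVarOrEta (.var y) y
  | eta (y : Var B α) : IsVarOrEta (.abs (eta (.var y))) y

theorem IsVarOrEta.lift {α γ : Arity} {A B : List Arity} {σ : Env ar α A B} {ρ : Ren A B}
    (h : ∀ β (x : Var A β), IsVarOrEta (σ _ x) (ρ _ x)) :
    ∀ β (x : Var (γ :: A) β), IsVarOrEta (σ.lift _ x) (ρ.lift _ x) := by
  intro β x
  cases x with
  | zero => exact .var _
  | succ x =>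
    have hx := h _ x
    simp only [Env.lift, Ren.lift]
    generalize σ _ x = i at hx
    generalize ρ _ x = y at hx
    cases hx with
    | var y => exact .var _
    | eta y =>
      simp only [Img.weaken, eta_rename]
      exact .eta _

/-- If `σ` sends every variable to its image under `ρ` or to the eta-long form of that image, then
`σ` acts as `ρ`, provided eta-long forms are neutral for employment. -/
theorem Expr.subst_eta_of {α : Arity}
    (h : ∀ (A : List Arity) (z : Head ar A α) (S : Seq ar A α),
      employSeq α A (eta z) S = .app z S)
    {A B : List Arity} {s : Cat} (e : Expr ar A s) (σ : Env ar α A B) (ρ : Ren A B)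
    (hσ : ∀ β (x : Var A β), IsVarOrEta (σ _ x) (ρ _ x)) :
    e.subst σ = e.rename ρ := by
  induction e generalizing B with
  | app z S ih =>
    have ih := ih σ ρ hσ
    cases z with
    | con c =>
      simp only [Expr.subst, Expr.substWith, Head.plug, Expr.rename, Head.rename] at ih ⊢
      rw [ih]
    | var x =>
      have hx := hσ _ x
      simp only [Expr.subst, Expr.substWith, Head.plug, Expr.rename, Head.rename] at ih ⊢
      generalize σ _ x = i at hx
      generalize ρ _ x = y at hx
      cases hx with
      | var y => simp only [Img.plug, ih]
      | eta y => simp only [Img.plug, ih, h]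
  | lam F ih =>
    have := ih σ.lift ρ.lift (IsVarOrEta.lift hσ)
    simp only [Expr.subst, Expr.substWith, Expr.rename] at this ⊢
    rw [this]
  | nil => rfl
  | cons F S ihF ihS =>
    have h1 := ihF σ ρ hσ
    have h2 := ihS σ ρ hσ
    simp only [Expr.subst, Expr.substWith, Expr.rename] at h1 h2 ⊢
    rw [h1, h2]

/-- The eta and beta laws for eta-long forms, proved together by induction on the arity: each law
at `(α) ^ β` needs both laws at `α`. -/
theorem eta_laws (α : Arity) :
    (∀ (A : List Arity) (F : Abs ar A α),
      lamAll α (employSeq α _ (F.rename (wkExt α A)) (etaSeq α A)) = F) ∧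
    (∀ (A : List Arity) (S : Seq ar A α), instAll α S (etaSeq α A) = S) := by
  induction α with
  | zero =>
    refine ⟨fun A F => Expr.rename_id F, fun A S => ?_⟩
    cases S; rfl
  | cons α β ihα ihβ =>
    have hE : ∀ (A : List Arity) (z : Head ar A α) (S : Seq ar A α),
        employSeq α A (eta z) S = .app z S := by
      intro A z S
      rw [eta, employSeq_lamAll, instAll_app, ihα.2]
    constructor
    · intro A F
      let ρ : Ren A (ext β (α :: A)) := Ren.comp Ren.wk (wkExt β (α :: A))
      have h1 : (F.body.rename ρ.lift).subst
          (Env.single ((eta (.var .zero)).rename (wkExt β (α :: A)))) =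
          F.body.rename (wkExt β (α :: A)) := by
        rw [Expr.subst_rename]
        apply Expr.subst_eta_of hE
        intro γ x
        cases x with
        | zero =>
          simp only [Env.pre, Ren.lift, Env.single, eta_rename]
          exact .eta _
        | succ x => exact .var _
      have h2 := ihβ.1 (α :: A) F.body
      rw [← h1] at h2
      cases F
      exact congrArg Expr.lam h2
    · intro A S
      have h1 : instAll β S.tail ((Expr.rename (wkExt β (α :: A)) (eta (.var .zero))).subst
          ((Env.single S.head).liftExt β)) = S.head := by
        rw [Expr.subst_rename, Env.pre_wkExt_liftExt, ← Expr.rename_subst, instAll_wk,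
          eta_subst_abs_aux _ S.head _ rfl, ihα.1]
      have h2 : instAll β S.tail ((etaSeq β (α :: A)).subst ((Env.single S.head).liftExt β))
          = S.tail := by
        rw [etaSeq_subst, ihβ.2]
      refine (instAll_cons (.cons α β) S (Expr.rename (wkExt β (α :: A)) (eta (.var .zero)))
        (etaSeq β (α :: A))).trans ?_
      refine (congrArg₂ Expr.cons h1 h2).trans ?_
      cases S; rfl

/-- `[x₁, …, xₙ] F • x₁^η • ⋯ • xₙ^η` is `F`. -/
theorem lamAll_employSeq_etaSeq (α : Arity) {A : List Arity} (F : Abs ar A α) :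
    lamAll α (employSeq α _ (F.rename (wkExt α A)) (etaSeq α A)) = F :=
  (eta_laws α).1 A F

/-- `z^η • F₁ • ⋯ • Fₙ` is `z[F₁, …, Fₙ]`. -/
theorem employSeq_eta {α : Arity} {A : List Arity} (z : Head ar A α) (S : Seq ar A α) :
    employSeq α A (eta z) S = .app z S := by
  rw [eta, employSeq_lamAll, instAll_app, (eta_laws α).2]

/-- `{F/x}x^η` is `F`. -/
theorem eta_subst_abs {α : Arity} {A B : List Arity} (x : Var A α) (F : Abs ar B α)
    (σ : Env ar α A B) (hx : σ _ x = .abs F) : (eta (.var x)).subst σ = F := by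
  rw [eta_subst_abs_aux x F σ hx, lamAll_employSeq_etaSeq]

/-- Instantiating the eta-long form of the last variable for the last variable, in an expression
that has been weakened below it, does nothing. -/
theorem Expr.subst_single_eta {α : Arity} {A : List Arity} {s : Cat} (e : Expr ar (α :: A) s) :
    (e.rename Ren.wk.lift).subst (Env.single (eta (.var .zero))) = e := by
  rw [Expr.subst_rename, Expr.subst_eta_of (fun _ z S => employSeq_eta z S) _ _ (Ren.id _) ?_,
    Expr.rename_id]
  intro γ x
  cases x with
  | zero => exact .eta _
  | succ x => exact .var _

/-! ### Kinds -/

theorem Kind.rename_rename {A B D : List Arity} {α : Arity} (K : Kind ar A α) (ρ : Ren A B)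
    (ρ' : Ren B D) : (K.rename ρ).rename ρ' = K.rename (Ren.comp ρ ρ') := by
  induction K generalizing B D with
  | type => rfl
  | el M => simp [Kind.rename, Expr.rename_rename]
  | pi K K' ih ih' => simp [Kind.rename, ih, ih', Ren.lift_comp]

theorem Kind.rename_id {A : List Arity} {α : Arity} (K : Kind ar A α) :
    K.rename (Ren.id A) = K := by
  induction K with
  | type => rfl
  | el M => simp [Kind.rename, Expr.rename_id]
  | pi K K' ih ih' => simp [Kind.rename, ih, ih', Ren.lift_id]

theorem Kind.subst_rename {α β : Arity} {A B D : List Arity} (K : Kind ar A β)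
    (ρ : Ren A B) (σ : Env ar α B D) : (K.rename ρ).subst σ = K.subst (Env.pre ρ σ) := by
  induction K generalizing B D with
  | type => rfl
  | el M => simp [Kind.rename, Kind.subst, Expr.subst_rename]
  | pi K K' ih ih' => simp [Kind.rename, Kind.subst, ih, ih', Env.lift_pre]

theorem Kind.rename_subst {α β : Arity} {A B D : List Arity} (K : Kind ar A β)
    (σ : Env ar α A B) (ρ : Ren B D) : (K.subst σ).rename ρ = K.subst (σ.rename ρ) := by
  induction K generalizing B D with
  | type => rfl
  | el M => simp [Kind.rename, Kind.subst, Expr.rename_subst]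
  | pi K K' ih ih' => simp [Kind.rename, Kind.subst, ih, ih', Env.lift_rename]

theorem Kind.cod_rename {A B : List Arity} {α β : Arity} (K : Kind ar A (.cons α β))
    (ρ : Ren A B) : (K.rename ρ).cod = K.cod.rename ρ.lift := by
  cases K; rfl

theorem Kind.dom_rename {A B : List Arity} {α β : Arity} (K : Kind ar A (.cons α β))
    (ρ : Ren A B) : (K.rename ρ).dom = K.dom.rename ρ := by
  cases K; rfl

theorem Kind.inst_eq {A : List Arity} {α β : Arity} (K : Kind ar (α :: A) β)
    (G : Abs ar A α) : Kind.inst [] G K = K.subst (Env.single G) := rfl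

theorem Kind.inst_rename {A B : List Arity} {α β : Arity} (K : Kind ar (α :: A) β)
    (G : Abs ar A α) (ρ : Ren A B) :
    (Kind.inst [] G K).rename ρ = Kind.inst [] (G.rename ρ) (K.rename ρ.lift) := by
  simp only [Kind.inst_eq]
  rw [Kind.rename_subst, Env.single_rename, Kind.subst_rename]

theorem Kind.instSeq_rename (α : Arity) {A B : List Arity} (K : Kind ar A α) (S : Seq ar A α)
    (ρ : Ren A B) :
    (Kind.instSeq α K S).rename ρ = Kind.instSeq α (K.rename ρ) (S.rename ρ) := by
  induction α generalizing A B with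
  | zero => rfl
  | cons α β _ ih =>
    simp only [Kind.instSeq]
    rw [ih, Kind.inst_rename, Expr.head_rename, Expr.tail_rename, Kind.cod_rename]

theorem Kind.subst_eta {α β : Arity} {A B : List Arity} (K : Kind ar A β) (σ : Env ar α A B)
    (ρ : Ren A B)
    (hσ : ∀ β (x : Var A β), IsVarOrEta (σ _ x) (ρ _ x)) :
    K.subst σ = K.rename ρ := by
  induction K generalizing B with
  | type => rfl
  | el M =>
    simp only [Kind.subst, Kind.rename]
    rw [Expr.subst_eta_of (fun _ z S => employSeq_eta z S) _ _ ρ hσ]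
  | pi K K' ih ih' =>
    simp only [Kind.subst, Kind.rename]
    rw [ih σ ρ hσ, ih' σ.lift ρ.lift (IsVarOrEta.lift hσ)]

theorem Kind.inst_eta {α β : Arity} {A : List Arity} (K : Kind ar (α :: A) β) :
    Kind.inst [] (eta (.var .zero)) (K.rename Ren.wk.lift) = K := by
  rw [Kind.inst_eq, Kind.subst_rename, Kind.subst_eta _ _ (Ren.id _) ?_, Kind.rename_id]
  intro γ x
  cases x with
  | zero => exact .eta _
  | succ x => exact .var _

end TF

namespace LF

variable {C : Type u} {ar : C → Arity}

/-! ### Evaluation of LF expressions in TF -/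

/-- An abstraction together with its arity. -/
abbrev Val (ar : C → Arity) (A : List Arity) : Type u := Σ α, TF.Abs ar A α

/-- A kind together with its arity. -/
abbrev KVal (ar : C → Arity) (A : List Arity) : Type u := Σ α, TF.Kind ar A α

/-- Renaming of values. -/
def Val.rename {A B : List Arity} (ρ : Ren A B) (p : Val ar A) : Val ar B := ⟨p.1, p.2.rename ρ⟩

/-- Hereditary substitution in values. -/
def Val.subst {α : Arity} {A B : List Arity} (τ : TF.Env ar α A B) (p : Val ar A) : Val ar B :=
  ⟨p.1, p.2.subst τ⟩

/-- Renaming of kind values. -/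
def KVal.rename {A B : List Arity} (ρ : Ren A B) (p : KVal ar A) : KVal ar B :=
  ⟨p.1, p.2.rename ρ⟩

/-- Hereditary substitution in kind values. -/
def KVal.subst {α : Arity} {A B : List Arity} (τ : TF.Env ar α A B) (p : KVal ar A) :
    KVal ar B :=
  ⟨p.1, p.2.subst τ⟩

/-- Partial assignments of TF abstractions, in scope `A`, to the LF variables. -/
abbrev Asg (ar : C → Arity) (A : List Arity) : Type u := ℕ → Option (Val ar A)

/-- Renaming of assignments. -/
def Asg.rename {A B : List Arity} (ρ : Ren A B) (σ : Asg ar A) : Asg ar B :=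
  fun i => (σ i).map (Val.rename ρ)

/-- Hereditary substitution in assignments. -/
def Asg.subst {α : Arity} {A B : List Arity} (τ : TF.Env ar α A B) (σ : Asg ar A) : Asg ar B :=
  fun i => (σ i).map (Val.subst τ)

/-- The assignment that sends variable `0` to `p` and variable `i + 1` to `σ i`. -/
def Asg.push {A : List Arity} (σ : Asg ar A) (p : Val ar A) : Asg ar A
  | 0 => some p
  | i + 1 => σ i

/-- Extension of an assignment under one binder. -/
def Asg.lift {A : List Arity} (α : Arity) (σ : Asg ar A) : Asg ar (α :: A) :=
  (σ.rename Ren.wk).push ⟨α, TF.eta (.var .zero)⟩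

/-- The employment of one value on another, defined when the arities match. -/
def employVal {A : List Arity} : Val ar A → Val ar A → Option (Val ar A)
  | ⟨.cons α β, F⟩, ⟨α', G⟩ =>
      if h : α' = α then some ⟨β, F.employ (h ▸ G)⟩ else none
  | ⟨.zero, _⟩, _ => none

theorem employVal_mk {A : List Arity} {α β : Arity} (F : TF.Abs ar A (.cons α β))
    (G : TF.Abs ar A α) : employVal ⟨.cons α β, F⟩ ⟨α, G⟩ = some ⟨β, F.employ G⟩ := by
  simp [employVal]

theorem employVal_rename {A B : List Arity} (ρ : Ren A B) (p q : Val ar A) :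
    (employVal p q).map (Val.rename ρ) = employVal (p.rename ρ) (q.rename ρ) := by
  obtain ⟨a, F⟩ := p
  obtain ⟨α', G⟩ := q
  cases a with
  | zero => rfl
  | cons α β =>
    by_cases hα : α' = α
    · subst hα
      simp [employVal, Val.rename, TF.Expr.employ_rename]
    · simp [employVal, Val.rename, hα]

theorem employVal_subst {γ : Arity} {A B : List Arity} (τ : TF.Env ar γ A B) (p q : Val ar A) :
    (employVal p q).map (Val.subst τ) = employVal (p.subst τ) (q.subst τ) := by
  obtain ⟨a, F⟩ := p
  obtain ⟨α', G⟩ := q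
  cases a with
  | zero => rfl
  | cons α β =>
    by_cases hα : α' = α
    · subst hα
      simp [employVal, Val.subst, TF.Expr.employ_subst]
    · simp [employVal, Val.subst, hα]

/-- The value of an LF object under an assignment to its variables: variables are looked up,
constants are eta-expanded, and application becomes employment.  (Undefined on kinds.) -/
def eval {s : Cat} : {A : List Arity} → Asg ar A → Expr C s → Option (Val ar A)
  | _, σ, .var i => σ i
  | _, _, .con c => some ⟨ar c, TF.eta (.con c)⟩
  | _, σ, .lam K k =>
      (eval (σ.lift K.kindArity) k).map fun p => ⟨.cons K.kindArity p.1, .lam p.2⟩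
  | _, σ, .app k k' => (eval σ k).bind fun p => (eval σ k').bind fun q => employVal p q
  | _, _, .type => none
  | _, _, .el _ => none
  | _, _, .pi _ _ => none

/-- The kind value `El(M)`, for an object `M`. -/
def elVal {A : List Arity} : Val ar A → Option (KVal ar A)
  | ⟨.zero, M⟩ => some ⟨.zero, .el M⟩
  | ⟨.cons _ _, _⟩ => none

/-- The value of an LF kind under an assignment to its variables.  (Undefined on objects.) -/
def evalKind {s : Cat} : {A : List Arity} → Asg ar A → Expr C s → Option (KVal ar A)
  | _, _, .type => some ⟨.zero, .type⟩
  | _, σ, .el k => (eval σ k).bind elVal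
  | _, σ, .pi K K' =>
      (evalKind σ K).bind fun p =>
        (evalKind (σ.lift p.1) K').map fun q => ⟨.cons p.1 q.1, .pi p.2 q.2⟩
  | _, _, .var _ => none
  | _, _, .con _ => none
  | _, _, .lam _ _ => none
  | _, _, .app _ _ => none

theorem Asg.rename_lift {A B : List Arity} (ρ : Ren A B) (α : Arity) (σ : Asg ar A) :
    (σ.lift α).rename ρ.lift = (σ.rename ρ).lift α := by
  funext i
  cases i with
  | zero =>
    simp only [Asg.rename, Asg.lift, Asg.push, Option.map_some, Val.rename, TF.eta_rename]
    rfl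
  | succ i =>
    simp only [Asg.rename, Asg.lift, Asg.push]
    cases σ i <;> simp [Val.rename, TF.Expr.rename_rename, TF.Ren.wk_lift]

theorem Asg.subst_lift {γ : Arity} {A B : List Arity} (τ : TF.Env ar γ A B) (α : Arity)
    (σ : Asg ar A) : (σ.lift α).subst τ.lift = (σ.subst τ).lift α := by
  funext i
  cases i with
  | zero =>
    simp only [Asg.subst, Asg.lift, Asg.push, Option.map_some, Val.subst]
    rw [TF.eta_subst_var Var.zero Var.zero τ.lift rfl]
  | succ i =>
    simp only [Asg.subst, Asg.rename, Asg.lift, Asg.push]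
    cases σ i <;> simp [Val.subst, Val.rename, TF.Expr.subst_wk]

theorem eval_map_rename {s : Cat} {A B : List Arity} (ρ : Ren A B) (σ : Asg ar A)
    (e : Expr C s) : eval (σ.rename ρ) e = (eval σ e).map (Val.rename ρ) := by
  induction e generalizing A B with
  | con c => simp [eval, Val.rename, TF.eta_rename, TF.Head.rename]
  | lam K k _ ih =>
    simp only [eval, ← Asg.rename_lift, ih, Option.map_map]
    rfl
  | app k k' ih ih' =>
    simp only [eval, ih, ih']
    cases eval σ k <;> cases eval σ k' <;> simp [employVal_rename]
  | _ => rfl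

theorem eval_map_subst {γ : Arity} {s : Cat} {A B : List Arity} (τ : TF.Env ar γ A B)
    (σ : Asg ar A) (e : Expr C s) : eval (σ.subst τ) e = (eval σ e).map (Val.subst τ) := by
  induction e generalizing A B with
  | con c => simp [eval, Val.subst, TF.eta_subst_con]
  | lam K k _ ih =>
    simp only [eval, ← Asg.subst_lift, ih, Option.map_map]
    rfl
  | app k k' ih ih' =>
    simp only [eval, ih, ih']
    cases eval σ k <;> cases eval σ k' <;> simp [employVal_subst]
  | _ => rfl

theorem elVal_rename {A B : List Arity} (ρ : Ren A B) (p : Val ar A) :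
    elVal (p.rename ρ) = (elVal p).map (KVal.rename ρ) := by
  obtain ⟨a, F⟩ := p
  cases a <;> rfl

theorem elVal_subst {γ : Arity} {A B : List Arity} (τ : TF.Env ar γ A B) (p : Val ar A) :
    elVal (p.subst τ) = (elVal p).map (KVal.subst τ) := by
  obtain ⟨a, F⟩ := p
  cases a <;> rfl

theorem evalKind_map_rename {s : Cat} {A B : List Arity} (ρ : Ren A B) (σ : Asg ar A)
    (e : Expr C s) : evalKind (σ.rename ρ) e = (evalKind σ e).map (KVal.rename ρ) := by
  induction e generalizing A B with
  | type => rfl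
  | el k =>
    simp only [evalKind, eval_map_rename]
    cases eval σ k <;> simp [elVal_rename]
  | pi K K' ih ih' =>
    simp only [evalKind, ih]
    cases evalKind σ K with
    | none => rfl
    | some p =>
      simp only [Option.map_some, Option.bind_some, KVal.rename, ← Asg.rename_lift, ih',
        Option.map_map]
      rfl
  | _ => rfl

theorem evalKind_map_subst {γ : Arity} {s : Cat} {A B : List Arity} (τ : TF.Env ar γ A B)
    (σ : Asg ar A) (e : Expr C s) :
    evalKind (σ.subst τ) e = (evalKind σ e).map (KVal.subst τ) := by
  induction e generalizing A B with
  | type => rfl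
  | el k =>
    simp only [evalKind, eval_map_subst]
    cases eval σ k <;> simp [elVal_subst]
  | pi K K' ih ih' =>
    simp only [evalKind, ih]
    cases evalKind σ K with
    | none => rfl
    | some p =>
      simp only [Option.map_some, Option.bind_some, KVal.subst, ← Asg.subst_lift, ih',
        Option.map_map]
      rfl
  | _ => rfl

theorem Expr.kindArity_obj (k : Obj C) : k.kindArity = .zero := by
  cases k <;> rfl

theorem Expr.kindArity_rename {s : Cat} (e : Expr C s) (r : ℕ → ℕ) :
    (e.rename r).kindArity = e.kindArity := by
  induction e generalizing r with
  | pi K K' ih ih' => simp [Expr.rename, Expr.kindArity, ih, ih']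
  | _ => rfl

theorem Expr.kindArity_subst {s : Cat} (e : Expr C s) (t : ℕ → Obj C) :
    (e.subst t).kindArity = e.kindArity := by
  induction e generalizing t with
  | pi K K' ih ih' => simp [Expr.subst, Expr.kindArity, ih, ih']
  | var i => exact Expr.kindArity_obj _
  | _ => rfl

theorem Asg.lift_comp_liftRen {A : List Arity} (σ : Asg ar A) (α : Arity) (r : ℕ → ℕ) :
    σ.lift α ∘ liftRen r = Asg.lift α (σ ∘ r) := by
  funext i; cases i <;> rfl

theorem eval_rename {s : Cat} {A : List Arity} (σ : Asg ar A) (e : Expr C s) (r : ℕ → ℕ) :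
    eval σ (e.rename r) = eval (σ ∘ r) e := by
  induction e generalizing A r with
  | lam K k _ ih =>
    simp only [Expr.rename, eval, ih, Asg.lift_comp_liftRen]
    rw [Expr.kindArity_rename]
  | app k k' ih ih' => simp only [Expr.rename, eval, ih, ih']
  | _ => rfl

theorem evalKind_rename {s : Cat} {A : List Arity} (σ : Asg ar A) (e : Expr C s) (r : ℕ → ℕ) :
    evalKind σ (e.rename r) = evalKind (σ ∘ r) e := by
  induction e generalizing A r with
  | el k => simp only [Expr.rename, evalKind, eval_rename]
  | pi K K' ih ih' => simp only [Expr.rename, evalKind, ih, ih', Asg.lift_comp_liftRen]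
  | _ => rfl

/-- The assignment that a substitution followed by `σ` amounts to. -/
def Asg.comp {A : List Arity} (t : ℕ → Obj C) (σ : Asg ar A) : Asg ar A := fun i => eval σ (t i)

theorem Asg.lift_comp_succ {A : List Arity} (σ : Asg ar A) (α : Arity) :
    σ.lift α ∘ Nat.succ = σ.rename Ren.wk := rfl

theorem Asg.comp_liftSub {A : List Arity} (σ : Asg ar A) (α : Arity) (t : ℕ → Obj C) :
    Asg.comp (liftSub t) (σ.lift α) = (Asg.comp t σ).lift α := by
  funext i
  cases i with
  | zero => rfl
  | succ i =>
    simp only [Asg.comp, liftSub, Expr.weaken, eval_rename, Asg.lift_comp_succ, eval_map_rename]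
    rfl

theorem eval_subst {s : Cat} {A : List Arity} (σ : Asg ar A) (e : Expr C s) (t : ℕ → Obj C) :
    eval σ (e.subst t) = eval (Asg.comp t σ) e := by
  induction e generalizing A t with
  | lam K k _ ih =>
    simp only [Expr.subst, eval, ih, Asg.comp_liftSub]
    rw [Expr.kindArity_subst]
  | app k k' ih ih' => simp only [Expr.subst, eval, ih, ih']
  | _ => rfl

theorem evalKind_obj {A : List Arity} (σ : Asg ar A) (k : Obj C) : evalKind σ k = none := by
  cases k <;> rfl

theorem evalKind_subst {s : Cat} {A : List Arity} (σ : Asg ar A) (e : Expr C s)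
    (t : ℕ → Obj C) : evalKind σ (e.subst t) = evalKind (Asg.comp t σ) e := by
  induction e generalizing A t with
  | el k => simp only [Expr.subst, evalKind, eval_subst]
  | pi K K' ih ih' => simp only [Expr.subst, evalKind, ih, ih', Asg.comp_liftSub]
  | var i => exact evalKind_obj σ (t i)
  | _ => rfl

/-- `τ` extends `σ`. -/
def Asg.Le {A : List Arity} (σ τ : Asg ar A) : Prop := ∀ i p, σ i = some p → τ i = some p

theorem Asg.Le.lift {A : List Arity} {σ τ : Asg ar A} (h : σ.Le τ) (α : Arity) :
    (σ.lift α).Le (τ.lift α) := by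
  intro i p hp
  cases i with
  | zero => exact hp
  | succ i =>
    simp only [Asg.lift, Asg.push, Asg.rename, Option.map_eq_some_iff] at hp ⊢
    obtain ⟨q, hq, rfl⟩ := hp
    exact ⟨q, h i q hq, rfl⟩

theorem eval_mono {s : Cat} {A : List Arity} {σ τ : Asg ar A} (h : σ.Le τ) (e : Expr C s)
    {p : Val ar A} (hp : eval σ e = some p) : eval τ e = some p := by
  induction e generalizing A with
  | var i => exact h i p hp
  | con c => exact hp
  | lam K k _ ih =>
    simp only [eval, Option.map_eq_some_iff] at hp ⊢
    obtain ⟨q, hq, rfl⟩ := hp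
    exact ⟨q, ih (h.lift _) hq, rfl⟩
  | app k k' ih ih' =>
    simp only [eval, Option.bind_eq_some_iff] at hp ⊢
    obtain ⟨q, hq, r, hr, hqr⟩ := hp
    exact ⟨q, ih h hq, r, ih' h hr, hqr⟩
  | _ => simp [eval] at hp

theorem evalKind_mono {s : Cat} {A : List Arity} {σ τ : Asg ar A} (h : σ.Le τ) (e : Expr C s)
    {p : KVal ar A} (hp : evalKind σ e = some p) : evalKind τ e = some p := by
  induction e generalizing A with
  | type => exact hp
  | el k =>
    simp only [evalKind, Option.bind_eq_some_iff] at hp ⊢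
    obtain ⟨q, hq, hqp⟩ := hp
    exact ⟨q, eval_mono h k hq, hqp⟩
  | pi K K' ih ih' =>
    simp only [evalKind, Option.bind_eq_some_iff, Option.map_eq_some_iff] at hp ⊢
    obtain ⟨q, hq, r, hr, rfl⟩ := hp
    exact ⟨q, ih h hq, r, ih' (h.lift _) hr, rfl⟩
  | _ => simp [evalKind] at hp

theorem evalKind_arity {s : Cat} {A : List Arity} {σ : Asg ar A} {e : Expr C s}
    {p : KVal ar A} (hp : evalKind σ e = some p) : p.1 = e.kindArity := by
  induction e generalizing A with
  | type => simp only [evalKind, Option.some.injEq] at hp; subst hp; rfl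
  | el k =>
    simp only [evalKind, Option.bind_eq_some_iff] at hp
    obtain ⟨⟨a, F⟩, hq, hqp⟩ := hp
    cases a with
    | zero => simp only [elVal, Option.some.injEq] at hqp; subst hqp; rfl
    | cons => simp [elVal] at hqp
  | pi K K' ih ih' =>
    simp only [evalKind, Option.bind_eq_some_iff, Option.map_eq_some_iff] at hp
    obtain ⟨q, hq, r, hr, rfl⟩ := hp
    simp only [Expr.kindArity, ih hq, ih' hr]
  | _ => simp [evalKind] at hp

theorem evalKind_pi {A : List Arity} {σ : Asg ar A} {K K' : Kind C} {p : KVal ar A}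
    (hp : evalKind σ (.pi K K') = some p) :
    ∃ (α β : Arity) (L : TF.Kind ar A α) (L' : TF.Kind ar (α :: A) β),
      evalKind σ K = some ⟨α, L⟩ ∧ evalKind (σ.lift α) K' = some ⟨β, L'⟩ ∧
        p = ⟨.cons α β, .pi L L'⟩ := by
  simp only [evalKind, Option.bind_eq_some_iff, Option.map_eq_some_iff] at hp
  obtain ⟨q, hq, r, hr, rfl⟩ := hp
  exact ⟨q.1, r.1, q.2, r.2, hq, hr, rfl⟩

theorem evalKind_pi_mk {A : List Arity} {σ : Asg ar A} {K K' : Kind C} {α β : Arity}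
    {L : TF.Kind ar A α} {L' : TF.Kind ar (α :: A) β} (h : evalKind σ K = some ⟨α, L⟩)
    (h' : evalKind (σ.lift α) K' = some ⟨β, L'⟩) :
    evalKind σ (.pi K K') = some ⟨.cons α β, .pi L L'⟩ := by
  simp [evalKind, h, h']

/-! ### The translation as evaluation -/

/-- The assignment of the eta-long forms of all variables. -/
def etaAsg (ar : C → Arity) (A : List Arity) : Asg ar A :=
  fun i => (Var.find A i).map fun p => ⟨p.1, TF.eta (.var p.2)⟩

theorem etaAsg_cons (α : Arity) (A : List Arity) :
    etaAsg ar (α :: A) = (etaAsg ar A).lift α := by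
  funext i
  cases i with
  | zero => rfl
  | succ i =>
    simp only [etaAsg, Var.find, Asg.lift, Asg.push, Asg.rename]
    cases Var.find A i <;> simp [Val.rename, TF.eta_rename, TF.Head.rename, Ren.wk]

theorem nfObj_eq_eval {s : Cat} (A : List Arity) (e : Expr C s) :
    nfObj ar A e = eval (etaAsg ar A) e := by
  induction e generalizing A with
  | lam K k _ ih => simp only [nfObj, eval, ih, etaAsg_cons]
  | app k k' ih ih' =>
    simp only [nfObj, eval, ih, ih']
    generalize eval (etaAsg ar A) k = p
    generalize eval (etaAsg ar A) k' = q
    rcases p with _ | ⟨_ | ⟨α, β⟩, F⟩ <;> rcases q with _ | ⟨α', G⟩ <;> rfl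
  | _ => rfl

theorem nfKind_eq_evalKind {s : Cat} (A : List Arity) (e : Expr C s) :
    (nfKind ar A e).map (fun L => (⟨_, L⟩ : KVal ar A)) = evalKind (etaAsg ar A) e := by
  induction e generalizing A with
  | type => rfl
  | el k =>
    simp only [nfKind, evalKind, nfObj_eq_eval]
    generalize eval (etaAsg ar A) k = p
    rcases p with _ | ⟨_ | ⟨α, β⟩, F⟩ <;> rfl
  | pi K K' ih ih' =>
    simp only [nfKind, evalKind, ← ih]
    cases nfKind ar A K with
    | none => rfl
    | some L =>
      simp only [Option.map_some, Option.bind_some, ← etaAsg_cons, ← ih']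
      cases nfKind ar (K.kindArity :: A) K' <;> rfl
  | _ => rfl

/-- The normal form of a context extension, together with its list of arities. -/
def evalTele (ar : C → Arity) (A : List Arity) : Ctx C → Option (Σ D, TF.Tele ar A D)
  | [] => some ⟨[], .nil⟩
  | K :: Θ =>
      (evalTele ar A Θ).bind fun t =>
        (evalKind (etaAsg ar (t.1 ++ A)) K).map fun L => ⟨L.1 :: t.1, .snoc t.2 L.2⟩

theorem nfTele_eq_evalTele (A : List Arity) (Θ : Ctx C) :
    (nfTele ar A Θ).map (fun t => (⟨_, t⟩ : Σ D, TF.Tele ar A D)) = evalTele ar A Θ := by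
  induction Θ with
  | nil => rfl
  | cons K Θ ih =>
    simp only [nfTele, evalTele, ← ih]
    cases nfTele ar A Θ with
    | none => rfl
    | some t =>
      simp only [Option.map_some, Option.bind_some, ← nfKind_eq_evalKind]
      cases nfKind ar (Ctx.arities Θ ++ A) K <;> rfl

theorem NFObj_iff {T : Spec C} {Γ : Ctx C} {k : Obj C} {A : List Arity} {α : Arity}
    {F : TF.Abs T.ar A α} :
    T.NFObj Γ k F ↔ A = Γ.arities ∧ eval (etaAsg T.ar A) k = some ⟨α, F⟩ := by
  rw [Spec.NFObj, nfObj_eq_eval]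

theorem NFKind_iff {T : Spec C} {Γ : Ctx C} {K : Kind C} {A : List Arity} {α : Arity}
    {L : TF.Kind T.ar A α} :
    T.NFKind Γ K L ↔ A = Γ.arities ∧ evalKind (etaAsg T.ar A) K = some ⟨α, L⟩ := by
  rw [Spec.NFKind, nfKind_eq_evalKind]

theorem NFTele_iff {T : Spec C} {Γ Θ : Ctx C} {A D : List Arity} {t : TF.Tele T.ar A D} :
    T.NFTele Γ Θ t ↔ A = Γ.arities ∧ evalTele T.ar A Θ = some ⟨D, t⟩ := by
  rw [Spec.NFTele, nfTele_eq_evalTele]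

/-! ### Normal forms and arities -/

theorem Var.find_eq_getElem (A : List Arity) (i : ℕ) :
    (Var.find A i).map (fun p => p.1) = A[i]? := by
  induction A generalizing i with
  | nil => rfl
  | cons α A ih =>
    cases i with
    | zero => rfl
    | succ i =>
      simp only [Var.find, Option.map_map, List.getElem?_cons_succ, ← ih]
      rfl

theorem objArity_eq {s : Cat} (A : List Arity) (e : Expr C s) :
    objArity ar A e = (nfObj ar A e).map (fun p => p.1) := by
  induction e generalizing A with
  | var i =>
    simp only [objArity, nfObj, Option.map_map, ← Var.find_eq_getElem]
    rfl
  | lam K k _ ih =>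
    simp only [objArity, nfObj, ih, Option.map_map]
    rfl
  | app k k' ih ih' =>
    simp only [objArity, nfObj, ih, ih']
    generalize nfObj ar A k = p
    generalize nfObj ar A k' = q
    rcases p with _ | ⟨_ | ⟨α, β⟩, F⟩ <;> rcases q with _ | ⟨α', G⟩ <;> try rfl
    by_cases h : α' = α <;> simp [h]
  | _ => rfl

theorem NFKind_arity {T : Spec C} {Γ : Ctx C} {K : Kind C} {A : List Arity} {α : Arity}
    {L : TF.Kind T.ar A α} (h : T.NFKind Γ K L) : α = K.kindArity :=
  evalKind_arity (NFKind_iff.1 h).2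

theorem Ar_eq_some_iff (T : Spec C) (Γ : Ctx C) (k : Obj C) (α : Arity) :
    T.Ar Γ k = some α ↔ ∃ F : TF.Abs T.ar Γ.arities α, T.NFObj Γ k F := by
  rw [Spec.Ar, objArity_eq, Option.map_eq_some_iff]
  constructor
  · rintro ⟨⟨α', F⟩, h, rfl⟩
    exact ⟨F, rfl, h⟩
  · rintro ⟨F, -, h⟩
    exact ⟨_, h, rfl⟩

/-! ### Normal forms and renaming -/

/-- The renaming `r` of indices acts as `ρ` on the variables of the scope `A`. -/
def RenRel {A B : List Arity} (r : ℕ → ℕ) (ρ : Ren A B) : Prop :=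
  ∀ i p, Var.find A i = some p → Var.find B (r i) = some ⟨p.1, ρ _ p.2⟩

theorem RenRel.lift {A B : List Arity} {r : ℕ → ℕ} {ρ : Ren A B} (h : RenRel r ρ) (α : Arity) :
    RenRel (liftRen r) (ρ.lift (γ := α)) := by
  intro i p hp
  cases i with
  | zero =>
    simp only [Var.find, Option.some.injEq] at hp
    subst hp; rfl
  | succ i =>
    simp only [Var.find, Option.map_eq_some_iff, liftRen] at hp ⊢
    obtain ⟨q, hq, rfl⟩ := hp
    exact ⟨_, h i q hq, rfl⟩

theorem RenRel.liftN {A B : List Arity} {r : ℕ → ℕ} {ρ : Ren A B} (h : RenRel r ρ)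
    (D : List Arity) : RenRel (liftRenN r D.length) (ρ.liftN D) := by
  induction D with
  | nil => exact h
  | cons α D ih => exact ih.lift α

theorem RenRel.le {A B : List Arity} {r : ℕ → ℕ} {ρ : Ren A B} (h : RenRel r ρ) :
    ((etaAsg ar A).rename ρ).Le (etaAsg ar B ∘ r) := by
  intro i p hp
  simp only [Asg.rename, etaAsg, Option.map_map, Option.map_eq_some_iff, Function.comp] at hp ⊢
  obtain ⟨q, hq, rfl⟩ := hp
  refine ⟨_, h i q hq, ?_⟩
  simp only [Val.rename, TF.eta_rename, TF.Head.rename]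

theorem RenRel.eval {A B : List Arity} {r : ℕ → ℕ} {ρ : Ren A B} (h : RenRel r ρ) {k : Obj C}
    {p : Val ar A} (hp : eval (etaAsg ar A) k = some p) :
    LF.eval (etaAsg ar B) (k.rename r) = some (p.rename ρ) := by
  rw [eval_rename]
  refine eval_mono h.le k ?_
  rw [eval_map_rename, hp]; rfl

theorem RenRel.evalKind {A B : List Arity} {r : ℕ → ℕ} {ρ : Ren A B} (h : RenRel r ρ)
    {K : Kind C} {p : KVal ar A} (hp : evalKind (etaAsg ar A) K = some p) :
    LF.evalKind (etaAsg ar B) (K.rename r) = some (p.rename ρ) := by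
  rw [evalKind_rename]
  refine evalKind_mono h.le K ?_
  rw [evalKind_map_rename, hp]; rfl

theorem evalTele_length {A : List Arity} {Θ : Ctx C} {t : Σ D, TF.Tele ar A D}
    (ht : evalTele ar A Θ = some t) : t.1.length = Θ.length := by
  induction Θ generalizing t with
  | nil => simp only [evalTele, Option.some.injEq] at ht; subst ht; rfl
  | cons K Θ ih =>
    simp only [evalTele, Option.bind_eq_some_iff, Option.map_eq_some_iff] at ht
    obtain ⟨u, hu, L, hL, rfl⟩ := ht
    simp [ih hu]

theorem RenRel.evalTele {A B : List Arity} {r : ℕ → ℕ} {ρ : Ren A B} (h : RenRel r ρ)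
    {Θ : Ctx C} {t : Σ D, TF.Tele ar A D} (ht : evalTele ar A Θ = some t) :
    LF.evalTele ar B (Ctx.rename r Θ) = some ⟨t.1, t.2.rename ρ⟩ := by
  induction Θ generalizing t with
  | nil => simp only [LF.evalTele, Option.some.injEq] at ht; subst ht; rfl
  | cons K Θ ih =>
    simp only [LF.evalTele, Option.bind_eq_some_iff, Option.map_eq_some_iff] at ht
    obtain ⟨u, hu, L, hL, rfl⟩ := ht
    have hK := (h.liftN u.1).evalKind hL
    rw [evalTele_length hu] at hK
    simp only [Ctx.rename, LF.evalTele, ih hu, Option.bind_some, hK, Option.map_some]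
    rfl

theorem Var.find_toNat {A : List Arity} {α : Arity} (x : Var A α) :
    Var.find A x.toNat = some ⟨α, x⟩ := by
  induction x with
  | zero => rfl
  | succ x ih => simp [Var.toNat, Var.find, ih]

theorem Var.toNat_of_find {A : List Arity} {i : ℕ} {p : Σ α, Var A α}
    (h : Var.find A i = some p) : p.2.toNat = i := by
  induction A generalizing i with
  | nil => simp [Var.find] at h
  | cons α A ih =>
    cases i with
    | zero => simp only [Var.find, Option.some.injEq] at h; subst h; rfl
    | succ i =>
      simp only [Var.find, Option.map_eq_some_iff] at h
      obtain ⟨q, hq, rfl⟩ := h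
      simp [Var.toNat, ih hq]

theorem Ctx.lookup_find (Γ : Ctx C) (i : ℕ) :
    (Ctx.lookup Γ i).map (fun K => K.kindArity) =
      (Var.find (Ctx.arities Γ) i).map (fun p => p.1) := by
  induction Γ generalizing i with
  | nil => rfl
  | cons K Γ ih =>
    rw [show Ctx.arities (K :: Γ) = K.kindArity :: Ctx.arities Γ from rfl]
    cases i with
    | zero => simp [Ctx.lookup, Var.find, Expr.weaken, Expr.kindArity_rename]
    | succ i =>
      have h : (fun L : Kind C => L.kindArity) ∘ Expr.weaken = fun L => L.kindArity :=
        funext fun L => Expr.kindArity_rename L _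
      simp only [Ctx.lookup, Var.find, Option.map_map, h, ih]
      rfl

/-- A renaming of indices that respects the declared kinds comes from an arity-preserving
renaming. -/
theorem exists_renRel {Γ Δ : Ctx C} {r : ℕ → ℕ}
    (h : ∀ (i : ℕ) (K : Kind C),
      Ctx.lookup Γ i = some K → Ctx.lookup Δ (r i) = some (K.rename r)) :
    ∃ ρ : Ren Γ.arities Δ.arities, ∀ (α : Arity) (x : Var Γ.arities α),
      (ρ α x).toNat = r x.toNat := by
  have : ∀ (α : Arity) (x : Var Γ.arities α), ∃ y : Var Δ.arities α, y.toNat = r x.toNat := by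
    intro α x
    have hx := Ctx.lookup_find Γ x.toNat
    rw [Var.find_toNat, Option.map_some, Option.map_eq_some_iff] at hx
    obtain ⟨K, hK, rfl⟩ := hx
    have hy := Ctx.lookup_find Δ (r x.toNat)
    rw [h _ _ hK, Option.map_some, Expr.kindArity_rename, eq_comm, Option.map_eq_some_iff] at hy
    obtain ⟨⟨β, y⟩, hy, rfl⟩ := hy
    exact ⟨y, Var.toNat_of_find hy⟩
  choose ρ hρ using this
  exact ⟨ρ, hρ⟩

theorem RenRel.of_toNat {A B : List Arity} {r : ℕ → ℕ} {ρ : Ren A B}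
    (h : ∀ (α : Arity) (x : Var A α), (ρ α x).toNat = r x.toNat) : RenRel r ρ := by
  intro i p hp
  rw [← Var.toNat_of_find hp, ← h, Var.find_toNat]

/-! ### Normal forms and substitution -/

/-- The substitution `t` acts as `τ` on the variables of the scope `A`. -/
def SubRel {α : Arity} {A B : List Arity} (t : ℕ → Obj C) (τ : TF.Env ar α A B) : Prop :=
  ((etaAsg ar A).subst τ).Le (Asg.comp t (etaAsg ar B))

theorem SubRel.lift {α : Arity} {A B : List Arity} {t : ℕ → Obj C} {τ : TF.Env ar α A B}
    (h : SubRel t τ) (γ : Arity) : SubRel (liftSub t) (τ.lift (γ := γ)) := by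
  unfold SubRel
  rw [etaAsg_cons, etaAsg_cons, Asg.subst_lift, Asg.comp_liftSub]
  exact Asg.Le.lift h γ

theorem SubRel.liftN {α : Arity} {A B : List Arity} {t : ℕ → Obj C} {τ : TF.Env ar α A B}
    (h : SubRel t τ) (D : List Arity) : SubRel (liftSubN t D.length) (τ.liftN D) := by
  induction D with
  | nil => exact h
  | cons γ D ih => exact ih.lift γ

theorem SubRel.eval {α : Arity} {A B : List Arity} {t : ℕ → Obj C} {τ : TF.Env ar α A B}
    (h : SubRel t τ) {k : Obj C} {p : Val ar A} (hp : eval (etaAsg ar A) k = some p) :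
    LF.eval (etaAsg ar B) (k.subst t) = some (p.subst τ) := by
  rw [eval_subst]
  refine eval_mono h k ?_
  rw [eval_map_subst, hp]; rfl

theorem SubRel.evalKind {α : Arity} {A B : List Arity} {t : ℕ → Obj C} {τ : TF.Env ar α A B}
    (h : SubRel t τ) {K : Kind C} {p : KVal ar A} (hp : evalKind (etaAsg ar A) K = some p) :
    LF.evalKind (etaAsg ar B) (K.subst t) = some (p.subst τ) := by
  rw [evalKind_subst]
  refine evalKind_mono h K ?_
  rw [evalKind_map_subst, hp]; rfl

theorem SubRel.single {α : Arity} {A : List Arity} {k : Obj C} {F : TF.Abs ar A α}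
    (h : LF.eval (etaAsg ar A) k = some ⟨α, F⟩) :
    SubRel (LF.listSub [k]) (TF.Env.single F) := by
  intro i p hp
  cases i with
  | zero =>
    simp only [Asg.subst, etaAsg, Var.find, Option.map_some, Option.some.injEq] at hp
    subst hp
    refine h.trans ?_
    simp only [Val.subst]
    rw [TF.eta_subst_abs _ F _ rfl]
  | succ i =>
    simp only [Asg.subst, etaAsg, Var.find, Option.map_map, Option.map_eq_some_iff,
      Function.comp] at hp
    obtain ⟨q, hq, rfl⟩ := hp
    refine Option.map_eq_some_iff.2 ⟨q, hq, ?_⟩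
    simp only [Val.subst]
    rw [TF.eta_subst_var q.2.succ q.2 (TF.Env.single F) rfl]

theorem liftSubN_add (t : ℕ → Obj C) (m n : ℕ) :
    liftSubN (liftSubN t n) m = liftSubN t (m + n) := by
  induction m with
  | zero => simp [liftSubN]
  | succ m ih => rw [Nat.succ_add, liftSubN, liftSubN, ih]

theorem SubRel.evalTele {α : Arity} {A B : List Arity} {n : ℕ} {k : Obj C}
    {τ : TF.Env ar α A B} (h : SubRel (liftSubN (listSub [k]) n) τ)
    {Θ : Ctx C} {t : Σ D, TF.Tele ar A D} (ht : evalTele ar A Θ = some t) :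
    LF.evalTele ar B (Ctx.inst n k Θ) = some ⟨t.1, t.2.subst τ⟩ := by
  induction Θ generalizing t with
  | nil => simp only [LF.evalTele, Option.some.injEq] at ht; subst ht; rfl
  | cons K Θ ih =>
    simp only [LF.evalTele, Option.bind_eq_some_iff, Option.map_eq_some_iff] at ht
    obtain ⟨u, hu, L, hL, rfl⟩ := ht
    have hK := (h.liftN u.1).evalKind hL
    rw [evalTele_length hu, liftSubN_add] at hK
    simp only [Ctx.inst, LF.evalTele, ih hu, Option.bind_some, Expr.inst, hK, Option.map_some]
    rfl

theorem Ctx.arities_inst (n : ℕ) (k : Obj C) (Θ : Ctx C) :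
    Ctx.arities (Ctx.inst n k Θ) = Ctx.arities Θ := by
  induction Θ with
  | nil => rfl
  | cons K Θ ih =>
    simp only [Ctx.inst, Ctx.arities, List.map_cons, Expr.inst, Expr.kindArity_subst] at ih ⊢
    rw [ih]

theorem Ctx.arities_append (Δ Γ : Ctx C) :
    Ctx.arities (Δ ++ Γ) = Ctx.arities Δ ++ Ctx.arities Γ := List.map_append

theorem Ctx.arities_inst_append (k : Obj C) (Δ Γ : Ctx C) :
    Ctx.arities Δ ++ Ctx.arities Γ = Ctx.arities (Ctx.inst 0 k Δ ++ Γ) := by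
  rw [Ctx.arities_append, Ctx.arities_inst]

theorem NF_rename (T : Spec C) (Γ Δ : Ctx C) (ρ : ℕ → ℕ)
    (h : ∀ (i : ℕ) (K : Kind C),
      Ctx.lookup Γ i = some K → Ctx.lookup Δ (ρ i) = some (K.rename ρ)) :
    ∃ ρ' : Ren Γ.arities Δ.arities,
      (∀ (α : Arity) (x : Var Γ.arities α), (ρ' α x).toNat = ρ x.toNat) ∧
      (∀ (k : Obj C) (α : Arity) (F : TF.Abs T.ar Γ.arities α),
        T.NFObj Γ k F → T.NFObj Δ (k.rename ρ) (F.rename ρ')) ∧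
      (∀ (K : Kind C) (α : Arity) (L : TF.Kind T.ar Γ.arities α),
        T.NFKind Γ K L → T.NFKind Δ (K.rename ρ) (L.rename ρ')) ∧
      (∀ (Θ : Ctx C) (D : List Arity) (t : TF.Tele T.ar Γ.arities D),
        T.NFTele Γ Θ t → T.NFTele Δ (Ctx.rename ρ Θ) (t.rename ρ')) := by
  obtain ⟨ρ', hρ'⟩ := exists_renRel h
  have hr := RenRel.of_toNat hρ'
  exact ⟨ρ', hρ', fun k α F hF => NFObj_iff.2 ⟨rfl, hr.eval (NFObj_iff.1 hF).2⟩,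
    fun K α L hL => NFKind_iff.2 ⟨rfl, hr.evalKind (NFKind_iff.1 hL).2⟩,
    fun Θ D t ht => NFTele_iff.2 ⟨rfl, hr.evalTele (NFTele_iff.1 ht).2⟩⟩

theorem NF_inst (T : Spec C) (Γ Δ : Ctx C) (K : Kind C) (k : Obj C)
    (F : TF.Abs T.ar Γ.arities K.kindArity) (hF : T.NFObj Γ k F) :
    (∀ (l : Obj C) (α : Arity) (G : TF.Abs T.ar (Δ.arities ++ K.kindArity :: Γ.arities) α),
      T.NFObj (Δ ++ K :: Γ) l G →
      T.NFObj (Ctx.inst 0 k Δ ++ Γ) (Expr.inst Δ.length k l)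
        (TF.Expr.inst Δ.arities F G)) ∧
    (∀ (M : Kind C) (α : Arity)
        (L : TF.Kind T.ar (Δ.arities ++ K.kindArity :: Γ.arities) α),
      T.NFKind (Δ ++ K :: Γ) M L →
      T.NFKind (Ctx.inst 0 k Δ ++ Γ) (Expr.inst Δ.length k M)
        (TF.Kind.inst Δ.arities F L)) ∧
    (∀ (Θ : Ctx C) (D : List Arity)
        (t : TF.Tele T.ar (Δ.arities ++ K.kindArity :: Γ.arities) D),
      T.NFTele (Δ ++ K :: Γ) Θ t →
      T.NFTele (Ctx.inst 0 k Δ ++ Γ) (Ctx.inst Δ.length k Θ)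
        (TF.Tele.inst Δ.arities F t)) := by
  have hs := (SubRel.single (NFObj_iff.1 hF).2).liftN Δ.arities
  have hlen : (Ctx.arities Δ).length = Δ.length := List.length_map _
  rw [hlen] at hs
  have hA := Ctx.arities_inst_append k Δ Γ
  exact ⟨fun l α G hG => NFObj_iff.2 ⟨hA, hs.eval (NFObj_iff.1 hG).2⟩,
    fun M α L hL => NFKind_iff.2 ⟨hA, hs.evalKind (NFKind_iff.1 hL).2⟩,
    fun Θ D t ht => NFTele_iff.2 ⟨hA, hs.evalTele (NFTele_iff.1 ht).2⟩⟩

end LF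

namespace TF

variable {C : Type u} {ar : C → Arity} {Sp : Spec ar}

/-! ### Renaming of derivations in TF -/

/-- The renaming `ρ` respects the declared kinds. -/
def IsRen {A B : List Arity} (Γ : Ctx ar A) (Γ' : Ctx ar B) (ρ : Ren A B) : Prop :=
  ∀ (α : Arity) (x : Var A α), Γ'.lookup (ρ α x) = (Γ.lookup x).rename ρ

/-- Kind-preserving renamings that are obtained from one into a valid context by going under
binders.  Validity of the extended target context is not required; it follows from derivability of
a judgement over the extended source context. -/
inductive WkExt (Sp : Spec ar) : {A B : List Arity} → Ctx ar A → Ctx ar B → Ren A B → Prop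
  | base {A B : List Arity} {Γ : Ctx ar A} {Γ' : Ctx ar B} {ρ : Ren A B} :
      IsRen Γ Γ' ρ → Derivable Sp (.valid Γ') → WkExt Sp Γ Γ' ρ
  | snoc {A B : List Arity} {Γ : Ctx ar A} {Γ' : Ctx ar B} {ρ : Ren A B} {α : Arity}
      {K : Kind ar A α} : WkExt Sp Γ Γ' ρ → WkExt Sp (Γ.snoc K) (Γ'.snoc (K.rename ρ)) ρ.lift

theorem IsRen.lift {A B : List Arity} {Γ : Ctx ar A} {Γ' : Ctx ar B} {ρ : Ren A B}
    (h : IsRen Γ Γ' ρ) {α : Arity} (K : Kind ar A α) :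
    IsRen (Γ.snoc K) (Γ'.snoc (K.rename ρ)) ρ.lift := by
  intro β x
  cases x with
  | zero => simp only [Ctx.lookup, Ren.lift, Kind.rename_rename, Ren.wk_lift]
  | succ x => simp only [Ctx.lookup, Ren.lift, Kind.rename_rename, Ren.wk_lift, h _ x]

theorem WkExt.isRen {A B : List Arity} {Γ : Ctx ar A} {Γ' : Ctx ar B} {ρ : Ren A B}
    (h : WkExt Sp Γ Γ' ρ) : IsRen Γ Γ' ρ := by
  induction h with
  | base h _ => exact h
  | snoc _ ih => exact ih.lift _

theorem isRen_wk {A : List Arity} {α : Arity} (Γ : Ctx ar A) (K : Kind ar A α) :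
    IsRen Γ (Γ.snoc K) Ren.wk := fun _ _ => rfl

theorem IsRen.comp {A B D : List Arity} {Γ : Ctx ar A} {Γ' : Ctx ar B} {Γ'' : Ctx ar D}
    {ρ : Ren A B} {ρ' : Ren B D} (h : IsRen Γ Γ' ρ) (h' : IsRen Γ' Γ'' ρ') :
    IsRen Γ Γ'' (Ren.comp ρ ρ') := by
  intro α x
  rw [Ren.comp, h', h, Kind.rename_rename]

/-- All renamings of the judgement along a `WkExt` are derivable, and their context is valid. -/
def RenDerivable (Sp : Spec ar) : Judg ar → Prop
  | @Judg.valid _ _ A Γ => ∀ (B : List Arity) (Γ' : Ctx ar B) (ρ : Ren A B), WkExt Sp Γ Γ' ρ →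
      Derivable Sp (.valid Γ')
  | @Judg.typ _ _ A Γ M T => ∀ (B : List Arity) (Γ' : Ctx ar B) (ρ : Ren A B), WkExt Sp Γ Γ' ρ →
      Derivable Sp (.valid Γ') ∧ Derivable Sp (.typ Γ' (M.rename ρ) (T.rename ρ))
  | @Judg.eq _ _ A Γ M N T => ∀ (B : List Arity) (Γ' : Ctx ar B) (ρ : Ren A B), WkExt Sp Γ Γ' ρ →
      Derivable Sp (.valid Γ') ∧ Derivable Sp (.eq Γ' (M.rename ρ) (N.rename ρ) (T.rename ρ))

theorem kindJ_rename {A B : List Arity} {α : Arity} {Γ : Ctx ar A} {Γ' : Ctx ar B} {ρ : Ren A B}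
    {K : Kind ar A α} (hρ : WkExt Sp Γ Γ' ρ) (h : ∀ J ∈ kindJ Γ K, RenDerivable Sp J) :
    ∀ J ∈ kindJ Γ' (K.rename ρ), Derivable Sp J := by
  induction K generalizing B with
  | type =>
    rintro J rfl
    exact h _ rfl _ _ _ hρ
  | el M =>
    rintro J rfl
    exact (h _ rfl _ _ _ hρ).2
  | pi K K' _ ih => exact ih hρ.snoc h

theorem absJ_rename {A B : List Arity} {α : Arity} {Γ : Ctx ar A} {Γ' : Ctx ar B} {ρ : Ren A B}
    {K : Kind ar A α} {F : Abs ar A α} (hρ : WkExt Sp Γ Γ' ρ)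
    (h : ∀ J ∈ absJ Γ F K, RenDerivable Sp J) :
    ∀ J ∈ absJ Γ' (F.rename ρ) (K.rename ρ), Derivable Sp J := by
  induction K generalizing B with
  | type =>
    rintro J rfl
    exact (h _ rfl _ _ _ hρ).2
  | el M =>
    rintro J rfl
    exact (h _ rfl _ _ _ hρ).2
  | pi K K' _ ih =>
    have := ih hρ.snoc h
    rw [← Expr.body_rename] at this
    exact this

theorem absEqJ_rename {A B : List Arity} {α : Arity} {Γ : Ctx ar A} {Γ' : Ctx ar B}
    {ρ : Ren A B} {K : Kind ar A α} {F G : Abs ar A α} (hρ : WkExt Sp Γ Γ' ρ)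
    (h : ∀ J ∈ absEqJ Γ F G K, RenDerivable Sp J) :
    ∀ J ∈ absEqJ Γ' (F.rename ρ) (G.rename ρ) (K.rename ρ), Derivable Sp J := by
  induction K generalizing B with
  | type =>
    rintro J rfl
    exact (h _ rfl _ _ _ hρ).2
  | el M =>
    rintro J rfl
    exact (h _ rfl _ _ _ hρ).2
  | pi K K' _ ih =>
    have := ih hρ.snoc h
    rw [← Expr.body_rename, ← Expr.body_rename] at this
    exact this

theorem seqJ_rename {A B : List Arity} (α : Arity) {Γ : Ctx ar A} {Γ' : Ctx ar B} {ρ : Ren A B}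
    {K : Kind ar A α} {S : Seq ar A α} (hρ : WkExt Sp Γ Γ' ρ)
    (h : ∀ J ∈ seqJ α Γ S K, RenDerivable Sp J) :
    Derivable Sp (.valid Γ') ∧ ∀ J ∈ seqJ α Γ' (S.rename ρ) (K.rename ρ), Derivable Sp J := by
  induction α with
  | zero =>
    have := h _ rfl _ _ _ hρ
    exact ⟨this, by rintro J rfl; exact this⟩
  | cons α β _ ih =>
    have h1 := absJ_rename hρ (fun J hJ => h J (.inl hJ))
    have h2 := ih (fun J hJ => h J (.inr hJ))
    rw [Kind.inst_rename, ← Kind.cod_rename, ← Expr.head_rename, ← Expr.tail_rename] at h2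
    rw [← Expr.head_rename, ← Kind.dom_rename] at h1
    exact ⟨h2.1, fun J hJ => hJ.elim (h1 J) (h2.2 J)⟩

theorem seqEqJ_rename {A B : List Arity} (α : Arity) {Γ : Ctx ar A} {Γ' : Ctx ar B}
    {ρ : Ren A B} {K : Kind ar A α} {S S' : Seq ar A α} (hρ : WkExt Sp Γ Γ' ρ)
    (h : ∀ J ∈ seqEqJ α Γ S S' K, RenDerivable Sp J) :
    Derivable Sp (.valid Γ') ∧
      ∀ J ∈ seqEqJ α Γ' (S.rename ρ) (S'.rename ρ) (K.rename ρ), Derivable Sp J := by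
  induction α with
  | zero =>
    have := h _ rfl _ _ _ hρ
    exact ⟨this, by rintro J rfl; exact this⟩
  | cons α β _ ih =>
    have h1 := absEqJ_rename hρ (fun J hJ => h J (.inl hJ))
    have h2 := ih (fun J hJ => h J (.inr hJ))
    rw [Kind.inst_rename, ← Kind.cod_rename, ← Expr.head_rename, ← Expr.tail_rename,
      ← Expr.tail_rename] at h2
    rw [← Expr.head_rename, ← Expr.head_rename, ← Kind.dom_rename] at h1
    exact ⟨h2.1, fun J hJ => hJ.elim (h1 J) (h2.2 J)⟩

theorem Ren.empty_comp {A B : List Arity} (ρ : Ren A B) :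
    Ren.comp (Ren.empty A) ρ = Ren.empty B := by
  funext α x; cases x

theorem Derivable.renDerivable {J : Judg ar} (h : Derivable Sp J) : RenDerivable Sp J := by
  induction h with
  | emp_ctxt =>
    intro B Γ' ρ hρ
    cases hρ with
    | base _ h => exact h
  | ctxt h ih =>
    intro B Γ' ρ hρ
    cases hρ with
    | base _ h => exact h
    | snoc hρ => exact .ctxt (kindJ_rename hρ ih)
  | var x h ih =>
    intro B Γ' ρ hρ
    have := seqJ_rename _ hρ ih
    rw [Kind.instSeq_rename, ← hρ.isRen] at *
    exact ⟨this.1, .var _ this.2⟩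
  | var_eq x h ih =>
    intro B Γ' ρ hρ
    have := seqEqJ_rename _ hρ ih
    rw [Kind.instSeq_rename, ← hρ.isRen] at *
    exact ⟨this.1, .var_eq _ this.2⟩
  | const c h ih =>
    intro B Γ' ρ hρ
    have := seqJ_rename _ hρ ih
    rw [Kind.instSeq_rename]
    rw [Kind.rename_rename, Ren.empty_comp] at *
    exact ⟨this.1, .const _ this.2⟩
  | const_eq c h ih =>
    intro B Γ' ρ hρ
    have := seqEqJ_rename _ hρ ih
    rw [Kind.instSeq_rename]
    rw [Kind.rename_rename, Ren.empty_comp] at *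
    exact ⟨this.1, .const_eq _ this.2⟩
  | eq d hd h ih =>
    intro B Γ' ρ hρ
    have := seqJ_rename _ hρ ih
    rw [Kind.instSeq_rename, employSeq_rename, employSeq_rename, Expr.rename_rename,
      Expr.rename_rename]
    rw [Kind.rename_rename, Ren.empty_comp] at *
    exact ⟨this.1, .eq d hd this.2⟩
  | ref _ ih => exact fun B Γ' ρ hρ => ⟨(ih _ _ _ hρ).1, .ref (ih _ _ _ hρ).2⟩
  | sym _ ih => exact fun B Γ' ρ hρ => ⟨(ih _ _ _ hρ).1, .sym (ih _ _ _ hρ).2⟩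
  | trans _ _ ih ih' =>
    exact fun B Γ' ρ hρ => ⟨(ih _ _ _ hρ).1, .trans (ih _ _ _ hρ).2 (ih' _ _ _ hρ).2⟩
  | conv _ _ ih ih' =>
    exact fun B Γ' ρ hρ => ⟨(ih _ _ _ hρ).1, .conv (ih _ _ _ hρ).2 (ih' _ _ _ hρ).2⟩
  | conv_eq _ _ ih ih' =>
    exact fun B Γ' ρ hρ => ⟨(ih _ _ _ hρ).1, .conv_eq (ih _ _ _ hρ).2 (ih' _ _ _ hρ).2⟩

/-- Kind-preserving renamings into a valid context. -/
structure WkRen (Sp : Spec ar) {A B : List Arity} (Γ : Ctx ar A) (Γ' : Ctx ar B)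
    (ρ : Ren A B) : Prop where
  isRen : IsRen Γ Γ' ρ
  valid : Derivable Sp (.valid Γ')

theorem WkRen.comp {A B D : List Arity} {Γ : Ctx ar A} {Γ' : Ctx ar B} {Γ'' : Ctx ar D}
    {ρ : Ren A B} {ρ' : Ren B D} (h : WkRen Sp Γ Γ' ρ) (h' : WkRen Sp Γ' Γ'' ρ') :
    WkRen Sp Γ Γ'' (Ren.comp ρ ρ') :=
  ⟨h.isRen.comp h'.isRen, h'.valid⟩

theorem WkRen.id {A : List Arity} {Γ : Ctx ar A} (h : Derivable Sp (.valid Γ)) :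
    WkRen Sp Γ Γ (Ren.id A) :=
  ⟨fun _ _ => (Kind.rename_id _).symm, h⟩

theorem WkRen.typ {A B : List Arity} {Γ : Ctx ar A} {Γ' : Ctx ar B} {ρ : Ren A B}
    (hρ : WkRen Sp Γ Γ' ρ) {M : Obj ar A} {T : Base ar A} (h : Derivable Sp (.typ Γ M T)) :
    Derivable Sp (.typ Γ' (M.rename ρ) (T.rename ρ)) :=
  (h.renDerivable _ _ _ (.base hρ.isRen hρ.valid)).2

theorem WkRen.eq {A B : List Arity} {Γ : Ctx ar A} {Γ' : Ctx ar B} {ρ : Ren A B}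
    (hρ : WkRen Sp Γ Γ' ρ) {M N : Obj ar A} {T : Base ar A}
    (h : Derivable Sp (.eq Γ M N T)) :
    Derivable Sp (.eq Γ' (M.rename ρ) (N.rename ρ) (T.rename ρ)) :=
  (h.renDerivable _ _ _ (.base hρ.isRen hρ.valid)).2

/-! ### A Kripke model over derivability in TF -/

/-- `Mem Sp α Γ K F G`: the `α`-ary abstractions `F` and `G` are equal elements of `K`.  At base
kinds this means that both are derivably of kind `K` and derivably equal; at higher arities it
means that in every renaming they send equal arguments to equal results. -/
def Mem (Sp : Spec ar) : (α : Arity) → {A : List Arity} → Ctx ar A → Kind ar A α →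
    Abs ar A α → Abs ar A α → Prop
  | .zero, _, Γ, T, M, N =>
      Derivable Sp (.typ Γ M T) ∧ Derivable Sp (.typ Γ N T) ∧ Derivable Sp (.eq Γ M N T)
  | .cons α β, A, Γ, K, F, G =>
      ∀ (B : List Arity) (Γ' : Ctx ar B) (ρ : Ren A B), WkRen Sp Γ Γ' ρ →
        ∀ H H' : Abs ar B α, Mem Sp α Γ' (K.rename ρ).dom H H' →
          Mem Sp β Γ' (Kind.inst [] H (K.rename ρ).cod) (Expr.employ (F.rename ρ) H)
            (Expr.employ (G.rename ρ) H')

/-- Equality of well-formed base kinds. -/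
def BaseEq (Sp : Spec ar) {A : List Arity} (Γ : Ctx ar A) : Base ar A → Base ar A → Prop
  | .type, .type => True
  | .el M, .el N => Mem Sp .zero Γ .type M N
  | .type, .el _ => False
  | .el _, .type => False

/-- `KEq Sp α Γ K K'`: the `α`-ary kinds `K` and `K'` are well-formed and equal. -/
def KEq (Sp : Spec ar) : (α : Arity) → {A : List Arity} → Ctx ar A → Kind ar A α →
    Kind ar A α → Prop
  | .zero, _, Γ, T, T' => Derivable Sp (.valid Γ) ∧ BaseEq Sp Γ T T'
  | .cons α β, A, Γ, K, K' =>
      KEq Sp α Γ K.dom K'.dom ∧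
      ∀ (B : List Arity) (Γ' : Ctx ar B) (ρ : Ren A B), WkRen Sp Γ Γ' ρ →
        ∀ H H' : Abs ar B α, Mem Sp α Γ' (K.rename ρ).dom H H' →
          KEq Sp β Γ' (Kind.inst [] H (K.rename ρ).cod) (Kind.inst [] H' (K'.rename ρ).cod)

theorem Mem.rename {α : Arity} {A B : List Arity} {Γ : Ctx ar A} {Γ' : Ctx ar B} {ρ : Ren A B}
    (hρ : WkRen Sp Γ Γ' ρ) {K : Kind ar A α} {F G : Abs ar A α} (h : Mem Sp α Γ K F G) :
    Mem Sp α Γ' (K.rename ρ) (F.rename ρ) (G.rename ρ) := by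
  cases α with
  | zero => exact ⟨hρ.typ h.1, hρ.typ h.2.1, hρ.eq h.2.2⟩
  | cons α β =>
    intro D Γ'' ρ' hρ' H H' hH
    rw [Kind.rename_rename] at hH
    rw [Kind.rename_rename, Expr.rename_rename, Expr.rename_rename]
    exact h _ _ _ (hρ.comp hρ') _ _ hH

theorem BaseEq.rename {A B : List Arity} {Γ : Ctx ar A} {Γ' : Ctx ar B} {ρ : Ren A B}
    (hρ : WkRen Sp Γ Γ' ρ) {T T' : Base ar A} (h : BaseEq Sp Γ T T') :
    BaseEq Sp Γ' (T.rename ρ) (T'.rename ρ) := by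
  cases T <;> cases T' <;> first | exact h.elim | exact trivial | exact Mem.rename hρ h

theorem KEq.rename {α : Arity} {A B : List Arity} {Γ : Ctx ar A} {Γ' : Ctx ar B} {ρ : Ren A B}
    (hρ : WkRen Sp Γ Γ' ρ) {K K' : Kind ar A α} (h : KEq Sp α Γ K K') :
    KEq Sp α Γ' (K.rename ρ) (K'.rename ρ) := by
  induction α generalizing A B with
  | zero => exact ⟨hρ.valid, h.2.rename hρ⟩
  | cons α β ih _ =>
    refine ⟨?_, ?_⟩
    · rw [Kind.dom_rename, Kind.dom_rename]
      exact ih hρ h.1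
    · intro D Γ'' ρ' hρ' H H' hH
      rw [Kind.rename_rename] at hH
      rw [Kind.rename_rename, Kind.rename_rename]
      exact h.2 _ _ _ (hρ.comp hρ') _ _ hH

theorem KEq.valid {α : Arity} {A : List Arity} {Γ : Ctx ar A} {K K' : Kind ar A α}
    (h : KEq Sp α Γ K K') : Derivable Sp (.valid Γ) := by
  induction α with
  | zero => exact h.1
  | cons α β ih _ => exact ih h.1

theorem BaseEq.typ {A : List Arity} {Γ : Ctx ar A} {T T' : Base ar A} (h : BaseEq Sp Γ T T')
    {M : Obj ar A} (hM : Derivable Sp (.typ Γ M T)) : Derivable Sp (.typ Γ M T') := by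
  cases T <;> cases T' <;> first | exact h.elim | exact hM | exact .conv hM h.2.2

theorem BaseEq.eq {A : List Arity} {Γ : Ctx ar A} {T T' : Base ar A} (h : BaseEq Sp Γ T T')
    {M N : Obj ar A} (hM : Derivable Sp (.eq Γ M N T)) : Derivable Sp (.eq Γ M N T') := by
  cases T <;> cases T' <;> first | exact h.elim | exact hM | exact .conv_eq hM h.2.2

/-- `KEq` and `Mem` are partial equivalence relations at arity `α`, and `Mem` respects `KEq`. -/
structure IsPer (Sp : Spec ar) (α : Arity) : Prop where
  symm_kind : ∀ {A : List Arity} {Γ : Ctx ar A} {K K' : Kind ar A α},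
    KEq Sp α Γ K K' → KEq Sp α Γ K' K
  trans_kind : ∀ {A : List Arity} {Γ : Ctx ar A} {K K' K'' : Kind ar A α},
    KEq Sp α Γ K K' → KEq Sp α Γ K' K'' → KEq Sp α Γ K K''
  conv : ∀ {A : List Arity} {Γ : Ctx ar A} {K K' : Kind ar A α} {F G : Abs ar A α},
    KEq Sp α Γ K K' → Mem Sp α Γ K F G → Mem Sp α Γ K' F G
  symm : ∀ {A : List Arity} {Γ : Ctx ar A} {K : Kind ar A α} {F G : Abs ar A α},
    KEq Sp α Γ K K → Mem Sp α Γ K F G → Mem Sp α Γ K G F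
  trans : ∀ {A : List Arity} {Γ : Ctx ar A} {K : Kind ar A α} {F G H : Abs ar A α},
    KEq Sp α Γ K K → Mem Sp α Γ K F G → Mem Sp α Γ K G H → Mem Sp α Γ K F H

theorem KEq.dom {α β : Arity} {A B : List Arity} {Γ : Ctx ar A} {Γ' : Ctx ar B} {ρ : Ren A B}
    (hρ : WkRen Sp Γ Γ' ρ) {K K' : Kind ar A (.cons α β)} (h : KEq Sp (.cons α β) Γ K K') :
    KEq Sp α Γ' (K.rename ρ).dom (K'.rename ρ).dom :=
  (h.rename hρ).1

theorem isPer (Sp : Spec ar) (α : Arity) : IsPer Sp α := by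
  induction α with
  | zero =>
    constructor
    · intro A Γ K K' h
      refine ⟨h.1, ?_⟩
      have h := h.2
      cases K <;> cases K' <;>
        first | exact h.elim | exact trivial | exact ⟨h.2.1, h.1, h.2.2.sym⟩
    · intro A Γ K K' K'' h h'
      refine ⟨h.1, ?_⟩
      have h := h.2
      have h' := h'.2
      cases K <;> cases K' <;> cases K'' <;>
        first | exact h.elim | exact h'.elim | exact trivial |
          exact ⟨h.1, h'.2.1, h.2.2.trans h'.2.2⟩
    · intro A Γ K K' F G h hF
      exact ⟨h.2.typ hF.1, h.2.typ hF.2.1, h.2.eq hF.2.2⟩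
    · intro A Γ K F G _ hF
      exact ⟨hF.2.1, hF.1, hF.2.2.sym⟩
    · intro A Γ K F G H _ hF hG
      exact ⟨hF.1, hG.2.1, hF.2.2.trans hG.2.2⟩
  | cons α β ihα ihβ =>
    constructor
    · intro A Γ K K' h
      refine ⟨ihα.symm_kind h.1, fun B Γ' ρ hρ H H' hH => ?_⟩
      have hd := h.dom hρ
      have hd' := ihα.symm_kind hd
      have hH' := ihα.symm (ihα.trans_kind hd hd') (ihα.conv hd' hH)
      exact ihβ.symm_kind (h.2 _ _ _ hρ _ _ hH')
    · intro A Γ K K' K'' h h'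
      refine ⟨ihα.trans_kind h.1 h'.1, fun B Γ' ρ hρ H H' hH => ?_⟩
      have hd := h.dom hρ
      have hr := ihα.trans_kind hd (ihα.symm_kind hd)
      have hHH := ihα.trans hr hH (ihα.symm hr hH)
      exact ihβ.trans_kind (h.2 _ _ _ hρ _ _ hHH) (h'.2 _ _ _ hρ _ _ (ihα.conv hd hH))
    · intro A Γ K K' F G h hF B Γ' ρ hρ H H' hH
      have hd := h.dom hρ
      have hr := ihα.trans_kind hd (ihα.symm_kind hd)
      have hH := ihα.conv (ihα.symm_kind hd) hH
      have hHH := ihα.trans hr hH (ihα.symm hr hH)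
      exact ihβ.conv (h.2 _ _ _ hρ _ _ hHH) (hF _ _ _ hρ _ _ hH)
    · intro A Γ K F G h hF B Γ' ρ hρ H H' hH
      have hd := h.dom hρ
      have hs := ihα.symm hd hH
      have hk := h.2 _ _ _ hρ _ _ hs
      have hr := ihβ.trans_kind hk (ihβ.symm_kind hk)
      exact ihβ.conv hk (ihβ.symm hr (hF _ _ _ hρ _ _ hs))
    · intro A Γ K F G P h hF hG B Γ' ρ hρ H H' hH
      have hd := h.dom hρ
      have hHH := ihα.trans hd hH (ihα.symm hd hH)
      exact ihβ.trans (h.2 _ _ _ hρ _ _ hHH) (hF _ _ _ hρ _ _ hHH) (hG _ _ _ hρ _ _ hH)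

section Per

variable {α : Arity} {A : List Arity} {Γ : Ctx ar A} {K K' K'' : Kind ar A α}
  {F G H : Abs ar A α}

theorem KEq.symm (h : KEq Sp α Γ K K') : KEq Sp α Γ K' K := (isPer Sp α).symm_kind h

theorem KEq.trans (h : KEq Sp α Γ K K') (h' : KEq Sp α Γ K' K'') : KEq Sp α Γ K K'' :=
  (isPer Sp α).trans_kind h h'

theorem KEq.left (h : KEq Sp α Γ K K') : KEq Sp α Γ K K := h.trans h.symm

theorem Mem.conv (hF : Mem Sp α Γ K F G) (h : KEq Sp α Γ K K') : Mem Sp α Γ K' F G :=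
  (isPer Sp α).conv h hF

theorem Mem.symm (hF : Mem Sp α Γ K F G) (h : KEq Sp α Γ K K') : Mem Sp α Γ K G F :=
  (isPer Sp α).symm h.left hF

theorem Mem.trans (hF : Mem Sp α Γ K F G) (h : KEq Sp α Γ K K') (hG : Mem Sp α Γ K G H) :
    Mem Sp α Γ K F H :=
  (isPer Sp α).trans h.left hF hG

theorem Mem.left (hF : Mem Sp α Γ K F G) (h : KEq Sp α Γ K K') : Mem Sp α Γ K F F :=
  hF.trans h (hF.symm h)

end Per

/-! ### Sequences in the model -/

/-- `SeqMem Sp α Γ K S S'`, for `K = (Δ)T`: the sequences `S` and `S'` are equal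
instances of `Δ`. -/
def SeqMem (Sp : Spec ar) : (α : Arity) → {A : List Arity} → Ctx ar A → Kind ar A α →
    Seq ar A α → Seq ar A α → Prop
  | .zero, _, Γ, _, _, _ => Derivable Sp (.valid Γ)
  | .cons α β, _, Γ, K, S, S' =>
      Mem Sp α Γ K.dom S.head S'.head ∧
        SeqMem Sp β Γ (Kind.inst [] S.head K.cod) S.tail S'.tail

theorem SeqMem.valid {α : Arity} {A : List Arity} {Γ : Ctx ar A} {K : Kind ar A α}
    {S S' : Seq ar A α} (h : SeqMem Sp α Γ K S S') : Derivable Sp (.valid Γ) := by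
  induction α with
  | zero => exact h
  | cons α β _ ih => exact ih h.2

/-- Application of equal elements to equal arguments. -/
theorem Mem.employ {α β : Arity} {A : List Arity} {Γ : Ctx ar A} {K : Kind ar A (.cons α β)}
    {F G : Abs ar A (.cons α β)} {H H' : Abs ar A α} (h : Mem Sp (.cons α β) Γ K F G)
    (hΓ : Derivable Sp (.valid Γ)) (hH : Mem Sp α Γ K.dom H H') :
    Mem Sp β Γ (Kind.inst [] H K.cod) (F.employ H) (G.employ H') := by
  have := h _ _ _ (WkRen.id hΓ) H H'
  rw [Kind.rename_id, Expr.rename_id, Expr.rename_id] at this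
  exact this hH

theorem KEq.inst {α β : Arity} {A : List Arity} {Γ : Ctx ar A} {K K' : Kind ar A (.cons α β)}
    {H H' : Abs ar A α} (h : KEq Sp (.cons α β) Γ K K') (hH : Mem Sp α Γ K.dom H H') :
    KEq Sp β Γ (Kind.inst [] H K.cod) (Kind.inst [] H' K'.cod) := by
  have := h.2 _ _ _ (WkRen.id h.valid) H H'
  rw [Kind.rename_id, Kind.rename_id] at this
  exact this hH

theorem Mem.employSeq {α : Arity} {A : List Arity} {Γ : Ctx ar A} {K : Kind ar A α}
    {F G : Abs ar A α} {S S' : Seq ar A α} (h : Mem Sp α Γ K F G) (hS : SeqMem Sp α Γ K S S') :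
    Mem Sp .zero Γ (Kind.instSeq α K S) (employSeq α A F S) (TF.employSeq α A G S') := by
  induction α with
  | zero => exact h
  | cons α β _ ih => exact ih (h.employ hS.valid hS.1) hS.2

/-- Elements of a kind are equal when they send equal sequences of arguments to equal objects. -/
theorem Mem.of_employSeq {α : Arity} {A : List Arity} {Γ : Ctx ar A} {K : Kind ar A α}
    {F G : Abs ar A α} (hΓ : Derivable Sp (.valid Γ))
    (h : ∀ (B : List Arity) (Γ' : Ctx ar B) (ρ : Ren A B), WkRen Sp Γ Γ' ρ →
      ∀ S S' : Seq ar B α, SeqMem Sp α Γ' (K.rename ρ) S S' →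
        Mem Sp .zero Γ' (Kind.instSeq α (K.rename ρ) S) (TF.employSeq α B (F.rename ρ) S)
          (TF.employSeq α B (G.rename ρ) S')) :
    Mem Sp α Γ K F G := by
  induction α generalizing A with
  | zero =>
    have := h _ _ _ (WkRen.id hΓ) .nil .nil hΓ
    rw [Kind.rename_id, Expr.rename_id, Expr.rename_id] at this
    exact this
  | cons α β _ ih =>
    intro B Γ' ρ hρ H H' hH
    refine ih hρ.valid fun D Γ'' ρ' hρ' S S' hS => ?_
    have hH := hH.rename hρ'
    rw [← Kind.dom_rename, Kind.rename_rename] at hH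
    rw [Kind.inst_rename, ← Kind.cod_rename, Kind.rename_rename] at hS ⊢
    rw [Expr.employ_rename, Expr.employ_rename, Expr.rename_rename, Expr.rename_rename]
    exact h _ _ _ (hρ.comp hρ') (.cons (H.rename ρ') S) (.cons (H'.rename ρ') S') ⟨hH, hS⟩

/-! ### From the model to derivations and back -/

/-- At arity `α`, what holds in the model is derivable in TF. -/
structure Reifies (Sp : Spec ar) (α : Arity) : Prop where
  mem : ∀ {A : List Arity} {Γ : Ctx ar A} {K : Kind ar A α} {F G : Abs ar A α},
    KEq Sp α Γ K K → Mem Sp α Γ K F G →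
      (∀ J ∈ absJ Γ F K, Derivable Sp J) ∧ (∀ J ∈ absEqJ Γ F G K, Derivable Sp J)
  kind : ∀ {A : List Arity} {Γ : Ctx ar A} {K K' : Kind ar A α}, KEq Sp α Γ K K' →
    (∀ J ∈ kindJ Γ K, Derivable Sp J) ∧
      ∃ s, kindEqJ Γ K K' = some s ∧ ∀ J ∈ s, Derivable Sp J
  seq : ∀ {A : List Arity} {Γ : Ctx ar A} {K K' : Kind ar A α} {S S' : Seq ar A α},
    KEq Sp α Γ K K' → SeqMem Sp α Γ K S S' →
      (∀ J ∈ seqJ α Γ S K, Derivable Sp J) ∧ (∀ J ∈ seqJ α Γ S' K', Derivable Sp J) ∧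
        (∀ J ∈ seqEqJ α Γ S S' K, Derivable Sp J) ∧
          KEq Sp .zero Γ (Kind.instSeq α K S) (Kind.instSeq α K' S')

/-- A variable or constant that may be applied to the instances of `Δ`, where `K = (Δ)T`, is an
element of `K`. -/
theorem Reifies.mem_eta {α : Arity} (hα : Reifies Sp α) {A : List Arity} {Γ : Ctx ar A}
    {K : Kind ar A α} (hK : KEq Sp α Γ K K) (z : Head ar A α)
    (hz : ∀ (B : List Arity) (Γ' : Ctx ar B) (ρ : Ren A B), WkRen Sp Γ Γ' ρ →
      ∀ S : Seq ar B α, (∀ J ∈ seqJ α Γ' S (K.rename ρ), Derivable Sp J) →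
        Derivable Sp (.typ Γ' (.app (z.rename ρ) S) (Kind.instSeq α (K.rename ρ) S)))
    (hz' : ∀ (B : List Arity) (Γ' : Ctx ar B) (ρ : Ren A B), WkRen Sp Γ Γ' ρ →
      ∀ S S' : Seq ar B α, (∀ J ∈ seqEqJ α Γ' S S' (K.rename ρ), Derivable Sp J) →
        Derivable Sp (.eq Γ' (.app (z.rename ρ) S) (.app (z.rename ρ) S')
          (Kind.instSeq α (K.rename ρ) S))) :
    Mem Sp α Γ K (eta z) (eta z) := by
  refine Mem.of_employSeq hK.valid fun B Γ' ρ hρ S S' hS => ?_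
  obtain ⟨h1, h2, h3, h4⟩ := hα.seq (hK.rename hρ) hS
  rw [eta_rename, employSeq_eta, employSeq_eta]
  exact ⟨hz _ _ _ hρ _ h1, h4.symm.2.typ (hz _ _ _ hρ _ h2), hz' _ _ _ hρ _ _ h3⟩

theorem Reifies.mem_var {α : Arity} (hα : Reifies Sp α) {A : List Arity} {Γ : Ctx ar A}
    (x : Var A α) (hK : KEq Sp α Γ (Γ.lookup x) (Γ.lookup x)) :
    Mem Sp α Γ (Γ.lookup x) (eta (.var x)) (eta (.var x)) := by
  refine hα.mem_eta hK _ ?_ ?_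
  · intro B Γ' ρ hρ S hS
    rw [← hρ.isRen] at hS ⊢
    exact .var _ hS
  · intro B Γ' ρ hρ S S' hS
    rw [← hρ.isRen] at hS ⊢
    exact .var_eq _ hS

theorem Reifies.valid_snoc {α : Arity} (hα : Reifies Sp α) {A : List Arity} {Γ : Ctx ar A}
    {K K' : Kind ar A α} (hK : KEq Sp α Γ K K') : Derivable Sp (.valid (Γ.snoc K)) :=
  .ctxt (hα.kind hK).1

/-- The eta-long form of the last variable of a context is an element of its kind. -/
theorem Reifies.mem_last {α : Arity} (hα : Reifies Sp α) {A : List Arity} {Γ : Ctx ar A}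
    {K K' : Kind ar A α} (hK : KEq Sp α Γ K K') :
    Mem Sp α (Γ.snoc K) (K.rename Ren.wk) (eta (.var .zero)) (eta (.var .zero)) := by
  have hwk : WkRen Sp Γ (Γ.snoc K) Ren.wk := ⟨isRen_wk Γ K, hα.valid_snoc hK⟩
  exact hα.mem_var (Γ := Γ.snoc K) .zero (hK.left.rename hwk)

theorem reifies (Sp : Spec ar) (α : Arity) : Reifies Sp α := by
  induction α with
  | zero =>
    constructor
    · intro A Γ K F G _ h
      cases K with
      | type => exact ⟨by rintro J rfl; exact h.1, by rintro J rfl; exact h.2.2⟩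
      | el M => exact ⟨by rintro J rfl; exact h.1, by rintro J rfl; exact h.2.2⟩
    · intro A Γ K K' h
      have h1 := h.1
      have h := h.2
      cases K <;> cases K'
      · exact ⟨by rintro J rfl; exact h1, _, rfl, by rintro J rfl; exact h1⟩
      · exact h.elim
      · exact h.elim
      · exact ⟨by rintro J rfl; exact h.1, _, rfl, by rintro J rfl; exact h.2.2⟩
    · intro A Γ K K' S S' h hS
      exact ⟨by rintro J rfl; exact hS, by rintro J rfl; exact hS, by rintro J rfl; exact hS, h⟩
  | cons α β ihα ihβ =>
    constructor
    · intro A Γ K F G hK h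
      cases K with
      | pi K L =>
        have hd : KEq Sp α Γ K K := hK.1
        have hwk : WkRen Sp Γ (Γ.snoc K) Ren.wk := ⟨isRen_wk Γ K, ihα.valid_snoc hd⟩
        -- an abstraction is recovered from its value at a fresh variable (`inst_eta`)
        have h1 := h _ _ _ hwk _ _ (ihα.mem_last hd)
        have h2 := hK.2 _ _ _ hwk _ _ (ihα.mem_last hd)
        rw [Kind.cod_rename, Kind.inst_eta] at h1 h2
        rw [Expr.employ_eq, Expr.employ_eq, Expr.body_rename, Expr.body_rename,
          Expr.subst_single_eta, Expr.subst_single_eta] at h1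
        exact ihβ.mem h2 h1
    · intro A Γ K K' hK
      cases K with
      | pi K L =>
      cases K' with
      | pi K' L' =>
        have hd : KEq Sp α Γ K K' := hK.1
        have hwk : WkRen Sp Γ (Γ.snoc K) Ren.wk := ⟨isRen_wk Γ K, ihα.valid_snoc hd⟩
        have h2 := hK.2 _ _ _ hwk _ _ (ihα.mem_last hd)
        rw [Kind.cod_rename, Kind.inst_eta, Kind.cod_rename, Kind.inst_eta] at h2
        obtain ⟨h3, t, ht, hts⟩ := ihβ.kind h2
        obtain ⟨-, s, hs, hss⟩ := ihα.kind hd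
        simp only [Kind.cod] at ht
        refine ⟨h3, _, by rw [kindEqJ, hs, ht]; rfl, ?_⟩
        rintro J ((rfl | hJ) | hJ)
        · exact hd.valid
        · exact hss J hJ
        · exact hts J hJ
    · intro A Γ K K' S S' hK hS
      have h1 := ihα.mem hK.1.left hS.1
      have h2 := ihα.mem hK.1.symm.left ((hS.1.symm hK.1).conv hK.1)
      obtain ⟨h3, h4, h5, h6⟩ := ihβ.seq (hK.inst hS.1) hS.2
      exact ⟨fun J hJ => hJ.elim (h1.1 J) (h3 J), fun J hJ => hJ.elim (h2.1 J) (h4 J),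
        fun J hJ => hJ.elim (h1.2 J) (h5 J), h6⟩

theorem KEq.wkRen {α : Arity} {A : List Arity} {Γ : Ctx ar A} {K K' : Kind ar A α}
    (hK : KEq Sp α Γ K K') : WkRen Sp Γ (Γ.snoc K) Ren.wk :=
  ⟨isRen_wk Γ K, (reifies Sp α).valid_snoc hK⟩

/-- The constants are elements of their kinds. -/
theorem mem_con {A : List Arity} {Γ : Ctx ar A} (c : C)
    (hK : KEq Sp _ Γ ((Sp.kind c).rename (Ren.empty A)) ((Sp.kind c).rename (Ren.empty A))) :
    Mem Sp _ Γ ((Sp.kind c).rename (Ren.empty A)) (eta (.con c)) (eta (.con c)) := by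
  refine (reifies Sp _).mem_eta hK _ ?_ ?_
  · intro B Γ' ρ hρ S hS
    rw [Kind.rename_rename, Ren.empty_comp] at hS ⊢
    exact .const _ hS
  · intro B Γ' ρ hρ S S' hS
    rw [Kind.rename_rename, Ren.empty_comp] at hS ⊢
    exact .const_eq _ hS

/-! ### Equations derivable in all instances -/

/-- `InstEq Sp α Γ K F G`, for `K = (Δ)T`: in all renamings, the objects that result from `F`
and `G` by employment on an instance of `Δ` are derivably equal.  Unlike `Mem`, this does not say
that these objects have a kind. -/
def InstEq (Sp : Spec ar) (α : Arity) {A : List Arity} (Γ : Ctx ar A) (K : Kind ar A α)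
    (F G : Abs ar A α) : Prop :=
  ∀ (B : List Arity) (Γ' : Ctx ar B) (ρ : Ren A B), WkRen Sp Γ Γ' ρ →
    ∀ S : Seq ar B α, (∀ J ∈ seqJ α Γ' S (K.rename ρ), Derivable Sp J) →
      Derivable Sp (.eq Γ' (employSeq α B (F.rename ρ) S) (employSeq α B (G.rename ρ) S)
        (Kind.instSeq α (K.rename ρ) S))

theorem InstEq.of_eqn {d : EqDecl ar} (hd : d ∈ Sp.eqns) {A : List Arity} (Γ : Ctx ar A) :
    InstEq Sp d.arity Γ (d.kind.rename (Ren.empty A)) (d.lhs.rename (Ren.empty A))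
      (d.rhs.rename (Ren.empty A)) := by
  intro B Γ' ρ hρ S hS
  rw [Kind.rename_rename, Ren.empty_comp] at hS ⊢
  rw [Expr.rename_rename, Expr.rename_rename, Ren.empty_comp]
  exact .eq d hd hS

theorem InstEq.employ {α β : Arity} {A : List Arity} {Γ : Ctx ar A}
    {K : Kind ar A (.cons α β)} {F G : Abs ar A (.cons α β)} {H : Abs ar A α}
    (h : InstEq Sp (.cons α β) Γ K F G) (hH : ∀ J ∈ absJ Γ H K.dom, Derivable Sp J) :
    InstEq Sp β Γ (Kind.inst [] H K.cod) (F.employ H) (G.employ H) := by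
  intro B Γ' ρ hρ S hS
  have hH := absJ_rename (.base hρ.isRen hρ.valid) (fun J hJ => (hH J hJ).renDerivable)
  rw [← Kind.dom_rename] at hH
  rw [Kind.inst_rename, ← Kind.cod_rename] at hS ⊢
  rw [Expr.employ_rename, Expr.employ_rename]
  exact h _ _ _ hρ (.cons (H.rename ρ) S) (fun J hJ => hJ.elim (hH J) (hS J))

/-- An equation that holds in all instances holds in the model, if its sides are elements of the
kind. -/
theorem InstEq.mem {α : Arity} {A : List Arity} {Γ : Ctx ar A} {K : Kind ar A α}
    {F G : Abs ar A α} (h : InstEq Sp α Γ K F G) (hK : KEq Sp α Γ K K)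
    (hF : Mem Sp α Γ K F F) (hG : Mem Sp α Γ K G G) : Mem Sp α Γ K F G := by
  refine Mem.of_employSeq hK.valid fun B Γ' ρ hρ S S' hS => ?_
  have h1 := (hF.rename hρ).employSeq hS
  have h2 := (hG.rename hρ).employSeq hS
  have h3 := h _ _ _ hρ S ((reifies Sp α).seq (hK.rename hρ) hS).1
  exact ⟨h1.1, h2.2.1, h3.trans h2.2.2⟩

end TF

namespace LF

variable {C : Type u} {T : Spec C} {S : TF.Spec T.ar}

/-! ### Interpretation of LF judgements in the model -/

/-- `σ` and `τ` are equal instances, in the TF context `Δ`, of the LF context `Γ`. -/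
def EnvEq (S : TF.Spec T.ar) {A : List Arity} (Δ : TF.Ctx T.ar A) :
    Ctx C → Asg T.ar A → Asg T.ar A → Prop
  | [], _, _ => TF.Derivable S (.valid Δ)
  | K :: Γ, σ, τ =>
      (∃ (α : Arity) (L : TF.Kind T.ar A α) (F G : TF.Abs T.ar A α),
        σ 0 = some ⟨α, F⟩ ∧ τ 0 = some ⟨α, G⟩ ∧ evalKind (σ ∘ Nat.succ) K = some ⟨α, L⟩ ∧
          TF.Mem S α Δ L F G) ∧
      EnvEq S Δ Γ (σ ∘ Nat.succ) (τ ∘ Nat.succ)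

/-- The kinds `K` and `K'` are equal in the model, in all instances of `Γ`. -/
def ValKEq (S : TF.Spec T.ar) (Γ : Ctx C) (K K' : Kind C) : Prop :=
  ∀ (A : List Arity) (Δ : TF.Ctx T.ar A) (σ τ : Asg T.ar A), EnvEq S Δ Γ σ τ →
    ∃ (α : Arity) (L L' : TF.Kind T.ar A α), evalKind σ K = some ⟨α, L⟩ ∧
      evalKind τ K' = some ⟨α, L'⟩ ∧ TF.KEq S α Δ L L'

/-- The objects `k` and `k'` are equal elements of `K` in the model, in all instances of `Γ`. -/
def ValEq (S : TF.Spec T.ar) (Γ : Ctx C) (k k' : Obj C) (K : Kind C) : Prop :=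
  ∀ (A : List Arity) (Δ : TF.Ctx T.ar A) (σ τ : Asg T.ar A), EnvEq S Δ Γ σ τ →
    ∃ (α : Arity) (L L' : TF.Kind T.ar A α) (F G : TF.Abs T.ar A α),
      evalKind σ K = some ⟨α, L⟩ ∧ evalKind τ K = some ⟨α, L'⟩ ∧ TF.KEq S α Δ L L' ∧
        eval σ k = some ⟨α, F⟩ ∧ eval τ k' = some ⟨α, G⟩ ∧ TF.Mem S α Δ L F G

/-- The entries of the context are well-formed in the model. -/
def ValCtx (S : TF.Spec T.ar) : Ctx C → Prop
  | [] => True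
  | K :: Γ => ValCtx S Γ ∧ ValKEq S Γ K K

/-- Truth of an LF judgement in the model.  Being of a kind is being equal to oneself there. -/
def Valid (S : TF.Spec T.ar) : Judg C → Prop
  | .valid Γ => ValCtx S Γ
  | .kind Γ K => ValCtx S Γ ∧ ValKEq S Γ K K
  | .keq Γ K K' => ValCtx S Γ ∧ ValKEq S Γ K K'
  | .typ Γ k K => ValCtx S Γ ∧ ValEq S Γ k k K
  | .eq Γ k k' K => ValCtx S Γ ∧ ValEq S Γ k k' K

theorem EnvEq.valid {A : List Arity} {Δ : TF.Ctx T.ar A} {Γ : Ctx C} {σ τ : Asg T.ar A}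
    (h : EnvEq S Δ Γ σ τ) : TF.Derivable S (.valid Δ) := by
  induction Γ generalizing σ τ with
  | nil => exact h
  | cons K Γ ih => exact ih h.2

theorem EnvEq.symm {A : List Arity} {Δ : TF.Ctx T.ar A} {Γ : Ctx C} {σ τ : Asg T.ar A}
    (hΓ : ValCtx S Γ) (h : EnvEq S Δ Γ σ τ) : EnvEq S Δ Γ τ σ := by
  induction Γ generalizing σ τ with
  | nil => exact h
  | cons K Γ ih =>
    obtain ⟨⟨α, L, F, G, h1, h2, h3, h4⟩, h5⟩ := h
    obtain ⟨α', L', L'', h6, h7, h8⟩ := hΓ.2 _ _ _ _ h5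
    cases h3.symm.trans h6
    exact ⟨⟨α, L'', G, F, h2, h1, h7, (h4.symm h8).conv h8⟩, ih hΓ.1 h5⟩

theorem EnvEq.left {A : List Arity} {Δ : TF.Ctx T.ar A} {Γ : Ctx C} {σ τ : Asg T.ar A}
    (hΓ : ValCtx S Γ) (h : EnvEq S Δ Γ σ τ) : EnvEq S Δ Γ σ σ := by
  induction Γ generalizing σ τ with
  | nil => exact h
  | cons K Γ ih =>
    obtain ⟨⟨α, L, F, G, h1, h2, h3, h4⟩, h5⟩ := h
    obtain ⟨α', L', L'', h6, h7, h8⟩ := hΓ.2 _ _ _ _ h5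
    cases h3.symm.trans h6
    exact ⟨⟨α, L, F, F, h1, h1, h3, h4.left h8⟩, ih hΓ.1 h5⟩

theorem EnvEq.rename {A B : List Arity} {Δ : TF.Ctx T.ar A} {Δ' : TF.Ctx T.ar B} {ρ : Ren A B}
    (hρ : TF.WkRen S Δ Δ' ρ) {Γ : Ctx C} {σ τ : Asg T.ar A} (h : EnvEq S Δ Γ σ τ) :
    EnvEq S Δ' Γ (σ.rename ρ) (τ.rename ρ) := by
  induction Γ generalizing σ τ with
  | nil => exact hρ.valid
  | cons K Γ ih =>
    obtain ⟨⟨α, L, F, G, h1, h2, h3, h4⟩, h5⟩ := h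
    refine ⟨⟨α, L.rename ρ, F.rename ρ, G.rename ρ, ?_, ?_, ?_, h4.rename hρ⟩, ih h5⟩
    · simp only [Asg.rename, h1]; rfl
    · simp only [Asg.rename, h2]; rfl
    · have := evalKind_map_rename ρ (σ ∘ Nat.succ) K
      rw [h3] at this
      exact this

theorem EnvEq.push {A : List Arity} {Δ : TF.Ctx T.ar A} {Γ : Ctx C} {σ τ : Asg T.ar A}
    (h : EnvEq S Δ Γ σ τ) {K : Kind C} {α : Arity} {L : TF.Kind T.ar A α}
    {F G : TF.Abs T.ar A α} (hK : evalKind σ K = some ⟨α, L⟩) (hF : TF.Mem S α Δ L F G) :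
    EnvEq S Δ (K :: Γ) (σ.push ⟨α, F⟩) (τ.push ⟨α, G⟩) :=
  ⟨⟨α, L, F, G, rfl, rfl, hK, hF⟩, h⟩

theorem EnvEq.lift {A : List Arity} {Δ : TF.Ctx T.ar A} {Γ : Ctx C} {σ τ : Asg T.ar A}
    (h : EnvEq S Δ Γ σ τ) {K : Kind C} {α : Arity} {L L' : TF.Kind T.ar A α}
    (hK : evalKind σ K = some ⟨α, L⟩) (hL : TF.KEq S α Δ L L') :
    EnvEq S (Δ.snoc L) (K :: Γ) (σ.lift α) (τ.lift α) := by
  refine (h.rename hL.wkRen).push (L := L.rename Ren.wk) ?_ ((TF.reifies S α).mem_last hL)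
  rw [evalKind_map_rename, hK]; rfl

theorem Asg.lift_rename_subst {ar : C → Arity} {A B : List Arity} (σ : Asg ar A) (ρ : Ren A B)
    {α : Arity} (H : TF.Abs ar B α) :
    ((σ.lift α).rename ρ.lift).subst (TF.Env.single H) = (σ.rename ρ).push ⟨α, H⟩ := by
  funext i
  cases i with
  | zero =>
    simp only [Asg.rename, Asg.subst, Asg.lift, Asg.push, Option.map_some, Val.rename, Val.subst,
      TF.eta_rename]
    rw [show TF.Head.rename ρ.lift (.var .zero) = TF.Head.var (ar := ar) (Var.zero (A := B) (α := α))
      from rfl, TF.eta_subst_abs _ H _ rfl]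
  | succ i =>
    simp only [Asg.rename, Asg.subst, Asg.lift, Asg.push]
    cases σ i with
    | none => rfl
    | some p =>
      simp only [Option.map_some, Val.rename, Val.subst, TF.Expr.rename_rename, TF.Ren.wk_lift]
      rw [← TF.Expr.rename_rename, TF.Expr.subst_single_wk]

theorem eval_push {ar : C → Arity} {A B : List Arity} {σ : Asg ar A} {ρ : Ren A B} {α β : Arity}
    {k : Obj C} {F : TF.Abs ar (α :: A) β} (h : eval (σ.lift α) k = some ⟨β, F⟩)
    (H : TF.Abs ar B α) :
    eval ((σ.rename ρ).push ⟨α, H⟩) k =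
      some ⟨β, (TF.Expr.rename ρ (.lam F) : TF.Abs ar B (.cons α β)).employ H⟩ := by
  rw [← Asg.lift_rename_subst, eval_map_subst, eval_map_rename, h]; rfl

theorem evalKind_push {ar : C → Arity} {A B : List Arity} {σ : Asg ar A} {ρ : Ren A B}
    {α β : Arity} {K : Kind C} {L : TF.Kind ar (α :: A) β}
    (h : evalKind (σ.lift α) K = some ⟨β, L⟩) (H : TF.Abs ar B α) :
    evalKind ((σ.rename ρ).push ⟨α, H⟩) K =
      some ⟨β, TF.Kind.inst [] H (L.rename ρ.lift)⟩ := by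
  rw [← Asg.lift_rename_subst, evalKind_map_subst, evalKind_map_rename, h]; rfl

theorem Asg.rename_id {ar : C → Arity} {A : List Arity} (σ : Asg ar A) :
    σ.rename (TF.Ren.id A) = σ := by
  funext i
  simp only [Asg.rename]
  cases σ i <;> simp [Val.rename, TF.Expr.rename_id]

theorem eval_push_id {ar : C → Arity} {A : List Arity} {σ : Asg ar A} {α β : Arity}
    {k : Obj C} {F : TF.Abs ar (α :: A) β} (h : eval (σ.lift α) k = some ⟨β, F⟩)
    (H : TF.Abs ar A α) :
    eval (σ.push ⟨α, H⟩) k = some ⟨β, TF.Expr.employ (.lam F) H⟩ := by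
  have := eval_push (ρ := TF.Ren.id A) h H
  rwa [Asg.rename_id, TF.Expr.rename_id] at this

theorem evalKind_push_id {ar : C → Arity} {A : List Arity} {σ : Asg ar A}
    {α β : Arity} {K : Kind C} {L : TF.Kind ar (α :: A) β}
    (h : evalKind (σ.lift α) K = some ⟨β, L⟩) (H : TF.Abs ar A α) :
    evalKind (σ.push ⟨α, H⟩) K = some ⟨β, TF.Kind.inst [] H L⟩ := by
  have := evalKind_push (ρ := TF.Ren.id A) h H
  rwa [Asg.rename_id, TF.Ren.lift_id, TF.Kind.rename_id] at this

theorem eval_lam {ar : C → Arity} {A : List Arity} {σ σ' : Asg ar A} {α β : Arity} {K : Kind C}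
    {L : TF.Kind ar A α} {k : Obj C} {F : TF.Abs ar (α :: A) β}
    (hK : evalKind σ' K = some ⟨α, L⟩) (h : eval (σ.lift α) k = some ⟨β, F⟩) :
    eval σ (.lam K k) = some ⟨.cons α β, .lam F⟩ := by
  have := evalKind_arity hK
  simp only at this
  subst this
  simp [eval, h]

theorem eval_lam_inv {ar : C → Arity} {A : List Arity} {σ σ' : Asg ar A} {α β : Arity}
    {K : Kind C} {L : TF.Kind ar A α} {k : Obj C} {F : TF.Abs ar A (.cons α β)}
    (hK : evalKind σ' K = some ⟨α, L⟩) (h : eval σ (.lam K k) = some ⟨.cons α β, F⟩) :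
    ∃ F' : TF.Abs ar (α :: A) β, eval (σ.lift α) k = some ⟨β, F'⟩ ∧ F = .lam F' := by
  have := evalKind_arity hK
  simp only at this
  subst this
  simp only [eval, Option.map_eq_some_iff] at h
  obtain ⟨⟨β', F'⟩, h1, h2⟩ := h
  cases h2
  exact ⟨F', h1, rfl⟩

theorem eval_app {ar : C → Arity} {A : List Arity} {σ : Asg ar A} {α β : Arity} {f k : Obj C}
    {F : TF.Abs ar A (.cons α β)} {H : TF.Abs ar A α} (hf : eval σ f = some ⟨.cons α β, F⟩)
    (hk : eval σ k = some ⟨α, H⟩) : eval σ (.app f k) = some ⟨β, F.employ H⟩ := by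
  simp [eval, hf, hk, employVal_mk]

/-! ### Equality in the model is a partial equivalence relation -/

theorem ValKEq.symm {Γ : Ctx C} {K K' : Kind C} (hΓ : ValCtx S Γ) (h : ValKEq S Γ K K') :
    ValKEq S Γ K' K := by
  intro A Δ σ τ hσ
  obtain ⟨α, L, L', h1, h2, h3⟩ := h _ _ _ _ (hσ.symm hΓ)
  exact ⟨α, L', L, h2, h1, h3.symm⟩

theorem ValKEq.trans {Γ : Ctx C} {K K' K'' : Kind C} (hΓ : ValCtx S Γ) (h : ValKEq S Γ K K')
    (h' : ValKEq S Γ K' K'') : ValKEq S Γ K K'' := by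
  intro A Δ σ τ hσ
  obtain ⟨α, L, L', h1, h2, h3⟩ := h _ _ _ _ (hσ.left hΓ)
  obtain ⟨β, M, M', h4, h5, h6⟩ := h' _ _ _ _ hσ
  cases h2.symm.trans h4
  exact ⟨α, L, M', h1, h5, h3.trans h6⟩

theorem ValEq.symm {Γ : Ctx C} {k k' : Obj C} {K : Kind C} (hΓ : ValCtx S Γ)
    (h : ValEq S Γ k k' K) : ValEq S Γ k' k K := by
  intro A Δ σ τ hσ
  obtain ⟨α, L, L', F, G, h1, h2, h3, h4, h5, h6⟩ := h _ _ _ _ (hσ.symm hΓ)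
  exact ⟨α, L', L, G, F, h2, h1, h3.symm, h5, h4, (h6.symm h3).conv h3⟩

theorem ValEq.trans {Γ : Ctx C} {k k' k'' : Obj C} {K : Kind C} (hΓ : ValCtx S Γ)
    (h : ValEq S Γ k k' K) (h' : ValEq S Γ k' k'' K) : ValEq S Γ k k'' K := by
  intro A Δ σ τ hσ
  obtain ⟨α, L, L', F, G, h1, h2, h3, h4, h5, h6⟩ := h _ _ _ _ (hσ.left hΓ)
  obtain ⟨β, M, M', F', G', h7, h8, h9, h10, h11, h12⟩ := h' _ _ _ _ hσ
  cases h1.symm.trans h7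
  cases h5.symm.trans h10
  exact ⟨α, L, M', F, G', h1, h8, h9, h4, h11, h6.trans h9 h12⟩

theorem ValEq.left {Γ : Ctx C} {k k' : Obj C} {K : Kind C} (hΓ : ValCtx S Γ)
    (h : ValEq S Γ k k' K) : ValEq S Γ k k K := h.trans hΓ (h.symm hΓ)

theorem ValEq.kind {Γ : Ctx C} {k k' : Obj C} {K : Kind C} (h : ValEq S Γ k k' K) :
    ValKEq S Γ K K := by
  intro A Δ σ τ hσ
  obtain ⟨α, L, L', F, G, h1, h2, h3, -⟩ := h _ _ _ _ hσ
  exact ⟨α, L, L', h1, h2, h3⟩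

theorem ValEq.conv {Γ : Ctx C} {k k' : Obj C} {K K' : Kind C} (hΓ : ValCtx S Γ)
    (h : ValEq S Γ k k' K) (hK : ValKEq S Γ K K') : ValEq S Γ k k' K' := by
  intro A Δ σ τ hσ
  obtain ⟨α, L, L', F, G, h1, h2, h3, h4, h5, h6⟩ := h _ _ _ _ hσ
  obtain ⟨β, M, M', h7, h8, h9⟩ := hK _ _ _ _ (hσ.left hΓ)
  obtain ⟨γ, N, N', h10, h11, h12⟩ := hK _ _ _ _ hσ
  cases h1.symm.trans h7
  cases h1.symm.trans h10
  exact ⟨α, M', N', F, G, h8, h11, h9.symm.trans h12, h4, h5, h6.conv h9⟩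

/-! ### Soundness of the rules of LF -/

theorem ValEq.var {Γ : Ctx C} {i : ℕ} {K : Kind C} (hΓ : ValCtx S Γ)
    (h : Ctx.lookup Γ i = some K) : ValEq S Γ (.var i) (.var i) K := by
  induction Γ generalizing i K with
  | nil => simp [Ctx.lookup] at h
  | cons K₀ Γ ih =>
    intro A Δ σ τ hσ
    cases i with
    | zero =>
      simp only [Ctx.lookup, Option.some.injEq] at h
      subst h
      obtain ⟨⟨α, L, F, G, h1, h2, h3, h4⟩, h5⟩ := hσ
      obtain ⟨α', L', L'', h6, h7, h8⟩ := hΓ.2 _ _ _ _ h5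
      cases h3.symm.trans h6
      simp only [Expr.weaken, evalKind_rename, eval]
      exact ⟨α, L, L'', F, G, h3, h7, h8, h1, h2, h4⟩
    | succ i =>
      simp only [Ctx.lookup, Option.map_eq_some_iff] at h
      obtain ⟨K', hK', rfl⟩ := h
      simp only [Expr.weaken, evalKind_rename]
      exact ih hΓ.1 hK' _ _ _ _ hσ.2

theorem Asg.comp_listSub_nil {ar : C → Arity} {A : List Arity} (σ : Asg ar A) :
    Asg.comp (listSub []) σ = σ := by
  funext i
  simp [Asg.comp, listSub, eval]

theorem Asg.comp_liftSub_push {ar : C → Arity} {A : List Arity} (σ : Asg ar A) (p : Val ar A)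
    (t : ℕ → Obj C) : Asg.comp (liftSub t) (σ.push p) = (Asg.comp t σ).push p := by
  funext i
  cases i with
  | zero => rfl
  | succ i =>
    simp only [Asg.comp, liftSub, Expr.weaken, eval_rename]
    rfl

theorem Asg.comp_liftSub_succ {ar : C → Arity} {A : List Arity} (σ : Asg ar A)
    (t : ℕ → Obj C) : Asg.comp (liftSub t) σ ∘ Nat.succ = Asg.comp t (σ ∘ Nat.succ) := by
  funext i
  simp only [Function.comp, Asg.comp, liftSub, Expr.weaken, eval_rename]

theorem Asg.comp_listSub_cons {ar : C → Arity} {A : List Arity} {σ : Asg ar A} {p : Val ar A}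
    {k : Obj C} (ks : List (Obj C)) (h : eval σ k = some p) :
    Asg.comp (listSub (k :: ks)) σ = (Asg.comp (listSub ks) σ).push p := by
  funext i
  cases i with
  | zero => exact h
  | succ i => simp [Asg.comp, listSub, Asg.push]

theorem Asg.comp_listSub_single {ar : C → Arity} {A : List Arity} {σ : Asg ar A} {p : Val ar A}
    {k : Obj C} (h : eval σ k = some p) : Asg.comp (listSub [k]) σ = σ.push p := by
  rw [Asg.comp_listSub_cons [] h, Asg.comp_listSub_nil]

theorem eval_inst_zero {ar : C → Arity} {A : List Arity} {σ : Asg ar A} {p : Val ar A}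
    {k : Obj C} (h : eval σ k = some p) (l : Obj C) :
    eval σ (Expr.inst 0 k l) = eval (σ.push p) l := by
  rw [Expr.inst, eval_subst, liftSubN, Asg.comp_listSub_single h]

theorem evalKind_inst_zero {ar : C → Arity} {A : List Arity} {σ : Asg ar A} {p : Val ar A}
    {k : Obj C} (h : eval σ k = some p) (K : Kind C) :
    evalKind σ (Expr.inst 0 k K) = evalKind (σ.push p) K := by
  rw [Expr.inst, evalKind_subst, liftSubN, Asg.comp_listSub_single h]

/-- Equal instances of `Γ, [k/x]Δ` give equal instances of `Γ, x : K, Δ`, by evaluation of equal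
objects `k` and `k'` for `x`. -/
theorem EnvEq.inst {A : List Arity} {Θ : TF.Ctx T.ar A} {Γ Δ : Ctx C} {K : Kind C} {k k' : Obj C}
    (hk : ValEq S Γ k k' K) {σ τ : Asg T.ar A} (h : EnvEq S Θ (Ctx.inst 0 k Δ ++ Γ) σ τ) :
    EnvEq S Θ (Δ ++ K :: Γ) (Asg.comp (liftSubN (listSub [k]) Δ.length) σ)
      (Asg.comp (liftSubN (listSub [k']) Δ.length) τ) := by
  induction Δ generalizing σ τ with
  | nil =>
    obtain ⟨α, L, L', F, G, h1, h2, h3, h4, h5, h6⟩ := hk _ _ _ _ h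
    rw [List.length_nil, liftSubN, liftSubN, Asg.comp_listSub_single h4,
      Asg.comp_listSub_single h5]
    exact EnvEq.push h h1 h6
  | cons M Δ ih =>
    obtain ⟨⟨α, L, F, G, h1, h2, h3, h4⟩, h5⟩ := h
    refine ⟨⟨α, L, F, G, h1, h2, ?_, h4⟩, ?_⟩
    · rw [List.length_cons, liftSubN, Asg.comp_liftSub_succ, ← evalKind_subst]
      exact h3
    · rw [List.length_cons, liftSubN, liftSubN, Asg.comp_liftSub_succ, Asg.comp_liftSub_succ]
      exact ih h5

theorem ValKEq.inst {Γ Δ : Ctx C} {K M M' : Kind C} {k k' : Obj C}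
    (h : ValKEq S (Δ ++ K :: Γ) M M') (hk : ValEq S Γ k k' K) :
    ValKEq S (Ctx.inst 0 k Δ ++ Γ) (Expr.inst Δ.length k M) (Expr.inst Δ.length k' M') := by
  intro A Θ σ τ hσ
  obtain ⟨α, L, L', h1, h2, h3⟩ := h _ _ _ _ (hσ.inst hk)
  rw [Expr.inst, Expr.inst, evalKind_subst, evalKind_subst]
  exact ⟨α, L, L', h1, h2, h3⟩

theorem ValCtx.inst {Γ Δ : Ctx C} {K : Kind C} {k : Obj C} (h : ValCtx S (Δ ++ K :: Γ))
    (hk : ValEq S Γ k k K) : ValCtx S (Ctx.inst 0 k Δ ++ Γ) := by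
  induction Δ with
  | nil => exact h.1
  | cons M Δ ih => exact ⟨ih h.1, ValKEq.inst h.2 hk⟩

theorem ValEq.inst {Γ Δ : Ctx C} {K M : Kind C} {k k' l l' : Obj C} (hΓ : ValCtx S Γ)
    (h : ValEq S (Δ ++ K :: Γ) l l' M) (hk : ValEq S Γ k k' K) :
    ValEq S (Ctx.inst 0 k Δ ++ Γ) (Expr.inst Δ.length k l) (Expr.inst Δ.length k' l')
      (Expr.inst Δ.length k M) := by
  intro A Θ σ τ hσ
  obtain ⟨α, L, L', F, G, h1, -, -, h4, h5, h6⟩ := h _ _ _ _ (hσ.inst hk)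
  obtain ⟨β, M, M', h7, h8, h9⟩ := h.kind _ _ _ _ (hσ.inst (hk.left hΓ))
  cases h1.symm.trans h7
  simp only [Expr.inst, evalKind_subst, eval_subst]
  exact ⟨α, L, M', F, G, h1, h8, h9, h4, h5, h6⟩

theorem ValKEq.el {Γ : Ctx C} {k k' : Obj C} (h : ValEq S Γ k k' .type) :
    ValKEq S Γ (.el k) (.el k') := by
  intro A Δ σ τ hσ
  obtain ⟨α, L, L', F, G, h1, h2, h3, h4, h5, h6⟩ := h _ _ _ _ hσ
  cases h1
  exact ⟨.zero, .el F, .el G, by simp [evalKind, h4, elVal], by simp [evalKind, h5, elVal],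
    hσ.valid, h6⟩

theorem ValKEq.pi {Γ : Ctx C} {K₁ K₂ K₁' K₂' : Kind C} (h : ValKEq S Γ K₁ K₂)
    (h' : ValKEq S (K₁ :: Γ) K₁' K₂') : ValKEq S Γ (.pi K₁ K₁') (.pi K₂ K₂') := by
  intro A Δ σ τ hσ
  obtain ⟨α, L, L', h1, h2, h3⟩ := h _ _ _ _ hσ
  obtain ⟨β, M, M', h4, h5, -⟩ := h' _ _ _ _ (hσ.lift h1 h3)
  refine ⟨.cons α β, .pi L M, .pi L' M', evalKind_pi_mk h1 h4, evalKind_pi_mk h2 h5, h3,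
    fun B Δ' ρ hρ H H' hH => ?_⟩
  have hL : evalKind (σ.rename ρ) K₁ = some ⟨α, L.rename ρ⟩ := by
    rw [evalKind_map_rename, h1]; rfl
  obtain ⟨γ, N, N', h7, h8, h9⟩ := h' _ _ _ _ ((hσ.rename hρ).push hL hH)
  rw [evalKind_push h4] at h7
  rw [evalKind_push h5] at h8
  cases h7
  cases h8
  exact h9

theorem ValEq.lam {Γ : Ctx C} {K₁ K₂ K' : Kind C} {k₁ k₂ : Obj C} (hΓ : ValCtx S Γ)
    (h : ValKEq S Γ K₁ K₂) (h' : ValEq S (K₁ :: Γ) k₁ k₂ K') :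
    ValEq S Γ (.lam K₁ k₁) (.lam K₂ k₂) (.pi K₁ K') := by
  intro A Δ σ τ hσ
  obtain ⟨a, P, P', hP, hP', hPP⟩ :=
    ValKEq.pi (h.trans hΓ (h.symm hΓ)) h'.kind _ _ _ _ hσ
  obtain ⟨α, L, L', h1, h2, h3⟩ := h _ _ _ _ hσ
  obtain ⟨β, M, M', F, G, h4, -, -, h7, h8, -⟩ := h' _ _ _ _ (hσ.lift h1 h3)
  cases hP.symm.trans (evalKind_pi_mk h1 h4)
  refine ⟨.cons α β, .pi L M, P', .lam F, .lam G, hP, hP', hPP, eval_lam h1 h7, eval_lam h2 h8,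
    fun B Δ' ρ hρ H H' hH => ?_⟩
  have hL : evalKind (σ.rename ρ) K₁ = some ⟨α, L.rename ρ⟩ := by
    rw [evalKind_map_rename, h1]; rfl
  obtain ⟨γ, N, N', F', G', h9, -, -, h12, h13, h14⟩ :=
    h' _ _ _ _ ((hσ.rename hρ).push hL hH)
  rw [evalKind_push h4] at h9
  rw [eval_push h7] at h12
  rw [eval_push h8] at h13
  cases h9
  cases h12
  cases h13
  exact h14

theorem ValEq.app {Γ : Ctx C} {K K' : Kind C} {f f' k k' : Obj C} (hΓ : ValCtx S Γ)
    (hf : ValEq S Γ f f' (.pi K K')) (hk : ValEq S Γ k k' K) :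
    ValEq S Γ (.app f k) (.app f' k') (Expr.inst 0 k K') := by
  intro A Δ σ τ hσ
  obtain ⟨a, P, P', F, F', hP, hP', hPP, hF, hF', hFF⟩ := hf _ _ _ _ hσ
  obtain ⟨α, β, L, M, h1, h2, h3⟩ := evalKind_pi hP
  cases h3
  obtain ⟨α', β', L', M', h1', h2', h3'⟩ := evalKind_pi hP'
  cases h3'
  obtain ⟨γ, N, N', G, G', h4, -, -, h7, h8, h9⟩ := hk _ _ _ _ hσ
  cases h1.symm.trans h4
  obtain ⟨γ, N, N', G₁, G₁', h10, -, -, h13, h14, h15⟩ := (hk.left hΓ) _ _ _ _ hσ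
  cases h1.symm.trans h10
  cases h7.symm.trans h13
  refine ⟨β, TF.Kind.inst [] G M, TF.Kind.inst [] G₁' M', F.employ G, F'.employ G', ?_, ?_,
    hPP.inst h15, eval_app hF h7, eval_app hF' h8, hFF.employ hσ.valid h9⟩
  · rw [evalKind_inst_zero h7, evalKind_push_id h2]
  · rw [evalKind_inst_zero h14, evalKind_push_id h2']

theorem ValEq.beta {Γ : Ctx C} {K K' : Kind C} {k k' : Obj C} (hΓ : ValCtx S (K :: Γ))
    (hk' : ValEq S (K :: Γ) k' k' K') (hk : ValEq S Γ k k K) :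
    ValEq S Γ (.app (.lam K k') k) (Expr.inst 0 k k') (Expr.inst 0 k K') := by
  intro A Δ σ τ hσ
  obtain ⟨α, L, L', F, F', h1, h2, h3, h4, h5, h6⟩ :=
    ValEq.app hΓ.1 (ValEq.lam hΓ.1 hΓ.2 hk') hk _ _ _ _ hσ
  -- both sides have the same value under `τ`; symmetry provides the values from which it is computed
  obtain ⟨γ, N, N', h13, h14, h15⟩ := hΓ.2 _ _ _ _ (hσ.symm hΓ.1)
  obtain ⟨δ, P, P', Q, Q', h16, -, -, h19, -, -⟩ := hk' _ _ _ _ ((hσ.symm hΓ.1).lift h13 h15)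
  obtain ⟨ε, R, R', H, H', h20, -, -, h23, -, -⟩ := hk _ _ _ _ (hσ.symm hΓ.1)
  cases h13.symm.trans h20
  have e1 := eval_app (eval_lam h13 h19) h23
  have e2 := (eval_inst_zero h23 k').trans (eval_push_id h19 H)
  exact ⟨α, L, L', F, F', h1, h2, h3, h4, e2.trans (e1.symm.trans h5), h6⟩

theorem ValEq.eta {Γ : Ctx C} {K K' : Kind C} {f : Obj C} (hf : ValEq S Γ f f (.pi K K')) :
    ValEq S Γ (.lam K (.app f.weaken (.var 0))) f (.pi K K') := by
  intro A Δ σ τ hσ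
  obtain ⟨a, P, P', F, F', hP, hP', hPP, hF, hF', hFF⟩ := hf _ _ _ _ hσ
  obtain ⟨α, β, L, M, h1, h2, h3⟩ := evalKind_pi hP
  cases h3
  refine ⟨_, _, _, F, F', hP, hP', hPP, ?_, hF', hFF⟩
  have hw : eval (σ.lift α) f.weaken = some ⟨.cons α β, F.rename Ren.wk⟩ := by
    rw [Expr.weaken, eval_rename, Asg.lift_comp_succ, eval_map_rename, hF]; rfl
  have := eval_lam (L := L) h1 (eval_app hw (k := .var 0) (H := TF.eta (.var .zero)) rfl)
  rw [this, TF.Expr.employ_eq, TF.Expr.body_rename, TF.Expr.subst_single_eta, TF.Expr.lam_body]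

/-- A value in the empty scope is the value in every scope. -/
theorem eval_of_closed {ar : C → Arity} {A : List Arity} (σ : Asg ar A) {k : Obj C}
    {p : Val ar []} (h : eval (etaAsg ar []) k = some p) :
    eval σ k = some (p.rename (TF.Ren.empty A)) := by
  refine eval_mono (σ := (etaAsg ar []).rename (TF.Ren.empty A)) (fun i p hp => ?_) k ?_
  · simp [Asg.rename, etaAsg, Var.find] at hp
  · rw [eval_map_rename, h]; rfl

theorem evalKind_of_closed {ar : C → Arity} {A : List Arity} (σ : Asg ar A) {K : Kind C}
    {p : KVal ar []} (h : evalKind (etaAsg ar []) K = some p) :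
    evalKind σ K = some (p.rename (TF.Ren.empty A)) := by
  refine evalKind_mono (σ := (etaAsg ar []).rename (TF.Ren.empty A)) (fun i p hp => ?_) K ?_
  · simp [Asg.rename, etaAsg, Var.find] at hp
  · rw [evalKind_map_rename, h]; rfl

theorem ValEq.con (hS : T.NFSpec S) {Γ : Ctx C} (c : C) (h : ValKEq S [] (T.kind c) (T.kind c)) :
    ValEq S Γ (.con c) (.con c) (T.kind c) := by
  intro A Δ σ τ hσ
  have hc := (NFKind_iff.1 (hS.1 c)).2
  have h1 := evalKind_of_closed σ hc
  obtain ⟨α, L, L', h2, h3, h4⟩ := h A Δ σ σ hσ.valid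
  cases h2.symm.trans h3
  cases h1.symm.trans h2
  exact ⟨_, _, _, _, _, h1, evalKind_of_closed τ hc, h4, rfl, rfl, TF.mem_con c h4⟩

/-- If the equation `[Δ]k = [Δ]k' : (Δ)K` holds in all instances, so does its instance
`[ks/Δ]k = [ks/Δ]k' : [ks/Δ]K`. -/
theorem instEq_listSub {A : List Arity} {Θ : TF.Ctx T.ar A} {Γ : Ctx C} {σ : Asg T.ar A}
    (hσ : EnvEq S Θ Γ σ σ) {Δ : Ctx C} {ks : List (Obj C)} (hlen : ks.length = Δ.length)
    (hks : ∀ J ∈ seqJ Γ ks Δ, Valid S J) {K : Kind C} {k k' : Obj C}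
    (h : ∃ (α : Arity) (L : TF.Kind T.ar A α) (F G : TF.Abs T.ar A α),
      evalKind σ (piAll Δ K) = some ⟨α, L⟩ ∧ eval σ (lamAll Δ k) = some ⟨α, F⟩ ∧
        eval σ (lamAll Δ k') = some ⟨α, G⟩ ∧ TF.InstEq S α Θ L F G) :
    ∃ (α : Arity) (L : TF.Kind T.ar A α) (F G : TF.Abs T.ar A α),
      evalKind σ (K.subst (listSub ks)) = some ⟨α, L⟩ ∧
        eval σ (k.subst (listSub ks)) = some ⟨α, F⟩ ∧
          eval σ (k'.subst (listSub ks)) = some ⟨α, G⟩ ∧ TF.InstEq S α Θ L F G := by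
  induction Δ generalizing ks K k k' with
  | nil =>
    obtain rfl := List.length_eq_zero_iff.1 hlen
    simp only [evalKind_subst, eval_subst, Asg.comp_listSub_nil]
    exact h
  | cons K₀ Δ ih =>
    cases ks with
    | nil => simp at hlen
    | cons l ks =>
      obtain ⟨a, P, F, G, h1, h2, h3, h4⟩ := ih (by simpa using hlen)
        (fun J hJ => hks J (.inr hJ)) (K := .pi K₀ K) (k := .lam K₀ k) (k' := .lam K₀ k') h
      simp only [Expr.subst] at h1 h2 h3
      obtain ⟨α, β, L, M, h5, h6, h7⟩ := evalKind_pi h1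
      cases h7
      obtain ⟨F, hF, rfl⟩ := eval_lam_inv h5 h2
      obtain ⟨G, hG, rfl⟩ := eval_lam_inv h5 h3
      obtain ⟨γ, N, N', H, H', h8, -, h10, h11, -, h13⟩ :=
        (hks _ (.inl rfl)).2 _ _ _ _ hσ
      cases h5.symm.trans h8
      refine ⟨β, TF.Kind.inst [] H M, TF.Expr.employ (.lam F) H, TF.Expr.employ (.lam G) H,
        ?_, ?_, ?_, h4.employ ((TF.reifies S α).mem h10.left h13).1⟩
      · rw [evalKind_subst, Asg.comp_listSub_cons ks h11, ← Asg.comp_liftSub_push,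
          ← evalKind_subst, evalKind_push_id h6]
      · rw [eval_subst, Asg.comp_listSub_cons ks h11, ← Asg.comp_liftSub_push,
          ← eval_subst, eval_push_id hF]
      · rw [eval_subst, Asg.comp_listSub_cons ks h11, ← Asg.comp_liftSub_push,
          ← eval_subst, eval_push_id hG]

theorem ValEq.comp (hS : T.NFSpec S) {Γ : Ctx C} (hΓ : ValCtx S Γ) {d : EqDecl C}
    (hd : d ∈ T.eqns) {ks : List (Obj C)} (hlen : ks.length = d.ctx.length)
    (hks : ∀ J ∈ seqJ Γ ks d.ctx, Valid S J)
    (h : ValEq S Γ (d.lhs.subst (listSub ks)) (d.lhs.subst (listSub ks))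
      (d.kind.subst (listSub ks)))
    (h' : ValEq S Γ (d.rhs.subst (listSub ks)) (d.rhs.subst (listSub ks))
      (d.kind.subst (listSub ks))) :
    ValEq S Γ (d.lhs.subst (listSub ks)) (d.rhs.subst (listSub ks))
      (d.kind.subst (listSub ks)) := by
  intro A Δ σ τ hσ
  obtain ⟨e, he⟩ := hS.2.1 d hd
  have heS : e ∈ S.eqns := by
    rw [hS.2.2]
    exact ⟨d, hd, he⟩
  obtain ⟨a, P, F, G, h1, h2, h3, h4⟩ := instEq_listSub (hσ.left hΓ) hlen hks
    ⟨_, _, _, _, evalKind_of_closed σ (NFKind_iff.1 he.1).2,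
      eval_of_closed σ (NFObj_iff.1 he.2.1).2, eval_of_closed σ (NFObj_iff.1 he.2.2).2,
      TF.InstEq.of_eqn heS Δ⟩
  obtain ⟨α, L, L', F₁, F₁', h5, -, h7, h8, -, h10⟩ := h _ _ _ _ hσ
  obtain ⟨β, M, M', G₁, G₁', h11, h12, h13, h14, h15, h16⟩ := h' _ _ _ _ hσ
  cases h1.symm.trans h5
  cases h1.symm.trans h11
  cases h2.symm.trans h8
  cases h3.symm.trans h14
  have := h4.mem h7.left (h10.left h7) (h16.left h7)
  exact ⟨_, _, _, _, _, h1, h12, h13, h2, h15, this.trans h7 h16⟩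

/-- All derivable judgements of LF hold in the model. -/
theorem Derivable.valid (hS : T.NFSpec S) {J : Judg C} (h : Derivable T J) : Valid S J := by
  induction h with
  | emp => exact trivial
  | ctxt _ ih => exact ih
  | var _ hi ih => exact ⟨ih, .var ih hi⟩
  | kref _ ih => exact ih
  | ksym _ ih => exact ⟨ih.1, ih.2.symm ih.1⟩
  | ktrans _ _ ih ih' => exact ⟨ih.1, ih.2.trans ih.1 ih'.2⟩
  | ref _ ih => exact ih
  | sym _ ih => exact ⟨ih.1, ih.2.symm ih.1⟩
  | trans _ _ ih ih' => exact ⟨ih.1, ih.2.trans ih.1 ih'.2⟩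
  | conv _ _ ih ih' => exact ⟨ih.1, ih.2.conv ih.1 ih'.2⟩
  | conv_eq _ _ ih ih' => exact ⟨ih.1, ih.2.conv ih.1 ih'.2⟩
  | subst_valid _ _ ih ih' => exact ValCtx.inst ih ih'.2
  | subst_kind _ _ ih ih' => exact ⟨ih.1.inst ih'.2, ih.2.inst ih'.2⟩
  | subst_kind_eq _ _ ih ih' => exact ⟨ih.1.inst (ih'.2.left ih'.1), ih.2.inst ih'.2⟩
  | subst_typ _ _ ih ih' => exact ⟨ih.1.inst ih'.2, ih.2.inst ih'.1 ih'.2⟩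
  | subst_typ_eq _ _ ih ih' => exact ⟨ih.1.inst (ih'.2.left ih'.1), ih.2.inst ih'.1 ih'.2⟩
  | subst_keq _ _ ih ih' => exact ⟨ih.1.inst ih'.2, ih.2.inst ih'.2⟩
  | subst_eq _ _ ih ih' => exact ⟨ih.1.inst ih'.2, ih.2.inst ih'.1 ih'.2⟩
  | type _ ih =>
    exact ⟨ih, fun A Δ σ τ hσ => ⟨.zero, .type, .type, rfl, rfl, hσ.valid, trivial⟩⟩
  | el _ ih => exact ⟨ih.1, .el ih.2⟩
  | el_eq _ ih => exact ⟨ih.1, .el ih.2⟩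
  | pi _ _ ih ih' => exact ⟨ih.1, .pi ih.2 ih'.2⟩
  | pi_eq _ _ ih ih' => exact ⟨ih.1, .pi ih.2 ih'.2⟩
  | lam _ ih => exact ⟨ih.1.1, .lam ih.1.1 ih.1.2 ih.2⟩
  | lam_eq _ _ ih ih' => exact ⟨ih.1, .lam ih.1 ih.2 ih'.2⟩
  | app _ _ ih ih' => exact ⟨ih.1, .app ih.1 ih.2 ih'.2⟩
  | app_eq _ _ ih ih' => exact ⟨ih.1, .app ih.1 ih.2 ih'.2⟩
  | beta _ _ ih ih' => exact ⟨ih'.1, .beta ih.1 ih.2 ih'.2⟩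
  | eta _ ih => exact ⟨ih.1, .eta ih.2⟩
  | const c _ _ ih ih' => exact ⟨ih', .con hS c ih.2⟩
  | comp d hd ks hlen _ _ _ ih ih₁ ih₂ => exact ⟨ih₁.1, .comp hS ih₁.1 hd hlen ih ih₁.2 ih₂.2⟩

/-! ### From the model back to TF -/

/-- A context that is well-formed in the model has a normal form, and its own variables are an
instance of it. -/
theorem ValCtx.exists_nfCtx {Γ : Ctx C} (h : ValCtx S Γ) :
    ∃ Γ' : TF.Ctx T.ar Γ.arities, nfCtx T.ar Γ = some Γ' ∧
      EnvEq S Γ' Γ (etaAsg T.ar Γ.arities) (etaAsg T.ar Γ.arities) := by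
  induction Γ with
  | nil => exact ⟨.nil, rfl, .emp_ctxt⟩
  | cons K Γ ih =>
    obtain ⟨Γ', h1, h2⟩ := ih h.1
    obtain ⟨α, L, L', h3, h4, h5⟩ := h.2 _ _ _ _ h2
    have h6 := (nfKind_eq_evalKind (Ctx.arities Γ) K).trans h3
    obtain ⟨L₀, h7, h8⟩ := Option.map_eq_some_iff.1 h6
    cases h8
    refine ⟨Γ'.snoc L₀, by simp only [nfCtx, h1, Option.bind_some, h7]; rfl, ?_⟩
    have := h2.lift h3 h5
    rw [← etaAsg_cons] at this
    exact this

/-- A judgement that holds in the model has a normal form, which consists of derivable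
judgements. -/
theorem Valid.exists_nfJudg {J : Judg C} (h : Valid S J) :
    ∃ s : Set (TF.Judg T.ar), T.NFJudg J s ∧ ∀ j ∈ s, TF.Derivable S j := by
  cases J with
  | valid Γ =>
    obtain ⟨Γ', h1, h2⟩ := ValCtx.exists_nfCtx h
    exact ⟨_, .valid h1, by rintro j rfl; exact h2.valid⟩
  | kind Γ K =>
    obtain ⟨Γ', h1, h2⟩ := h.1.exists_nfCtx
    obtain ⟨α, L, L', h3, h4, h5⟩ := h.2 _ _ _ _ h2
    exact ⟨_, .kind h1 (NFKind_iff.2 ⟨rfl, h3⟩), ((TF.reifies S α).kind h5).1⟩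
  | keq Γ K K' =>
    obtain ⟨Γ', h1, h2⟩ := h.1.exists_nfCtx
    obtain ⟨α, L, L', h3, h4, h5⟩ := h.2 _ _ _ _ h2
    obtain ⟨-, s, hs, hss⟩ := (TF.reifies S α).kind h5
    exact ⟨s, .keq h1 (NFKind_iff.2 ⟨rfl, h3⟩) (NFKind_iff.2 ⟨rfl, h4⟩) hs, hss⟩
  | typ Γ k K =>
    obtain ⟨Γ', h1, h2⟩ := h.1.exists_nfCtx
    obtain ⟨α, L, L', F, G, h3, h4, h5, h6, h7, h8⟩ := h.2 _ _ _ _ h2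
    exact ⟨_, .typ h1 (NFObj_iff.2 ⟨rfl, h6⟩) (NFKind_iff.2 ⟨rfl, h3⟩),
      ((TF.reifies S α).mem h5.left h8).1⟩
  | eq Γ k k' K =>
    obtain ⟨Γ', h1, h2⟩ := h.1.exists_nfCtx
    obtain ⟨α, L, L', F, G, h3, h4, h5, h6, h7, h8⟩ := h.2 _ _ _ _ h2
    exact ⟨_, .eq h1 (NFObj_iff.2 ⟨rfl, h6⟩) (NFObj_iff.2 ⟨rfl, h7⟩) (NFKind_iff.2 ⟨rfl, h3⟩),
      ((TF.reifies S α).mem h5.left h8).2⟩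

end LF

/-- Soundness of the translation `NF` from LF to TF. -/
theorem mainTheorem4 {C : Type u} (T : LF.Spec C) :
    -- 1. `NF` respects arities
    ((∀ (Γ : LF.Ctx C) (K : LF.Kind C) (A : List Arity) (α : Arity) (L : TF.Kind T.ar A α),
        T.NFKind Γ K L → α = K.kindArity) ∧
      (∀ (Γ : LF.Ctx C) (k : LF.Obj C) (α : Arity),
        T.Ar Γ k = some α ↔ ∃ F : TF.Abs T.ar Γ.arities α, T.NFObj Γ k F)) ∧
    -- 2. `NF` respects weakening
    (∀ (Γ Δ : LF.Ctx C) (ρ : ℕ → ℕ),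
      (∀ (i : ℕ) (K : LF.Kind C),
        LF.Ctx.lookup Γ i = some K → LF.Ctx.lookup Δ (ρ i) = some (K.rename ρ)) →
      ∃ ρ' : Ren Γ.arities Δ.arities,
        (∀ (α : Arity) (x : Var Γ.arities α), (ρ' α x).toNat = ρ x.toNat) ∧
        (∀ (k : LF.Obj C) (α : Arity) (F : TF.Abs T.ar Γ.arities α),
          T.NFObj Γ k F → T.NFObj Δ (k.rename ρ) (F.rename ρ')) ∧
        (∀ (K : LF.Kind C) (α : Arity) (L : TF.Kind T.ar Γ.arities α),
          T.NFKind Γ K L → T.NFKind Δ (K.rename ρ) (L.rename ρ')) ∧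
        (∀ (Θ : LF.Ctx C) (D : List Arity) (t : TF.Tele T.ar Γ.arities D),
          T.NFTele Γ Θ t → T.NFTele Δ (LF.Ctx.rename ρ Θ) (t.rename ρ'))) ∧
    -- 3. `NF` commutes with substitution
    (∀ (Γ Δ : LF.Ctx C) (K : LF.Kind C) (k : LF.Obj C)
        (F : TF.Abs T.ar Γ.arities K.kindArity),
      T.Ar Γ k = some K.kindArity → T.NFObj Γ k F →
        (∀ (l : LF.Obj C) (α : Arity)
            (G : TF.Abs T.ar (Δ.arities ++ K.kindArity :: Γ.arities) α),
          T.NFObj (Δ ++ K :: Γ) l G →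
          T.NFObj (LF.Ctx.inst 0 k Δ ++ Γ) (LF.Expr.inst Δ.length k l)
            (TF.Expr.inst Δ.arities F G)) ∧
        (∀ (M : LF.Kind C) (α : Arity)
            (L : TF.Kind T.ar (Δ.arities ++ K.kindArity :: Γ.arities) α),
          T.NFKind (Δ ++ K :: Γ) M L →
          T.NFKind (LF.Ctx.inst 0 k Δ ++ Γ) (LF.Expr.inst Δ.length k M)
            (TF.Kind.inst Δ.arities F L)) ∧
        (∀ (Θ : LF.Ctx C) (D : List Arity)
            (t : TF.Tele T.ar (Δ.arities ++ K.kindArity :: Γ.arities) D),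
          T.NFTele (Δ ++ K :: Γ) Θ t →
          T.NFTele (LF.Ctx.inst 0 k Δ ++ Γ) (LF.Ctx.inst Δ.length k Θ)
            (TF.Tele.inst Δ.arities F t))) ∧
    -- 4. soundness
    (∀ (S : TF.Spec T.ar) (n : ℕ), T.NFSpec S → S.Good n →
      ∀ J : LF.Judg C, LF.Derivable T J → ctxOrder J.ctx.arities ≤ n →
        ∃ s : Set (TF.Judg T.ar), T.NFJudg J s ∧ ∀ j ∈ s, TF.Derivable S j) := by
  refine ⟨⟨fun Γ K A α L h => LF.NFKind_arity h, LF.Ar_eq_some_iff T⟩, LF.NF_rename T, ?_, ?_⟩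
  · intro Γ Δ K k F _ hF
    exact LF.NF_inst T Γ Δ K k F hF
  · intro S n hS _ J hJ _
    exact (hJ.valid hS).exists_nfJudg
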